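/- Let $\Bbbk$ be a field and let $B$ be a bialgebra over $\Bbbk$, with comultiplication $\Delta(b)=b_{(1)}\otimes b_{(2)}$. Let $\mathcal V={}^B\mathbf{Vec}$ be the monoidal category of (arbitrary, not necessarily finite-dimensional) left $B$-comodules, with tensor product $M\otimes_{\Bbbk}N$ and diagonal coaction $m\otimes n\mapsto m_{(-1)}n_{(-1)}\otimes(m_{(0)}\otimes n_{(0)})$, regarded as a left module category over itself. A *lax $\mathcal V$-module endofunctor* of $\mathcal V$ is a functor $F:\mathcal V\to\mathcal V$ with a natural family of morphisms $F_{M,N}:M\otimes F(N)\to F(M\otimes N)$ satisfying the associativity and unit axioms of a module functor; a morphism $F\to G$ is a natural transformation $\varphi$ with $G_{M,N}\circ(M\otimes\varphi_N)=\varphi_{M\otimes N}\circ F_{M,N}$. Let $\mathbf{LexLax}$ be the category of those lax $\mathcal V$-module endofunctors whose underlying functor is $\Bbbk$-linear, left exact and finitary (preserves filtered colimits); it is monoidal under composition, with $(F\circ G)_{M,N}=F(G_{M,N})\circ F_{M,G(N)}$. A *Hopf trimodule* is a $B$-$B$-bicomodule $X$ (with coactions $\lambda_X:X\to B\otimes X$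 and $\rho_X:X\to X\otimes B$) with an associative unital left $B$-action $B\otimes X\to X$ that is a morphism of left and of right $B$-comodules, where $B\otimes X$ carries the diagonal coactions. Morphisms are the linear maps that commute with both coactions and the action; the category is denoted ${}^B_B\mathbf{Vec}^B$. For a left comodule $M$ with coaction $\lambda_M$, the cotensor product $X\square M$ is the equalizer of $\rho_X\otimes M,\;X\otimes\lambda_M:X\otimes M\rightrightarrows X\otimes B\otimes M$, a left comodule by the coaction of $X$. For Hopf trimodules $X,Y$, the cotensor product $X\square Y$ is a Hopf trimodule with the outer coactions and the action $b(x\otimes y)=b_{(1)}x\otimes b_{(2)}y$. This makes ${}^B_B\mathbf{Vec}^B$ a monoidal category with unit $B$, whose associativity and unit isomorphisms are given by restricting $(X\otimes Y)\otimes Z\cong X\otimes(Y\otimes Z)$ and by the inverses of the coactions $X\cong B\square X$, $X\cong X\square B$. **Theorem.** There is a monoidal equivalence $$\Sigma:\left({}^B_B\mathbf{Vec}^B,\square,B\right)\xrightarrow{\ \simeq\ }\mathbf{LexLax},\qquad X\longmapsto(X\square-,\chi),\quad f\longmapsto f\square-,$$ where $$\chi_{M,N}:M\otimes(X\square N)\to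 X\square(M\otimes N),\qquad m\otimes(x\otimes n)\mapsto m_{(-1)}x\otimes(m_{(0)}\otimes n).$$ More precisely, $(X\square-,\chi)$ lies in $\mathbf{LexLax}$ for each Hopf trimodule $X$, the resulting functor $\Sigma$ is an equivalence of categories, and it is a (strong) monoidal functor whose structure isomorphisms $\Sigma(X)\circ\Sigma(Y)\cong\Sigma(X\square Y)$ and $\mathrm{Id}\cong\Sigma(B)$ have as components the associativity isomorphisms $X\square(Y\square M)\cong(X\square Y)\square M$ and the coactions $M\cong B\square M$. -/

import Mathlib

open CategoryTheory MonoidalCategory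
open scoped TensorProduct

universe u

noncomputable section Main

namespace HopfTri

/-! ### Linear algebra -/

section LinearAlgebra

variable {k B M N M' N' V W U U' X Y : Type u} [Field k] [AddCommGroup B] [Module k B]
  [AddCommGroup M] [Module k M] [AddCommGroup N] [Module k N]
  [AddCommGroup M'] [Module k M'] [AddCommGroup N'] [Module k N']
  [AddCommGroup V] [Module k V] [AddCommGroup W] [Module k W]
  [AddCommGroup U] [Module k U] [AddCommGroup U'] [Module k U']
  [AddCommGroup X] [Module k X] [AddCommGroup Y] [Module k Y]

/-- For a bilinear map `a : B × X → Y`, the linear map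
`(B ⊗ M) ⊗ (X ⊗ N) → Y ⊗ (M ⊗ N)`, `(b ⊗ m) ⊗ (x ⊗ n) ↦ a b x ⊗ (m ⊗ n)`. -/
def shuffleL (a : B →ₗ[k] X →ₗ[k] Y) :
    (B ⊗[k] M) ⊗[k] (X ⊗[k] N) →ₗ[k] Y ⊗[k] (M ⊗[k] N) :=
  (TensorProduct.lift a).rTensor (M ⊗[k] N) ∘ₗ
    (TensorProduct.tensorTensorTensorComm k B M X N).toLinearMap

@[simp]
lemma shuffleL_tmul (a : B →ₗ[k] X →ₗ[k] Y) (b : B) (m : M) (x : X) (n : N) :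
    shuffleL a ((b ⊗ₜ[k] m) ⊗ₜ[k] (x ⊗ₜ[k] n)) = a b x ⊗ₜ[k] (m ⊗ₜ[k] n) := by
  simp [shuffleL]

/-- For a bilinear map `a : B × X → Y`, the linear map
`(M ⊗ B) ⊗ (N ⊗ X) → (M ⊗ N) ⊗ Y`, `(m ⊗ b) ⊗ (n ⊗ x) ↦ (m ⊗ n) ⊗ a b x`. -/
def shuffleR (a : B →ₗ[k] X →ₗ[k] Y) :
    (M ⊗[k] B) ⊗[k] (N ⊗[k] X) →ₗ[k] (M ⊗[k] N) ⊗[k] Y :=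
  (TensorProduct.lift a).lTensor (M ⊗[k] N) ∘ₗ
    (TensorProduct.tensorTensorTensorComm k M B N X).toLinearMap

@[simp]
lemma shuffleR_tmul (a : B →ₗ[k] X →ₗ[k] Y) (b : B) (m : M) (x : X) (n : N) :
    shuffleR a ((m ⊗ₜ[k] b) ⊗ₜ[k] (n ⊗ₜ[k] x)) = (m ⊗ₜ[k] n) ⊗ₜ[k] a b x := by
  simp [shuffleR]

lemma shuffleL_nat (a : B →ₗ[k] X →ₗ[k] Y) (f : M →ₗ[k] M') (g : N →ₗ[k] N')
    (s : B ⊗[k] M) (w : X ⊗[k] N) :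
    (TensorProduct.map f g).lTensor Y (shuffleL a (s ⊗ₜ w)) =
      shuffleL a (f.lTensor B s ⊗ₜ g.lTensor X w) := by
  induction s with
  | zero => simp
  | add s t hs ht => simp only [TensorProduct.add_tmul, map_add, hs, ht]
  | tmul b m =>
    induction w with
    | zero => simp
    | add s t hs ht => simp only [TensorProduct.tmul_add, map_add, hs, ht]
    | tmul x n => simp

lemma lTensor_inj {f : V →ₗ[k] W} (hf : Function.Injective f) :
    Function.Injective (f.lTensor X) :=
  Module.Flat.lTensor_preserves_injective_linearMap f hf

lemma rTensor_inj {f : V →ₗ[k] W} (hf : Function.Injective f) :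
    Function.Injective (f.rTensor X) :=
  Module.Flat.rTensor_preserves_injective_linearMap f hf

/-- The equalizer of two linear maps. -/
abbrev Eq2 (f g : V →ₗ[k] W) : Type u := LinearMap.eqLocus f g

/-- The inclusion of the equalizer. -/
abbrev incl (f g : V →ₗ[k] W) : Eq2 f g →ₗ[k] V := (LinearMap.eqLocus f g).subtype

lemma incl_inj (f g : V →ₗ[k] W) : Function.Injective (incl f g) := Subtype.val_injective

lemma incl_mem {f g : V →ₗ[k] W} (z : Eq2 f g) : f (incl f g z) = g (incl f g z) := z.2

lemma exists_lTensor (f g : V →ₗ[k] W) (w : X ⊗[k] V) (h : f.lTensor X w = g.lTensor X w) :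
    ∃ t, (incl f g).lTensor X t = w := by
  have key := Module.Flat.eqLocus_lTensor_eq (R := k) k X f g
  have : w ∈ LinearMap.eqLocus (TensorProduct.AlgebraTensorModule.lTensor k X f)
    (TensorProduct.AlgebraTensorModule.lTensor k X g) := h
  rw [key] at this
  exact this

lemma comm_rTensor (f : V →ₗ[k] W) (w : V ⊗[k] X) :
    TensorProduct.comm k W X (f.rTensor X w) = f.lTensor X (TensorProduct.comm k V X w) := by
  simp [LinearMap.lTensor, LinearMap.rTensor, TensorProduct.map_comm]

lemma exists_rTensor (f g : V →ₗ[k] W) (w : V ⊗[k] X) (h : f.rTensor X w = g.rTensor X w) :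
    ∃ t, (incl f g).rTensor X t = w := by
  obtain ⟨t, ht⟩ := exists_lTensor (X := X) f g (TensorProduct.comm k V X w) (by
    rw [← comm_rTensor, ← comm_rTensor, h])
  refine ⟨(TensorProduct.comm k X _) t, (TensorProduct.comm k V X).injective ?_⟩
  rw [comm_rTensor, ← ht]
  simp

/-- Since `X ⊗ -` is exact, a map `φ` into `X ⊗ V` which is equalized by `X ⊗ f` and `X ⊗ g`
factors uniquely through `X ⊗ eq(f, g)`; this is the factorization. -/
def liftL (f g : V →ₗ[k] W) (φ : U →ₗ[k] X ⊗[k] V)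
    (h : ∀ z, f.lTensor X (φ z) = g.lTensor X (φ z)) : U →ₗ[k] X ⊗[k] Eq2 f g :=
  LinearMap.codRestrictOfInjective φ ((incl f g).lTensor X) (lTensor_inj (incl_inj f g))
    (fun z => exists_lTensor f g (φ z) (h z))

@[simp]
lemma liftL_spec (f g : V →ₗ[k] W) (φ : U →ₗ[k] X ⊗[k] V)
    (h : ∀ z, f.lTensor X (φ z) = g.lTensor X (φ z)) (z : U) :
    (incl f g).lTensor X (liftL f g φ h z) = φ z :=
  LinearMap.codRestrictOfInjective_comp_apply ..

/-- Since `- ⊗ X` is exact, a map `φ` into `V ⊗ X` which is equalized by `f ⊗ X` and `g ⊗ X`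
factors uniquely through `eq(f, g) ⊗ X`; this is the factorization. -/
def liftR (f g : V →ₗ[k] W) (φ : U →ₗ[k] V ⊗[k] X)
    (h : ∀ z, f.rTensor X (φ z) = g.rTensor X (φ z)) : U →ₗ[k] Eq2 f g ⊗[k] X :=
  LinearMap.codRestrictOfInjective φ ((incl f g).rTensor X) (rTensor_inj (incl_inj f g))
    (fun z => exists_rTensor f g (φ z) (h z))

@[simp]
lemma liftR_spec (f g : V →ₗ[k] W) (φ : U →ₗ[k] V ⊗[k] X)
    (h : ∀ z, f.rTensor X (φ z) = g.rTensor X (φ z)) (z : U) :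
    (incl f g).rTensor X (liftR f g φ h z) = φ z :=
  LinearMap.codRestrictOfInjective_comp_apply ..

end LinearAlgebra

/-! ### Left comodules -/

section LComod

variable (k B : Type u) [Field k] [Ring B] [Bialgebra k B]

/-- Left `B`-comodules: a vector space with a coassociative counital coaction `V → B ⊗ V`. -/
structure LComod where
  /-- the underlying vector space -/
  carrier : Type u
  [addCommGroup : AddCommGroup carrier]
  [module : Module k carrier]
  /-- the left coaction -/
  lcoact : carrier →ₗ[k] B ⊗[k] carrier
  lcoassoc : (TensorProduct.assoc k B B carrier).toLinearMap ∘ₗ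
      (Coalgebra.comul (R := k) (A := B)).rTensor carrier ∘ₗ lcoact =
    lcoact.lTensor B ∘ₗ lcoact
  lcounit : (TensorProduct.lid k carrier).toLinearMap ∘ₗ
      (Coalgebra.counit (R := k) (A := B)).rTensor carrier ∘ₗ lcoact = LinearMap.id

attribute [instance] LComod.addCommGroup LComod.module

instance : CoeSort (LComod k B) (Type u) := ⟨LComod.carrier⟩

variable {k B}

namespace LComod

lemma coassoc_apply (M : LComod k B) (m : M) :
    TensorProduct.assoc k B B M ((Coalgebra.comul (R := k) (A := B)).rTensor M (M.lcoact m)) =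
      M.lcoact.lTensor B (M.lcoact m) := DFunLike.congr_fun M.lcoassoc m

lemma counit_apply (M : LComod k B) (m : M) :
    TensorProduct.lid k M ((Coalgebra.counit (R := k) (A := B)).rTensor M (M.lcoact m)) = m :=
  DFunLike.congr_fun M.lcounit m

lemma lcoact_inj (M : LComod k B) : Function.Injective M.lcoact := fun x y h => by
  rw [← M.counit_apply x, ← M.counit_apply y, h]

/-- Morphisms of left comodules: linear maps commuting with the coactions. -/
@[ext]
structure Hom (M N : LComod k B) where
  /-- the underlying linear map -/
  lin : M →ₗ[k] N
  lcomm : N.lcoact ∘ₗ lin = lin.lTensor B ∘ₗ M.lcoact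

instance : Category (LComod k B) where
  Hom := Hom
  id M := ⟨LinearMap.id, by simp⟩
  comp f g := ⟨g.lin ∘ₗ f.lin, by
    rw [← LinearMap.comp_assoc, g.lcomm, LinearMap.comp_assoc, f.lcomm, LinearMap.lTensor_comp,
      LinearMap.comp_assoc]⟩

@[ext]
lemma hom_ext {M N : LComod k B} {f g : M ⟶ N} (h : ∀ m, f.lin m = g.lin m) : f = g :=
  Hom.ext (LinearMap.ext h)

@[simp] lemma id_lin (M : LComod k B) : Hom.lin (𝟙 M) = LinearMap.id := rfl
@[simp] lemma comp_lin {M N P : LComod k B} (f : M ⟶ N) (g : N ⟶ P) :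
    (f ≫ g).lin = g.lin ∘ₗ f.lin := rfl

lemma lcomm_apply {M N : LComod k B} (f : M ⟶ N) (m : M) :
    N.lcoact (f.lin m) = f.lin.lTensor B (M.lcoact m) := DFunLike.congr_fun f.lcomm m

/-- Morphisms of left comodules form a linear subspace of all linear maps. -/
def homSubmodule (M N : LComod k B) : Submodule k (M →ₗ[k] N) where
  carrier := {f | N.lcoact ∘ₗ f = f.lTensor B ∘ₗ M.lcoact}
  add_mem' {f g} hf hg := by
    simp only [Set.mem_ofPred_eq] at *
    rw [LinearMap.comp_add, hf, hg, LinearMap.lTensor_add, LinearMap.add_comp]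
  zero_mem' := by simp
  smul_mem' c f hf := by
    simp only [Set.mem_ofPred_eq] at *
    rw [LinearMap.comp_smul, hf, LinearMap.lTensor_smul, LinearMap.smul_comp]

/-- Morphisms as elements of the subspace. -/
def homEquiv (M N : LComod k B) : (M ⟶ N) ≃ homSubmodule M N where
  toFun f := ⟨f.lin, f.lcomm⟩
  invFun f := ⟨f.1, f.2⟩

instance (M N : LComod k B) : AddCommGroup (M ⟶ N) := (homEquiv M N).addCommGroup
instance (M N : LComod k B) : Module k (M ⟶ N) := (homEquiv M N).module k

@[simp] lemma add_lin {M N : LComod k B} (f g : M ⟶ N) : (f + g).lin = f.lin + g.lin := rfl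
@[simp] lemma smul_lin {M N : LComod k B} (c : k) (f : M ⟶ N) : (c • f).lin = c • f.lin := rfl

instance : Preadditive (LComod k B) where
  add_comp _ _ _ f f' g := by ext; simp
  comp_add _ _ _ f g g' := by ext; simp

instance : Linear k (LComod k B) where
  smul_comp _ _ _ r f g := by ext; simp
  comp_smul _ _ _ f r g := by ext; simp

/-- An isomorphism of comodules from a linear equivalence commuting with the coactions. -/
@[simps] def isoMk {M N : LComod k B} (e : M ≃ₗ[k] N)
    (h : ∀ m, N.lcoact (e m) = e.toLinearMap.lTensor B (M.lcoact m)) : M ≅ N where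
  hom := ⟨e.toLinearMap, LinearMap.ext h⟩
  inv := ⟨e.symm.toLinearMap, LinearMap.ext fun n => by
    obtain ⟨m, rfl⟩ := e.surjective n
    simp [h, ← LinearMap.lTensor_comp_apply]⟩
  hom_inv_id := by ext; simp
  inv_hom_id := by ext; simp

end LComod

/-- The diagonal left coaction on `M ⊗ N`:  `m ⊗ n ↦ m₍₋₁₎ n₍₋₁₎ ⊗ (m₍₀₎ ⊗ n₍₀₎)`. -/
def diagL {M N : Type u} [AddCommGroup M] [Module k M] [AddCommGroup N] [Module k N]
    (f : M →ₗ[k] B ⊗[k] M) (g : N →ₗ[k] B ⊗[k] N) : M ⊗[k] N →ₗ[k] B ⊗[k] (M ⊗[k] N) :=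
  shuffleL (LinearMap.mul k B) ∘ₗ TensorProduct.map f g

/-- The diagonal right coaction on `M ⊗ N`:  `m ⊗ n ↦ (m₍₀₎ ⊗ n₍₀₎) ⊗ m₍₁₎ n₍₁₎`. -/
def diagR {M N : Type u} [AddCommGroup M] [Module k M] [AddCommGroup N] [Module k N]
    (f : M →ₗ[k] M ⊗[k] B) (g : N →ₗ[k] N ⊗[k] B) : M ⊗[k] N →ₗ[k] (M ⊗[k] N) ⊗[k] B :=
  shuffleR (LinearMap.mul k B) ∘ₗ TensorProduct.map f g

section diag

variable {M N : Type u} [AddCommGroup M] [Module k M] [AddCommGroup N] [Module k N]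

@[simp] lemma diagL_tmul (f : M →ₗ[k] B ⊗[k] M) (g : N →ₗ[k] B ⊗[k] N) (m : M) (n : N) :
    diagL f g (m ⊗ₜ n) = shuffleL (LinearMap.mul k B) (f m ⊗ₜ g n) := by simp [diagL]

@[simp] lemma diagR_tmul (f : M →ₗ[k] M ⊗[k] B) (g : N →ₗ[k] N ⊗[k] B) (m : M) (n : N) :
    diagR f g (m ⊗ₜ n) = shuffleR (LinearMap.mul k B) (f m ⊗ₜ g n) := by simp [diagR]

lemma diagL_shuffle (f : M →ₗ[k] B ⊗[k] M) (g : N →ₗ[k] B ⊗[k] N)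
    (s : B ⊗[k] M) (t : B ⊗[k] N) :
    (diagL f g).lTensor B (shuffleL (LinearMap.mul k B) (s ⊗ₜ t)) =
      (shuffleL (LinearMap.mul k B)).lTensor B
        (shuffleL (LinearMap.mul k B) (f.lTensor B s ⊗ₜ g.lTensor B t)) := by
  rw [diagL, LinearMap.lTensor_comp_apply, shuffleL_nat]

lemma comul_shuffle_aux (u v : B ⊗[k] B) (m : M) (n : N) :
    TensorProduct.assoc k B B (M ⊗[k] N) ((u * v) ⊗ₜ (m ⊗ₜ n)) =
      (shuffleL (LinearMap.mul k B)).lTensor B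
        (shuffleL (LinearMap.mul k B) (TensorProduct.assoc k B B M (u ⊗ₜ m) ⊗ₜ
          TensorProduct.assoc k B B N (v ⊗ₜ n))) := by
  induction u with
  | zero => simp
  | add s t hs ht => simp only [TensorProduct.add_tmul, map_add, add_mul, hs, ht]
  | tmul b b' =>
    induction v with
    | zero => simp
    | add s t hs ht =>
      simp only [TensorProduct.tmul_add, TensorProduct.add_tmul, map_add, mul_add, hs, ht]
    | tmul x n => simp

lemma comul_shuffle (s : B ⊗[k] M) (t : B ⊗[k] N) :
    TensorProduct.assoc k B B (M ⊗[k] N) ((Coalgebra.comul (R := k) (A := B)).rTensor _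
      (shuffleL (LinearMap.mul k B) (s ⊗ₜ t))) =
      (shuffleL (LinearMap.mul k B)).lTensor B
        (shuffleL (LinearMap.mul k B)
          (TensorProduct.assoc k B B M ((Coalgebra.comul (R := k) (A := B)).rTensor _ s) ⊗ₜ
          TensorProduct.assoc k B B N ((Coalgebra.comul (R := k) (A := B)).rTensor _ t))) := by
  induction s with
  | zero => simp
  | add s t hs ht => simp only [TensorProduct.add_tmul, map_add, hs, ht]
  | tmul b m =>
    induction t with
    | zero => simp
    | add s t hs ht => simp only [TensorProduct.tmul_add, map_add, hs, ht]
    | tmul x n => simp [comul_shuffle_aux]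

lemma counit_shuffle (s : B ⊗[k] M) (t : B ⊗[k] N) :
    TensorProduct.lid k (M ⊗[k] N) ((Coalgebra.counit (R := k) (A := B)).rTensor _
      (shuffleL (LinearMap.mul k B) (s ⊗ₜ t))) =
    TensorProduct.lid k M ((Coalgebra.counit (R := k) (A := B)).rTensor _ s) ⊗ₜ
      TensorProduct.lid k N ((Coalgebra.counit (R := k) (A := B)).rTensor _ t) := by
  induction s with
  | zero => simp
  | add s t hs ht => simp only [TensorProduct.add_tmul, map_add, hs, ht]
  | tmul b m =>
    induction t with
    | zero => simp
    | add s t hs ht => simp only [TensorProduct.tmul_add, map_add, hs, ht]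
    | tmul x n =>
      simp only [shuffleL_tmul, LinearMap.rTensor_tmul, LinearMap.mul_apply', Bialgebra.counit_mul,
        TensorProduct.lid_tmul, TensorProduct.smul_tmul_smul]

lemma diagL_map {M' N' : Type u} [AddCommGroup M'] [Module k M'] [AddCommGroup N'] [Module k N']
    {f : M →ₗ[k] B ⊗[k] M} {g : N →ₗ[k] B ⊗[k] N} {f' : M' →ₗ[k] B ⊗[k] M'}
    {g' : N' →ₗ[k] B ⊗[k] N'} {φ : M →ₗ[k] M'} {ψ : N →ₗ[k] N'}
    (hφ : f' ∘ₗ φ = φ.lTensor B ∘ₗ f) (hψ : g' ∘ₗ ψ = ψ.lTensor B ∘ₗ g) :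
    diagL f' g' ∘ₗ TensorProduct.map φ ψ = (TensorProduct.map φ ψ).lTensor B ∘ₗ diagL f g := by
  refine TensorProduct.ext' fun m n => ?_
  have h1 := DFunLike.congr_fun hφ m
  have h2 := DFunLike.congr_fun hψ n
  simp only [LinearMap.comp_apply] at h1 h2
  simp only [LinearMap.comp_apply, TensorProduct.map_tmul, diagL_tmul, h1, h2, shuffleL_nat]

lemma diagL_assoc_aux {P : Type u} [AddCommGroup P] [Module k P]
    (s : B ⊗[k] M) (t : B ⊗[k] N) (r : B ⊗[k] P) :
    shuffleL (LinearMap.mul k B) (s ⊗ₜ shuffleL (LinearMap.mul k B) (t ⊗ₜ r)) =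
    (TensorProduct.assoc k M N P).toLinearMap.lTensor B
      (shuffleL (LinearMap.mul k B) (shuffleL (LinearMap.mul k B) (s ⊗ₜ t) ⊗ₜ r)) := by
  induction s with
  | zero => simp
  | add s t hs ht => simp only [TensorProduct.add_tmul, map_add, hs, ht]
  | tmul b m =>
    induction t with
    | zero => simp
    | add s t hs ht => simp only [TensorProduct.tmul_add, TensorProduct.add_tmul, map_add, hs, ht]
    | tmul x n =>
      induction r with
      | zero => simp
      | add s t hs ht => simp only [TensorProduct.tmul_add, map_add, hs, ht]
      | tmul x n => simp [mul_assoc]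

lemma diagL_assoc {P : Type u} [AddCommGroup P] [Module k P] (f : M →ₗ[k] B ⊗[k] M)
    (g : N →ₗ[k] B ⊗[k] N) (h : P →ₗ[k] B ⊗[k] P) :
    diagL f (diagL g h) ∘ₗ (TensorProduct.assoc k M N P).toLinearMap =
      (TensorProduct.assoc k M N P).toLinearMap.lTensor B ∘ₗ diagL (diagL f g) h :=
  TensorProduct.ext_threefold fun m n p => by simp [diagL_assoc_aux]

lemma diagL_lid (f : M →ₗ[k] B ⊗[k] M) :
    f ∘ₗ (TensorProduct.lid k M).toLinearMap =
      (TensorProduct.lid k M).toLinearMap.lTensor B ∘ₗ diagL (TensorProduct.mk k B k 1) f := by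
  refine TensorProduct.ext' fun c m => ?_
  simp only [LinearMap.comp_apply, diagL_tmul, LinearEquiv.coe_coe, TensorProduct.lid_tmul,
    map_smul, TensorProduct.mk_apply]
  induction f m with
  | zero => simp
  | add s t hs ht => simp only [TensorProduct.tmul_add, map_add, hs, ht, smul_add]
  | tmul b n => simp

lemma diagL_rid (f : M →ₗ[k] B ⊗[k] M) :
    f ∘ₗ (TensorProduct.rid k M).toLinearMap =
      (TensorProduct.rid k M).toLinearMap.lTensor B ∘ₗ diagL f (TensorProduct.mk k B k 1) := by
  refine TensorProduct.ext' fun m c => ?_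
  simp only [LinearMap.comp_apply, diagL_tmul, LinearEquiv.coe_coe, TensorProduct.rid_tmul,
    map_smul, TensorProduct.mk_apply]
  induction f m with
  | zero => simp
  | add s t hs ht => simp only [TensorProduct.add_tmul, map_add, hs, ht, smul_add]
  | tmul b n => simp

end diag

namespace LComod

/-- The tensor product of left comodules, with the diagonal coaction. -/
def tensor (M N : LComod k B) : LComod k B where
  carrier := M ⊗[k] N
  lcoact := diagL M.lcoact N.lcoact
  lcoassoc := by
    refine TensorProduct.ext' fun m n => ?_
    simp only [LinearMap.comp_apply, diagL_tmul, LinearEquiv.coe_coe, comul_shuffle, diagL_shuffle,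
      coassoc_apply]
  lcounit := by
    refine TensorProduct.ext' fun m n => ?_
    simp only [LinearMap.comp_apply, diagL_tmul, LinearEquiv.coe_coe, counit_shuffle,
      counit_apply, LinearMap.id_apply]

/-- The trivial comodule `k`, with coaction `1 ↦ 1 ⊗ 1`. -/
def triv : LComod k B where
  carrier := k
  lcoact := TensorProduct.mk k B k 1
  lcoassoc := by ext; simp [Algebra.TensorProduct.one_def]
  lcounit := by ext; simp

/-- The tensor product of morphisms. -/
def tensorMap {M N M' N' : LComod k B} (f : M ⟶ M') (g : N ⟶ N') : tensor M N ⟶ tensor M' N' where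
  lin := TensorProduct.map f.lin g.lin
  lcomm := diagL_map f.lcomm g.lcomm

instance : MonoidalCategoryStruct (LComod k B) where
  tensorObj := tensor
  tensorUnit := triv
  tensorHom := tensorMap
  whiskerLeft M _ _ f := tensorMap (𝟙 M) f
  whiskerRight f M := tensorMap f (𝟙 M)
  associator M N P := isoMk (M := tensor (tensor M N) P) (N := tensor M (tensor N P))
    (TensorProduct.assoc k M N P)
    (DFunLike.congr_fun (diagL_assoc M.lcoact N.lcoact P.lcoact))
  leftUnitor M := isoMk (M := tensor triv M) (TensorProduct.lid k M)
    (DFunLike.congr_fun (diagL_lid M.lcoact))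
  rightUnitor M := isoMk (M := tensor M triv) (TensorProduct.rid k M)
    (DFunLike.congr_fun (diagL_rid M.lcoact))

instance : MonoidalCategory (LComod k B) where
  tensorHom_def _ _ := Hom.ext (TensorProduct.ext' fun _ _ => rfl)
  id_tensorHom_id _ _ := Hom.ext (TensorProduct.ext' fun _ _ => rfl)
  tensorHom_comp_tensorHom _ _ _ _ := Hom.ext (TensorProduct.ext' fun _ _ => rfl)
  whiskerLeft_id _ _ := Hom.ext (TensorProduct.ext' fun _ _ => rfl)
  id_whiskerRight _ _ := Hom.ext (TensorProduct.ext' fun _ _ => rfl)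
  associator_naturality _ _ _ := Hom.ext (TensorProduct.ext_threefold fun _ _ _ => rfl)
  leftUnitor_naturality f := Hom.ext (TensorProduct.ext' fun (c : k) m => (map_smul f.lin c m).symm)
  rightUnitor_naturality f := Hom.ext (TensorProduct.ext' fun m (c : k) => (map_smul f.lin c m).symm)
  pentagon _ _ _ _ := Hom.ext (TensorProduct.ext_fourfold fun _ _ _ _ => rfl)
  triangle _ _ := Hom.ext (TensorProduct.ext_threefold fun m (c : k) n =>
    (TensorProduct.smul_tmul c m n).symm)

end LComod

end LComod

section Bicomod

variable {k B : Type u} [Field k] [Ring B] [Bialgebra k B]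

section Unbundled

variable {X Y M N P : Type u} [AddCommGroup X] [Module k X] [AddCommGroup Y] [Module k Y]
  [AddCommGroup M] [Module k M] [AddCommGroup N] [Module k N] [AddCommGroup P] [Module k P]

/-- `X ⊗ M → X ⊗ B ⊗ M` induced by a right coaction on `X`. -/
def cf (r : X →ₗ[k] X ⊗[k] B) : X ⊗[k] M →ₗ[k] X ⊗[k] (B ⊗[k] M) :=
  (TensorProduct.assoc k X B M).toLinearMap ∘ₗ r.rTensor M

/-- `X ⊗ M → X ⊗ B ⊗ M` induced by a left coaction on `M`. -/
def cg (l : M →ₗ[k] B ⊗[k] M) : X ⊗[k] M →ₗ[k] X ⊗[k] (B ⊗[k] M) := l.lTensor X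

/-- The left coaction on `X ⊗ M` induced by a left coaction on `X`. -/
def coL (l : X →ₗ[k] B ⊗[k] X) : X ⊗[k] M →ₗ[k] B ⊗[k] (X ⊗[k] M) :=
  (TensorProduct.assoc k B X M).toLinearMap ∘ₗ l.rTensor M

/-- The right coaction on `X ⊗ Y` induced by a right coaction on `Y`. -/
def coR (r : Y →ₗ[k] Y ⊗[k] B) : X ⊗[k] Y →ₗ[k] (X ⊗[k] Y) ⊗[k] B :=
  (TensorProduct.assoc k X Y B).symm.toLinearMap ∘ₗ r.lTensor X

@[simp] lemma cf_tmul (r : X →ₗ[k] X ⊗[k] B) (x : X) (m : M) :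
    cf r (x ⊗ₜ[k] m) = TensorProduct.assoc k X B M (r x ⊗ₜ m) := by simp [cf]
@[simp] lemma cg_tmul (l : M →ₗ[k] B ⊗[k] M) (x : X) (m : M) :
    cg l (x ⊗ₜ[k] m) = x ⊗ₜ l m := by simp [cg]
@[simp] lemma coL_tmul (l : X →ₗ[k] B ⊗[k] X) (x : X) (m : M) :
    coL l (x ⊗ₜ[k] m) = TensorProduct.assoc k B X M (l x ⊗ₜ m) := by simp [coL]
@[simp] lemma coR_tmul (r : Y →ₗ[k] Y ⊗[k] B) (x : X) (y : Y) :
    coR r (x ⊗ₜ[k] y) = (TensorProduct.assoc k X Y B).symm (x ⊗ₜ r y) := by simp [coR]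

/-- The cotensor product `X □ M`, the equalizer of the two maps `X ⊗ M ⇉ X ⊗ B ⊗ M`. -/
abbrev Cot (r : X →ₗ[k] X ⊗[k] B) (l : M →ₗ[k] B ⊗[k] M) : Type u :=
  Eq2 (cf (M := M) r) (cg (X := X) l)

/-- The inclusion `X □ M → X ⊗ M`. -/
abbrev inc (r : X →ₗ[k] X ⊗[k] B) (l : M →ₗ[k] B ⊗[k] M) : Cot r l →ₗ[k] X ⊗[k] M :=
  incl (cf (M := M) r) (cg (X := X) l)

lemma inc_inj (r : X →ₗ[k] X ⊗[k] B) (l : M →ₗ[k] B ⊗[k] M) : Function.Injective (inc r l) :=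
  incl_inj _ _

/-! Compatibility of the ambient maps. -/

lemma cf_nat {r : X →ₗ[k] X ⊗[k] B} {r' : Y →ₗ[k] Y ⊗[k] B} {f : X →ₗ[k] Y}
    (hf : r' ∘ₗ f = f.rTensor B ∘ₗ r) (g : M →ₗ[k] N) (z : X ⊗[k] M) :
    cf r' (TensorProduct.map f g z) = TensorProduct.map f (g.lTensor B) (cf r z) := by
  induction z with
  | zero => simp
  | add s t hs ht => simp only [map_add, hs, ht]
  | tmul x m =>
    have := DFunLike.congr_fun hf x
    simp only [LinearMap.comp_apply] at this
    simp only [TensorProduct.map_tmul, cf_tmul, this]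
    induction r x with
    | zero => simp
    | add s t hs ht => simp only [TensorProduct.add_tmul, map_add, hs, ht]
    | tmul x m => simp

lemma cg_nat {l : M →ₗ[k] B ⊗[k] M} {l' : N →ₗ[k] B ⊗[k] N} (f : X →ₗ[k] Y)
    {g : M →ₗ[k] N} (hg : l' ∘ₗ g = g.lTensor B ∘ₗ l) (z : X ⊗[k] M) :
    cg l' (TensorProduct.map f g z) = TensorProduct.map f (g.lTensor B) (cg l z) := by
  induction z with
  | zero => simp
  | add s t hs ht => simp only [map_add, hs, ht]
  | tmul x m =>
    have := DFunLike.congr_fun hg m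
    simp only [LinearMap.comp_apply] at this
    simp only [TensorProduct.map_tmul, cg_tmul, this]

lemma coL_nat {l : X →ₗ[k] B ⊗[k] X} {l' : Y →ₗ[k] B ⊗[k] Y} {f : X →ₗ[k] Y}
    (hf : l' ∘ₗ f = f.lTensor B ∘ₗ l) (g : M →ₗ[k] N) (z : X ⊗[k] M) :
    coL l' (TensorProduct.map f g z) = (TensorProduct.map f g).lTensor B (coL l z) := by
  induction z with
  | zero => simp
  | add s t hs ht => simp only [map_add, hs, ht]
  | tmul x m =>
    have := DFunLike.congr_fun hf x
    simp only [LinearMap.comp_apply] at this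
    simp only [TensorProduct.map_tmul, coL_tmul, this]
    induction l x with
    | zero => simp
    | add s t hs ht => simp only [TensorProduct.add_tmul, map_add, hs, ht]
    | tmul x m => simp

lemma coR_nat {r : M →ₗ[k] M ⊗[k] B} {r' : N →ₗ[k] N ⊗[k] B} (f : X →ₗ[k] Y)
    {g : M →ₗ[k] N} (hg : r' ∘ₗ g = g.rTensor B ∘ₗ r) (z : X ⊗[k] M) :
    coR r' (TensorProduct.map f g z) = (TensorProduct.map f g).rTensor B (coR r z) := by
  induction z with
  | zero => simp
  | add s t hs ht => simp only [map_add, hs, ht]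
  | tmul x m =>
    have := DFunLike.congr_fun hg m
    simp only [LinearMap.comp_apply] at this
    simp only [TensorProduct.map_tmul, coR_tmul, this]
    induction r m with
    | zero => simp
    | add s t hs ht => simp only [TensorProduct.tmul_add, map_add, hs, ht]
    | tmul x m => simp

lemma coL_coassoc {l : X →ₗ[k] B ⊗[k] X}
    (h : (TensorProduct.assoc k B B X).toLinearMap ∘ₗ
      (Coalgebra.comul (R := k) (A := B)).rTensor X ∘ₗ l = l.lTensor B ∘ₗ l) :
    (TensorProduct.assoc k B B (X ⊗[k] M)).toLinearMap ∘ₗ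
      (Coalgebra.comul (R := k) (A := B)).rTensor (X ⊗[k] M) ∘ₗ coL l =
      (coL l).lTensor B ∘ₗ coL l := by
  refine TensorProduct.ext' fun x m => ?_
  have hx := DFunLike.congr_fun h x
  simp only [LinearMap.comp_apply, LinearEquiv.coe_coe] at hx
  have h1 : ∀ t : B ⊗[k] X, (coL (M := M) l).lTensor B (TensorProduct.assoc k B X M (t ⊗ₜ m)) =
      (TensorProduct.assoc k B X M).toLinearMap.lTensor B
        (TensorProduct.assoc k B (B ⊗[k] X) M (l.lTensor B t ⊗ₜ m)) := fun t => by
    induction t with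
    | zero => simp
    | add s t hs ht => simp only [TensorProduct.add_tmul, map_add, hs, ht]
    | tmul x m => simp
  have h2 : ∀ (u : B ⊗[k] B) (x : X),
      TensorProduct.assoc k B B (X ⊗[k] M) (u ⊗ₜ (x ⊗ₜ m)) =
      (TensorProduct.assoc k B X M).toLinearMap.lTensor B
        (TensorProduct.assoc k B (B ⊗[k] X) M (TensorProduct.assoc k B B X (u ⊗ₜ x) ⊗ₜ m)) :=
    fun u x => by
    induction u with
    | zero => simp
    | add s t hs ht => simp only [TensorProduct.add_tmul, map_add, hs, ht]
    | tmul x m => simp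
  have h3 : ∀ t : B ⊗[k] X, TensorProduct.assoc k B B (X ⊗[k] M)
      ((Coalgebra.comul (R := k) (A := B)).rTensor (X ⊗[k] M)
        (TensorProduct.assoc k B X M (t ⊗ₜ m))) =
      (TensorProduct.assoc k B X M).toLinearMap.lTensor B
        (TensorProduct.assoc k B (B ⊗[k] X) M (TensorProduct.assoc k B B X
          ((Coalgebra.comul (R := k) (A := B)).rTensor X t) ⊗ₜ m)) := fun t => by
    induction t with
    | zero => simp
    | add s t hs ht => simp only [TensorProduct.add_tmul, map_add, hs, ht]
    | tmul x m => simp [h2]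
  simp only [LinearMap.comp_apply, LinearEquiv.coe_coe, coL_tmul, h1, h3, hx]

lemma coL_counit {l : X →ₗ[k] B ⊗[k] X}
    (h : (TensorProduct.lid k X).toLinearMap ∘ₗ
      (Coalgebra.counit (R := k) (A := B)).rTensor X ∘ₗ l = LinearMap.id) :
    (TensorProduct.lid k (X ⊗[k] M)).toLinearMap ∘ₗ
      (Coalgebra.counit (R := k) (A := B)).rTensor (X ⊗[k] M) ∘ₗ coL l = LinearMap.id := by
  refine TensorProduct.ext' fun x m => ?_
  have hx := DFunLike.congr_fun h x
  simp only [LinearMap.comp_apply, LinearEquiv.coe_coe, LinearMap.id_apply] at hx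
  have h1 : ∀ t : B ⊗[k] X, TensorProduct.lid k (X ⊗[k] M)
      ((Coalgebra.counit (R := k) (A := B)).rTensor (X ⊗[k] M)
        (TensorProduct.assoc k B X M (t ⊗ₜ m))) =
      TensorProduct.lid k X ((Coalgebra.counit (R := k) (A := B)).rTensor X t) ⊗ₜ m := fun t => by
    induction t with
    | zero => simp
    | add s t hs ht => simp only [TensorProduct.add_tmul, map_add, hs, ht]
    | tmul x m => simp [TensorProduct.smul_tmul']
  simp only [LinearMap.comp_apply, LinearEquiv.coe_coe, coL_tmul, h1, hx, LinearMap.id_apply]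

lemma coR_coassoc {r : Y →ₗ[k] Y ⊗[k] B}
    (h : (TensorProduct.assoc k Y B B).toLinearMap ∘ₗ r.rTensor B ∘ₗ r =
      (Coalgebra.comul (R := k) (A := B)).lTensor Y ∘ₗ r) :
    (TensorProduct.assoc k (X ⊗[k] Y) B B).toLinearMap ∘ₗ (coR r).rTensor B ∘ₗ coR r =
      (Coalgebra.comul (R := k) (A := B)).lTensor (X ⊗[k] Y) ∘ₗ coR r := by
  refine TensorProduct.ext' fun x y => ?_
  have hx := DFunLike.congr_fun h y
  simp only [LinearMap.comp_apply, LinearEquiv.coe_coe] at hx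
  have h0 : ∀ (s : Y ⊗[k] B) (b : B), TensorProduct.assoc k (X ⊗[k] Y) B B
      ((TensorProduct.assoc k X Y B).symm (x ⊗ₜ s) ⊗ₜ b) =
      (TensorProduct.assoc k X Y (B ⊗[k] B)).symm (x ⊗ₜ TensorProduct.assoc k Y B B (s ⊗ₜ b)) :=
    fun s b => by
    induction s with
    | zero => simp
    | add s t hs ht => simp only [TensorProduct.add_tmul, TensorProduct.tmul_add, map_add, hs, ht]
    | tmul x m => simp
  have h1 : ∀ t : Y ⊗[k] B, TensorProduct.assoc k (X ⊗[k] Y) B B ((coR (X := X) r).rTensor B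
      ((TensorProduct.assoc k X Y B).symm (x ⊗ₜ t))) =
      (TensorProduct.assoc k X Y (B ⊗[k] B)).symm
        (x ⊗ₜ TensorProduct.assoc k Y B B (r.rTensor B t)) := fun t => by
    induction t with
    | zero => simp
    | add s t hs ht => simp only [TensorProduct.tmul_add, map_add, hs, ht]
    | tmul x m => simp [h0]
  have h3 : ∀ t : Y ⊗[k] B, (Coalgebra.comul (R := k) (A := B)).lTensor (X ⊗[k] Y)
        ((TensorProduct.assoc k X Y B).symm (x ⊗ₜ t)) =
      (TensorProduct.assoc k X Y (B ⊗[k] B)).symm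
        (x ⊗ₜ (Coalgebra.comul (R := k) (A := B)).lTensor Y t) := fun t => by
    induction t with
    | zero => simp
    | add s t hs ht => simp only [TensorProduct.tmul_add, map_add, hs, ht]
    | tmul x m => simp
  simp only [LinearMap.comp_apply, LinearEquiv.coe_coe, coR_tmul, h1, h3, hx]

lemma coR_counit {r : Y →ₗ[k] Y ⊗[k] B}
    (h : (TensorProduct.rid k Y).toLinearMap ∘ₗ
      (Coalgebra.counit (R := k) (A := B)).lTensor Y ∘ₗ r = LinearMap.id) :
    (TensorProduct.rid k (X ⊗[k] Y)).toLinearMap ∘ₗ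
      (Coalgebra.counit (R := k) (A := B)).lTensor (X ⊗[k] Y) ∘ₗ coR r = LinearMap.id := by
  refine TensorProduct.ext' fun x y => ?_
  have hx := DFunLike.congr_fun h y
  simp only [LinearMap.comp_apply, LinearEquiv.coe_coe, LinearMap.id_apply] at hx
  have h1 : ∀ t : Y ⊗[k] B, TensorProduct.rid k (X ⊗[k] Y)
      ((Coalgebra.counit (R := k) (A := B)).lTensor (X ⊗[k] Y)
        ((TensorProduct.assoc k X Y B).symm (x ⊗ₜ t))) =
      x ⊗ₜ TensorProduct.rid k Y ((Coalgebra.counit (R := k) (A := B)).lTensor Y t) := fun t => by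
    induction t with
    | zero => simp
    | add s t hs ht => simp only [TensorProduct.tmul_add, map_add, hs, ht]
    | tmul x m => simp
  simp only [LinearMap.comp_apply, LinearEquiv.coe_coe, coR_tmul, h1, hx, LinearMap.id_apply]

lemma coL_coR (l : X →ₗ[k] B ⊗[k] X) (r : Y →ₗ[k] Y ⊗[k] B) :
    (coR r).lTensor B ∘ₗ coL l = (TensorProduct.assoc k B (X ⊗[k] Y) B).toLinearMap ∘ₗ
      (coL l).rTensor B ∘ₗ coR r := by
  refine TensorProduct.ext' fun x y => ?_
  have h2 : ∀ (s : B ⊗[k] X), (coR r).lTensor B (TensorProduct.assoc k B X Y (s ⊗ₜ y)) =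
      (TensorProduct.assoc k X Y B).symm.toLinearMap.lTensor B
        (TensorProduct.assoc k B X (Y ⊗[k] B) (s ⊗ₜ r y)) := fun s => by
    induction s with
    | zero => simp
    | add s t hs ht => simp only [TensorProduct.add_tmul, map_add, hs, ht]
    | tmul x m => simp
  have h4 : ∀ (s : B ⊗[k] X) (y : Y) (b : B), TensorProduct.assoc k B (X ⊗[k] Y) B
      (TensorProduct.assoc k B X Y (s ⊗ₜ y) ⊗ₜ b) =
      (TensorProduct.assoc k X Y B).symm.toLinearMap.lTensor B
        (TensorProduct.assoc k B X (Y ⊗[k] B) (s ⊗ₜ (y ⊗ₜ b))) := fun s y b => by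
    induction s with
    | zero => simp
    | add s t hs ht => simp only [TensorProduct.add_tmul, map_add, hs, ht]
    | tmul x m => simp
  have h3 : ∀ (t : Y ⊗[k] B), TensorProduct.assoc k B (X ⊗[k] Y) B ((coL l).rTensor B
      ((TensorProduct.assoc k X Y B).symm (x ⊗ₜ t))) =
      (TensorProduct.assoc k X Y B).symm.toLinearMap.lTensor B
        (TensorProduct.assoc k B X (Y ⊗[k] B) (l x ⊗ₜ t)) := fun s => by
    induction s with
    | zero => simp
    | add s t hs ht => simp only [TensorProduct.tmul_add, map_add, hs, ht]
    | tmul x m => simp [h4]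
  simp only [LinearMap.comp_apply, LinearEquiv.coe_coe, coL_tmul, coR_tmul, h2, h3]

lemma coL_cf {l : X →ₗ[k] B ⊗[k] X} {r : X →ₗ[k] X ⊗[k] B}
    (h : r.lTensor B ∘ₗ l = (TensorProduct.assoc k B X B).toLinearMap ∘ₗ l.rTensor B ∘ₗ r)
    (z : X ⊗[k] M) : (cf r).lTensor B (coL l z) = coL l (cf r z) := by
  induction z with
  | zero => simp
  | add s t hs ht => simp only [map_add, hs, ht]
  | tmul x m =>
    have hx := DFunLike.congr_fun h x
    simp only [LinearMap.comp_apply, LinearEquiv.coe_coe] at hx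
    have h1 : ∀ t : B ⊗[k] X, (cf r).lTensor B (TensorProduct.assoc k B X M (t ⊗ₜ m)) =
        (TensorProduct.assoc k X B M).toLinearMap.lTensor B
          (TensorProduct.assoc k B (X ⊗[k] B) M (r.lTensor B t ⊗ₜ m)) := fun t => by
      induction t with
      | zero => simp
      | add s t hs ht => simp only [TensorProduct.add_tmul, map_add, hs, ht]
      | tmul x m => simp
    have h3 : ∀ (t : B ⊗[k] X) (b : B), TensorProduct.assoc k B X (B ⊗[k] M)
        (t ⊗ₜ (b ⊗ₜ m)) =
        (TensorProduct.assoc k X B M).toLinearMap.lTensor B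
          (TensorProduct.assoc k B (X ⊗[k] B) M (TensorProduct.assoc k B X B (t ⊗ₜ b) ⊗ₜ m)) :=
      fun t b => by
      induction t with
      | zero => simp
      | add s t hs ht => simp only [TensorProduct.add_tmul, map_add, hs, ht]
      | tmul x m => simp
    have h2 : ∀ t : X ⊗[k] B, coL l (TensorProduct.assoc k X B M (t ⊗ₜ m)) =
        (TensorProduct.assoc k X B M).toLinearMap.lTensor B
          (TensorProduct.assoc k B (X ⊗[k] B) M
            (TensorProduct.assoc k B X B (l.rTensor B t) ⊗ₜ m)) := fun t => by
      induction t with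
      | zero => simp
      | add s t hs ht => simp only [TensorProduct.add_tmul, map_add, hs, ht]
      | tmul x m => simp [h3]
    simp only [cf_tmul, coL_tmul, h1, h2, hx]

lemma coL_cg (l : X →ₗ[k] B ⊗[k] X) (l' : M →ₗ[k] B ⊗[k] M)
    (z : X ⊗[k] M) : (cg l').lTensor B (coL l z) = coL l (cg l' z) := by
  induction z with
  | zero => simp
  | add s t hs ht => simp only [map_add, hs, ht]
  | tmul x m =>
    simp only [cg_tmul, coL_tmul]
    induction l x with
    | zero => simp
    | add s t hs ht => simp only [TensorProduct.add_tmul, map_add, hs, ht]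
    | tmul x m => simp

/-- Reassociation `(X ⊗ B ⊗ Y) ⊗ B ≃ X ⊗ B ⊗ (Y ⊗ B)`. -/
def reassoc₃ (X C Y P : Type u) [AddCommGroup X] [Module k X] [AddCommGroup C] [Module k C]
    [AddCommGroup Y] [Module k Y] [AddCommGroup P] [Module k P] :
    (X ⊗[k] (C ⊗[k] Y)) ⊗[k] P ≃ₗ[k] X ⊗[k] (C ⊗[k] (Y ⊗[k] P)) :=
  TensorProduct.assoc k X (C ⊗[k] Y) P ≪≫ₗ
    TensorProduct.congr (LinearEquiv.refl k X) (TensorProduct.assoc k C Y P)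

@[simp] lemma reassoc₃_tmul {C : Type u} [AddCommGroup C] [Module k C] (x : X) (t : C ⊗[k] Y)
    (p : P) : reassoc₃ (k := k) X C Y P ((x ⊗ₜ t) ⊗ₜ p) =
      x ⊗ₜ TensorProduct.assoc k C Y P (t ⊗ₜ p) := by simp [reassoc₃]

lemma cf_assoc (r : X →ₗ[k] X ⊗[k] B) (w : (X ⊗[k] Y) ⊗[k] P) :
    cf r (TensorProduct.assoc k X Y P w) = reassoc₃ X B Y P ((cf r).rTensor P w) := by
  have : cf r ∘ₗ (TensorProduct.assoc k X Y P).toLinearMap =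
      (reassoc₃ X B Y P).toLinearMap ∘ₗ (cf r).rTensor P := by
    refine TensorProduct.ext_threefold fun x y p => ?_
    simp only [LinearMap.comp_apply, LinearEquiv.coe_coe, TensorProduct.assoc_tmul, cf_tmul,
      LinearMap.rTensor_tmul]
    induction r x with
    | zero => simp
    | add s t hs ht => simp only [TensorProduct.add_tmul, map_add, hs, ht]
    | tmul x m => simp
  exact DFunLike.congr_fun this w

lemma coL_assoc (l : Y →ₗ[k] B ⊗[k] Y) (w : (X ⊗[k] Y) ⊗[k] P) :
    (coL l).lTensor X (TensorProduct.assoc k X Y P w) =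
      reassoc₃ X B Y P ((cg l).rTensor P w) := by
  have : (coL l).lTensor X ∘ₗ (TensorProduct.assoc k X Y P).toLinearMap =
      (reassoc₃ X B Y P).toLinearMap ∘ₗ (cg l).rTensor P := by
    refine TensorProduct.ext_threefold fun x y p => ?_
    simp
  exact DFunLike.congr_fun this w

lemma cg_assoc (l : P →ₗ[k] B ⊗[k] P) (w : (X ⊗[k] Y) ⊗[k] P) :
    (cg l).lTensor X (TensorProduct.assoc k X Y P w) =
      TensorProduct.assoc k X Y (B ⊗[k] P) (cg l w) := by
  have : (cg l).lTensor X ∘ₗ (TensorProduct.assoc k X Y P).toLinearMap =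
      (TensorProduct.assoc k X Y (B ⊗[k] P)).toLinearMap ∘ₗ cg l :=
    TensorProduct.ext_threefold fun x y p => by simp
  exact DFunLike.congr_fun this w

lemma coR_assoc (r : Y →ₗ[k] Y ⊗[k] B) (w : (X ⊗[k] Y) ⊗[k] P) :
    (cf r).lTensor X (TensorProduct.assoc k X Y P w) =
      TensorProduct.assoc k X Y (B ⊗[k] P) (cf (coR r) w) := by
  have : (cf r).lTensor X ∘ₗ (TensorProduct.assoc k X Y P).toLinearMap =
      (TensorProduct.assoc k X Y (B ⊗[k] P)).toLinearMap ∘ₗ cf (coR r) := by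
    refine TensorProduct.ext_threefold fun x y p => ?_
    simp only [LinearMap.comp_apply, LinearEquiv.coe_coe, TensorProduct.assoc_tmul, cf_tmul,
      LinearMap.lTensor_tmul, coR_tmul]
    induction r y with
    | zero => simp
    | add s t hs ht => simp only [TensorProduct.add_tmul, TensorProduct.tmul_add, map_add, hs, ht]
    | tmul x m => simp
  exact DFunLike.congr_fun this w

/-! Componentwise actions. -/

section dact

variable {A C R X' Y' : Type u} [AddCommGroup A] [Module k A] [AddCommGroup C] [Module k C]
  [AddCommGroup R] [Module k R]
  [AddCommGroup X'] [Module k X'] [AddCommGroup Y'] [Module k Y']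

/-- The componentwise action of `A ⊗ C` on `X ⊗ Y`. -/
def dact (p : A →ₗ[k] Module.End k X) (q : C →ₗ[k] Module.End k Y) :
    A ⊗[k] C →ₗ[k] Module.End k (X ⊗[k] Y) :=
  TensorProduct.homTensorHomMap (RingHom.id k) X Y X Y ∘ₗ TensorProduct.map p q

@[simp] lemma dact_tmul (p : A →ₗ[k] Module.End k X) (q : C →ₗ[k] Module.End k Y) (a : A) (c : C)
    (x : X) (y : Y) : dact p q (a ⊗ₜ c) (x ⊗ₜ y) = p a x ⊗ₜ q c y := by simp [dact]

lemma dact_eq_shuffleL (p : A →ₗ[k] Module.End k X) (q : C →ₗ[k] Module.End k Y) (u : A ⊗[k] C)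
    (w : X ⊗[k] Y) : (TensorProduct.lift q).lTensor X (shuffleL p (u ⊗ₜ w)) = dact p q u w := by
  induction u with
  | zero => simp
  | add s t hs ht => simp only [TensorProduct.add_tmul, map_add, hs, ht, LinearMap.add_apply]
  | tmul x m =>
    induction w with
    | zero => simp
    | add s t hs ht => simp only [TensorProduct.tmul_add, map_add, hs, ht]
    | tmul y n => simp

lemma dact_eq_shuffleR (p : A →ₗ[k] Module.End k X) (q : C →ₗ[k] Module.End k Y) (u : A ⊗[k] C)
    (w : X ⊗[k] Y) : (TensorProduct.lift p).rTensor Y (shuffleR q (u ⊗ₜ w)) = dact p q u w := by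
  induction u with
  | zero => simp
  | add s t hs ht => simp only [TensorProduct.add_tmul, map_add, hs, ht, LinearMap.add_apply]
  | tmul x m =>
    induction w with
    | zero => simp
    | add s t hs ht => simp only [TensorProduct.tmul_add, map_add, hs, ht]
    | tmul y n => simp

lemma dact_nat (p : A →ₗ[k] Module.End k X) (q : C →ₗ[k] Module.End k Y)
    (p' : A →ₗ[k] Module.End k X') (q' : C →ₗ[k] Module.End k Y') (f : X →ₗ[k] X')
    (g : Y →ₗ[k] Y') (hf : ∀ a x, f (p a x) = p' a (f x)) (hg : ∀ a x, g (q a x) = q' a (g x))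
    (u : A ⊗[k] C) (w : X ⊗[k] Y) :
    TensorProduct.map f g (dact p q u w) = dact p' q' u (TensorProduct.map f g w) := by
  induction u with
  | zero => simp
  | add s t hs ht => simp only [map_add, hs, ht, LinearMap.add_apply]
  | tmul x m =>
    induction w with
    | zero => simp
    | add s t hs ht => simp only [map_add, hs, ht]
    | tmul y n => simp [hf, hg]

lemma dact_assoc (p : A →ₗ[k] Module.End k X) (q : C →ₗ[k] Module.End k Y)
    (r : R →ₗ[k] Module.End k P) (u : (A ⊗[k] C) ⊗[k] R) (w : (X ⊗[k] Y) ⊗[k] P) :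
    TensorProduct.assoc k X Y P (dact (dact p q) r u w) =
      dact p (dact q r) (TensorProduct.assoc k A C R u) (TensorProduct.assoc k X Y P w) := by
  induction u with
  | zero => simp
  | add s t hs ht => simp only [map_add, hs, ht, LinearMap.add_apply]
  | tmul u m =>
    induction u with
    | zero => simp
    | add s t hs ht => simp only [TensorProduct.add_tmul, map_add, hs, ht, LinearMap.add_apply]
    | tmul u m' =>
      have : (TensorProduct.assoc k X Y P).toLinearMap ∘ₗ (dact (dact p q) r ((u ⊗ₜ m') ⊗ₜ m)) =
        dact p (dact q r) (u ⊗ₜ (m' ⊗ₜ m)) ∘ₗ (TensorProduct.assoc k X Y P).toLinearMap :=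
        TensorProduct.ext_threefold fun x y z => by simp
      exact DFunLike.congr_fun this w

lemma dact_rT {p : A →ₗ[k] Module.End k X} {p' : R →ₗ[k] Module.End k X'}
    (q : C →ₗ[k] Module.End k Y) {f : X →ₗ[k] X'} {φ : A →ₗ[k] R}
    (h : ∀ a x, f (p a x) = p' (φ a) (f x)) (u : A ⊗[k] C) (w : X ⊗[k] Y) :
    f.rTensor Y (dact p q u w) = dact p' q (φ.rTensor C u) (f.rTensor Y w) := by
  induction u with
  | zero => simp
  | add s t hs ht => simp only [map_add, hs, ht, LinearMap.add_apply]
  | tmul x m =>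
    induction w with
    | zero => simp
    | add s t hs ht => simp only [map_add, hs, ht]
    | tmul y n => simp [h]

lemma dact_lT (p : A →ₗ[k] Module.End k X) {q : C →ₗ[k] Module.End k Y}
    {q' : R →ₗ[k] Module.End k Y'} {f : Y →ₗ[k] Y'} {φ : C →ₗ[k] R}
    (h : ∀ a x, f (q a x) = q' (φ a) (f x)) (u : A ⊗[k] C) (w : X ⊗[k] Y) :
    f.lTensor X (dact p q u w) = dact p q' (φ.lTensor A u) (f.lTensor X w) := by
  induction u with
  | zero => simp
  | add s t hs ht => simp only [map_add, hs, ht, LinearMap.add_apply]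
  | tmul x m =>
    induction w with
    | zero => simp
    | add s t hs ht => simp only [map_add, hs, ht]
    | tmul y n => simp [h]

end dact

end Unbundled

/-! ### Bicomodules and Hopf trimodules -/

variable (k B) in
/-- `B`-`B`-bicomodules: left comodules with a commuting coassociative counital right coaction. -/
structure Bicomod extends LComod k B where
  /-- the right coaction -/
  rcoact : carrier →ₗ[k] carrier ⊗[k] B
  rcoassoc : (TensorProduct.assoc k carrier B B).toLinearMap ∘ₗ rcoact.rTensor B ∘ₗ rcoact =
    (Coalgebra.comul (R := k) (A := B)).lTensor carrier ∘ₗ rcoact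
  rcounit : (TensorProduct.rid k carrier).toLinearMap ∘ₗ
    (Coalgebra.counit (R := k) (A := B)).lTensor carrier ∘ₗ rcoact = LinearMap.id
  bicomm : rcoact.lTensor B ∘ₗ lcoact =
    (TensorProduct.assoc k B carrier B).toLinearMap ∘ₗ lcoact.rTensor B ∘ₗ rcoact

instance : CoeSort (Bicomod k B) (Type u) := ⟨fun X => X.carrier⟩

variable (k B) in
/-- Hopf trimodules: bicomodules `X` with a left `B`-action such that the action map
`B ⊗ X → X` is a morphism of left and of right comodules, where `B ⊗ X` carries the diagonal
coactions. -/
structure HopfTrimodule extends Bicomod k B where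
  /-- the (associative and unital) left action -/
  act : B →ₐ[k] Module.End k carrier
  act_lcoact : lcoact ∘ₗ TensorProduct.lift act.toLinearMap =
    (TensorProduct.lift act.toLinearMap).lTensor B ∘ₗ
      diagL (Coalgebra.comul (R := k) (A := B)) lcoact
  act_rcoact : rcoact ∘ₗ TensorProduct.lift act.toLinearMap =
    (TensorProduct.lift act.toLinearMap).rTensor B ∘ₗ
      diagR (Coalgebra.comul (R := k) (A := B)) rcoact

instance : CoeSort (HopfTrimodule k B) (Type u) := ⟨fun X => X.carrier⟩

namespace HopfTrimodule

/-- The action as a linear map. -/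
abbrev actL (X : HopfTrimodule k B) : B →ₗ[k] Module.End k X := X.act.toLinearMap

lemma lact (X : HopfTrimodule k B) (b : B) (x : X) : X.lcoact (X.actL b x) =
    dact (LinearMap.mul k B) X.actL (Coalgebra.comul b) (X.lcoact x) := by
  have := DFunLike.congr_fun X.act_lcoact (b ⊗ₜ x)
  simp only [LinearMap.comp_apply, diagL_tmul, TensorProduct.lift.tmul] at this
  rw [this]
  exact dact_eq_shuffleL (LinearMap.mul k B) _ _ _

lemma ract (X : HopfTrimodule k B) (b : B) (x : X) : X.rcoact (X.actL b x) =
    dact X.actL (LinearMap.mul k B) (Coalgebra.comul b) (X.rcoact x) := by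
  have := DFunLike.congr_fun X.act_rcoact (b ⊗ₜ x)
  simp only [LinearMap.comp_apply, diagR_tmul, TensorProduct.lift.tmul] at this
  rw [this]
  exact dact_eq_shuffleR _ (LinearMap.mul k B) _ _

/-- Morphisms of Hopf trimodules: linear maps commuting with both coactions and the action. -/
@[ext]
structure Hom (X Y : HopfTrimodule k B) where
  /-- the underlying linear map -/
  lin : X →ₗ[k] Y
  lcomm : Y.lcoact ∘ₗ lin = lin.lTensor B ∘ₗ X.lcoact
  rcomm : Y.rcoact ∘ₗ lin = lin.rTensor B ∘ₗ X.rcoact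
  acomm : ∀ b x, lin (X.actL b x) = Y.actL b (lin x)

/-- Composition of morphisms. -/
def Hom.comp {X Y Z : HopfTrimodule k B} (f : Hom X Y) (g : Hom Y Z) : Hom X Z where
  lin := g.lin ∘ₗ f.lin
  lcomm := by
    rw [← LinearMap.comp_assoc, g.lcomm, LinearMap.comp_assoc, f.lcomm, LinearMap.lTensor_comp,
      LinearMap.comp_assoc]
  rcomm := by
    rw [← LinearMap.comp_assoc, g.rcomm, LinearMap.comp_assoc, f.rcomm, LinearMap.rTensor_comp,
      LinearMap.comp_assoc]
  acomm b x := by rw [LinearMap.comp_apply, f.acomm, g.acomm, LinearMap.comp_apply]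

instance : Category (HopfTrimodule k B) where
  Hom := Hom
  id X := ⟨LinearMap.id, by simp, by simp, by simp⟩
  comp := Hom.comp

/-- The underlying morphism of left comodules. -/
def Hom.toL {X Y : HopfTrimodule k B} (f : X ⟶ Y) : X.toLComod ⟶ Y.toLComod := ⟨f.lin, f.lcomm⟩

/-- An isomorphism of trimodules from a morphism with bijective underlying map. -/
def isoMk {X Y : HopfTrimodule k B} (f : X ⟶ Y) (e : X ≃ₗ[k] Y) (h : e.toLinearMap = f.lin) :
    X ≅ Y where
  hom := f
  inv := by
    have hf : ∀ y, f.lin (e.symm y) = y := fun y => by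
      rw [← h]; exact e.apply_symm_apply y
    have hc : f.lin ∘ₗ e.symm.toLinearMap = LinearMap.id := LinearMap.ext hf
    have hd : e.symm.toLinearMap ∘ₗ f.lin = LinearMap.id := by
      rw [← h]; exact LinearMap.ext e.symm_apply_apply
    refine ⟨e.symm.toLinearMap, ?_, ?_, ?_⟩
    · have := congrArg (fun t => e.symm.toLinearMap.lTensor B ∘ₗ t ∘ₗ e.symm.toLinearMap) f.lcomm
      simp only [LinearMap.comp_assoc, hc, LinearMap.comp_id] at this
      rw [this, ← LinearMap.comp_assoc, ← LinearMap.lTensor_comp, hd]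
      simp
    · have := congrArg (fun t => e.symm.toLinearMap.rTensor B ∘ₗ t ∘ₗ e.symm.toLinearMap) f.rcomm
      simp only [LinearMap.comp_assoc, hc, LinearMap.comp_id] at this
      rw [this, ← LinearMap.comp_assoc, ← LinearMap.rTensor_comp, hd]
      simp
    · intro b y
      have := f.acomm b (e.symm y)
      rw [hf] at this
      have h2 := congrArg e.symm this
      have h3 := DFunLike.congr_fun hd (X.actL b (e.symm y))
      exact h2.symm.trans h3
  hom_inv_id := Hom.ext (by
    change e.symm.toLinearMap ∘ₗ f.lin = LinearMap.id
    rw [← h]; exact LinearMap.ext e.symm_apply_apply)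
  inv_hom_id := Hom.ext (by
    change f.lin ∘ₗ e.symm.toLinearMap = LinearMap.id
    rw [← h]; exact LinearMap.ext e.apply_symm_apply)

end HopfTrimodule

/-! ### Subobjects cut out by injective maps -/

/-- A linear subspace stable under the coaction is a comodule. -/
def LComod.ofInj (W : LComod k B) {E : Type u} [AddCommGroup E] [Module k E] (i : E →ₗ[k] W)
    (hi : Function.Injective i) (c : E →ₗ[k] B ⊗[k] E)
    (h : ∀ z, i.lTensor B (c z) = W.lcoact (i z)) : LComod k B where
  carrier := E
  lcoact := c
  lcoassoc := by
    refine LinearMap.ext fun z => lTensor_inj (lTensor_inj hi) ?_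
    have h' : i.lTensor B ∘ₗ c = W.lcoact ∘ₗ i := LinearMap.ext h
    have h1 : ∀ t : B ⊗[k] E, (i.lTensor B).lTensor B (c.lTensor B t) =
        W.lcoact.lTensor B (i.lTensor B t) := fun t => by
      rw [← LinearMap.lTensor_comp_apply, h', LinearMap.lTensor_comp_apply]
    have h2 : ∀ t : (B ⊗[k] B) ⊗[k] E,
        (i.lTensor B).lTensor B (TensorProduct.assoc k B B E t) =
        TensorProduct.assoc k B B W (i.lTensor (B ⊗[k] B) t) := fun t => by
      refine DFunLike.congr_fun (f := (i.lTensor B).lTensor B ∘ₗ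
        (TensorProduct.assoc k B B E).toLinearMap) (g :=
        (TensorProduct.assoc k B B W).toLinearMap ∘ₗ (i.lTensor (B ⊗[k] B))) ?_ t
      exact TensorProduct.ext_threefold fun _ _ _ => rfl
    have h3 : ∀ t : B ⊗[k] E, i.lTensor (B ⊗[k] B)
        ((Coalgebra.comul (R := k) (A := B)).rTensor E t) =
        (Coalgebra.comul (R := k) (A := B)).rTensor W (i.lTensor B t) := fun t => by
      rw [← LinearMap.comp_apply, ← LinearMap.comp_apply, LinearMap.lTensor_comp_rTensor,
        LinearMap.rTensor_comp_lTensor]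
    simp only [LinearMap.comp_apply, LinearEquiv.coe_coe]
    rw [h1, h2, h3, h, W.coassoc_apply]
  lcounit := by
    refine LinearMap.ext fun z => hi ?_
    have h2 : ∀ t : B ⊗[k] E, i (TensorProduct.lid k E
        ((Coalgebra.counit (R := k) (A := B)).rTensor E t)) =
        TensorProduct.lid k W ((Coalgebra.counit (R := k) (A := B)).rTensor W (i.lTensor B t)) :=
      fun t => by
      induction t with
      | zero => simp
      | add s t hs ht => simp only [map_add, hs, ht]
      | tmul x m => simp
    simp only [LinearMap.comp_apply, LinearEquiv.coe_coe, LinearMap.id_apply]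
    rw [h2, h, W.counit_apply]

/-- A linear subspace of a bicomodule stable under the coactions is a bicomodule. -/
def Bicomod.ofInj (W : Bicomod k B) (E : LComod k B) (i : E →ₗ[k] W)
    (hi : Function.Injective i) (h : ∀ z, i.lTensor B (E.lcoact z) = W.lcoact (i z))
    (c : E →ₗ[k] E ⊗[k] B) (hc : ∀ z, i.rTensor B (c z) = W.rcoact (i z)) : Bicomod k B where
  toLComod := E
  rcoact := c
  rcoassoc := by
    refine LinearMap.ext fun z => rTensor_inj hi ?_
    have h' : i.rTensor B ∘ₗ c = W.rcoact ∘ₗ i := LinearMap.ext hc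
    have h2 : ∀ t : (E ⊗[k] B) ⊗[k] B,
        i.rTensor (B ⊗[k] B) (TensorProduct.assoc k E B B t) =
        TensorProduct.assoc k W B B ((i.rTensor B).rTensor B t) := fun t => by
      refine DFunLike.congr_fun (f := i.rTensor (B ⊗[k] B) ∘ₗ
        (TensorProduct.assoc k E B B).toLinearMap) (g :=
        (TensorProduct.assoc k W B B).toLinearMap ∘ₗ ((i.rTensor B).rTensor B)) ?_ t
      exact TensorProduct.ext_threefold fun _ _ _ => rfl
    have h3 : ∀ t : E ⊗[k] B, i.rTensor (B ⊗[k] B)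
        ((Coalgebra.comul (R := k) (A := B)).lTensor E t) =
        (Coalgebra.comul (R := k) (A := B)).lTensor W (i.rTensor B t) := fun t => by
      rw [← LinearMap.comp_apply, ← LinearMap.comp_apply, LinearMap.lTensor_comp_rTensor,
        LinearMap.rTensor_comp_lTensor]
    have h4 := DFunLike.congr_fun W.rcoassoc (i z)
    simp only [LinearMap.comp_apply, LinearEquiv.coe_coe] at h4 ⊢
    rw [h2, h3, hc, ← h4, ← LinearMap.rTensor_comp_apply, h', LinearMap.rTensor_comp_apply, hc]
  rcounit := by
    refine LinearMap.ext fun z => hi ?_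
    have h2 : ∀ t : E ⊗[k] B, i (TensorProduct.rid k E
        ((Coalgebra.counit (R := k) (A := B)).lTensor E t)) =
        TensorProduct.rid k W ((Coalgebra.counit (R := k) (A := B)).lTensor W (i.rTensor B t)) :=
      fun t => by
      induction t with
      | zero => simp
      | add s t hs ht => simp only [map_add, hs, ht]
      | tmul x m => simp
    have h4 := DFunLike.congr_fun W.rcounit (i z)
    simp only [LinearMap.comp_apply, LinearEquiv.coe_coe, LinearMap.id_apply] at h4 ⊢
    rw [h2, hc, h4]
  bicomm := by
    refine LinearMap.ext fun z => lTensor_inj (X := B) (rTensor_inj (X := B) hi) ?_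
    have h' : i.rTensor B ∘ₗ c = W.rcoact ∘ₗ i := LinearMap.ext hc
    have h'' : i.lTensor B ∘ₗ E.lcoact = W.lcoact ∘ₗ i := LinearMap.ext h
    have h2 : ∀ t : (B ⊗[k] E) ⊗[k] B,
        (i.rTensor B).lTensor B (TensorProduct.assoc k B E B t) =
        TensorProduct.assoc k B W B ((i.lTensor B).rTensor B t) := fun t => by
      refine DFunLike.congr_fun (f := (i.rTensor B).lTensor B ∘ₗ
        (TensorProduct.assoc k B E B).toLinearMap) (g :=
        (TensorProduct.assoc k B W B).toLinearMap ∘ₗ ((i.lTensor B).rTensor B)) ?_ t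
      exact TensorProduct.ext_threefold fun _ _ _ => rfl
    have h4 := DFunLike.congr_fun W.bicomm (i z)
    simp only [LinearMap.comp_apply, LinearEquiv.coe_coe] at h4 ⊢
    rw [h2, ← LinearMap.lTensor_comp_apply, h', ← LinearMap.rTensor_comp_apply, h'',
      LinearMap.rTensor_comp_apply, hc, ← h4, LinearMap.lTensor_comp_apply, h]

namespace HopfTrimodule

/-- A linear subspace of a Hopf trimodule stable under all operations is a Hopf trimodule. -/
def ofInj (W : HopfTrimodule k B) (E : Bicomod k B) (i : E →ₗ[k] W)
    (hi : Function.Injective i) (h : ∀ z, i.lTensor B (E.lcoact z) = W.lcoact (i z))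
    (hc : ∀ z, i.rTensor B (E.rcoact z) = W.rcoact (i z)) (a : B →ₗ[k] Module.End k E)
    (ha : ∀ b z, i (a b z) = W.actL b (i z)) : HopfTrimodule k B where
  toBicomod := E
  act := AlgHom.ofLinearMap a
    (LinearMap.ext fun z => hi (by rw [ha]; simp))
    (fun b b' => LinearMap.ext fun z => hi (by rw [ha]; simp [ha]))
  act_lcoact := by
    refine TensorProduct.ext' fun b z => lTensor_inj hi ?_
    have e1 := dact_eq_shuffleL (LinearMap.mul k B) a (Coalgebra.comul b) (E.lcoact z)
    have e2 := dact_lT (LinearMap.mul k B) (f := i) (φ := LinearMap.id) ha (Coalgebra.comul b)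
      (E.lcoact z)
    simp only [LinearMap.comp_apply, TensorProduct.lift.tmul, diagL_tmul,
      AlgHom.toLinearMap_ofLinearMap]
    rw [h, ha, W.lact, ← h]
    refine Eq.trans ?_ (congrArg (i.lTensor B) e1).symm
    rw [e2]; simp
  act_rcoact := by
    refine TensorProduct.ext' fun b z => rTensor_inj hi ?_
    have e1 := dact_eq_shuffleR a (LinearMap.mul k B) (Coalgebra.comul b) (E.rcoact z)
    have e2 := dact_rT (LinearMap.mul k B) (f := i) (φ := LinearMap.id) ha (Coalgebra.comul b)
      (E.rcoact z)
    simp only [LinearMap.comp_apply, TensorProduct.lift.tmul, diagR_tmul,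
      AlgHom.toLinearMap_ofLinearMap]
    rw [hc, ha, W.ract, ← hc]
    refine Eq.trans ?_ (congrArg (i.rTensor B) e1).symm
    rw [e2]; simp

end HopfTrimodule

/-! ### The cotensor product -/

section CotUnbundled

variable {X Y M N P X' Y' : Type u} [AddCommGroup X] [Module k X] [AddCommGroup Y] [Module k Y]
  [AddCommGroup M] [Module k M] [AddCommGroup N] [Module k N] [AddCommGroup P] [Module k P]
  [AddCommGroup X'] [Module k X'] [AddCommGroup Y'] [Module k Y']

/-- The map `f □ g` on cotensor products. -/
def cotMap {rX : X →ₗ[k] X ⊗[k] B} {rY : Y →ₗ[k] Y ⊗[k] B} {lM : M →ₗ[k] B ⊗[k] M}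
    {lN : N →ₗ[k] B ⊗[k] N} (f : X →ₗ[k] Y) (hf : rY ∘ₗ f = f.rTensor B ∘ₗ rX) (g : M →ₗ[k] N)
    (hg : lN ∘ₗ g = g.lTensor B ∘ₗ lM) : Cot rX lM →ₗ[k] Cot rY lN :=
  (TensorProduct.map f g ∘ₗ inc rX lM).codRestrict _ (fun z => by
    change cf rY (TensorProduct.map f g (inc rX lM z)) = cg lN (TensorProduct.map f g (inc rX lM z))
    rw [cf_nat hf, cg_nat f hg, incl_mem])

lemma inc_cotMap {rX : X →ₗ[k] X ⊗[k] B} {rY : Y →ₗ[k] Y ⊗[k] B} {lM : M →ₗ[k] B ⊗[k] M}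
    {lN : N →ₗ[k] B ⊗[k] N} (f : X →ₗ[k] Y) (hf : rY ∘ₗ f = f.rTensor B ∘ₗ rX) (g : M →ₗ[k] N)
    (hg : lN ∘ₗ g = g.lTensor B ∘ₗ lM) (z : Cot rX lM) :
    inc rY lN (cotMap f hf g hg z) = TensorProduct.map f g (inc rX lM z) := rfl

section assoc

variable {rX : X →ₗ[k] X ⊗[k] B} {lY : Y →ₗ[k] B ⊗[k] Y} {rY : Y →ₗ[k] Y ⊗[k] B}
  {lP : P →ₗ[k] B ⊗[k] P} {r : Cot rX lY →ₗ[k] Cot rX lY ⊗[k] B}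
  {l : Cot rY lP →ₗ[k] B ⊗[k] Cot rY lP}

variable (r lP) in
/-- The inclusion `(X □ Y) □ P → (X ⊗ Y) ⊗ P`. -/
def incLeft : Cot r lP →ₗ[k] (X ⊗[k] Y) ⊗[k] P := (inc rX lY).rTensor P ∘ₗ inc r lP

variable (rX l) in
/-- The inclusion `X □ (Y □ P) → X ⊗ (Y ⊗ P)`. -/
def incRight : Cot rX l →ₗ[k] X ⊗[k] (Y ⊗[k] P) := (inc rY lP).lTensor X ∘ₗ inc rX l

lemma incLeft_inj : Function.Injective (incLeft lP r) :=
  (rTensor_inj (inc_inj rX lY)).comp (inc_inj r lP)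

lemma incRight_inj : Function.Injective (incRight rX l) :=
  (lTensor_inj (inc_inj rY lP)).comp (inc_inj rX l)

lemma mem_range_incLeft (hr : ∀ z, (inc rX lY).rTensor B (r z) = coR rY (inc rX lY z))
    (w : (X ⊗[k] Y) ⊗[k] P) : w ∈ LinearMap.range (incLeft lP r) ↔
      (cf rX).rTensor P w = (cg lY).rTensor P w ∧ cf (coR rY) w = cg lP w := by
  have hr' : coR rY ∘ₗ inc rX lY = (inc rX lY).rTensor B ∘ₗ r := LinearMap.ext fun z => (hr z).symm
  have e1 : ∀ t : Cot rX lY ⊗[k] P, cf (coR rY) ((inc rX lY).rTensor P t) =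
      (inc rX lY).rTensor _ (cf r t) := fun t => by
    simpa [LinearMap.rTensor] using cf_nat hr' (LinearMap.id (M := P)) t
  have e2 : ∀ t : Cot rX lY ⊗[k] P, cg lP ((inc rX lY).rTensor P t) =
      (inc rX lY).rTensor _ (cg lP t) := fun t => by
    simpa [LinearMap.rTensor] using
      cg_nat (l := lP) (l' := lP) (inc rX lY) (g := LinearMap.id) (by simp) t
  constructor
  · rintro ⟨z, rfl⟩
    refine ⟨?_, ?_⟩
    · have : cf rX ∘ₗ inc rX lY = cg lY ∘ₗ inc rX lY := LinearMap.ext incl_mem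
      simp only [incLeft, LinearMap.comp_apply]
      rw [← LinearMap.rTensor_comp_apply, this, LinearMap.rTensor_comp_apply]
    · simp only [incLeft, LinearMap.comp_apply]
      rw [e1, e2]; exact congrArg _ (incl_mem z)
  · rintro ⟨h1, h2⟩
    obtain ⟨t, rfl⟩ := exists_rTensor _ _ w h1
    refine ⟨⟨t, rTensor_inj (inc_inj rX lY) ?_⟩, rfl⟩
    rw [← e1, ← e2]; exact h2

lemma mem_range_incRight (hl : ∀ z, (inc rY lP).lTensor B (l z) = coL lY (inc rY lP z))
    (w : X ⊗[k] (Y ⊗[k] P)) : w ∈ LinearMap.range (incRight rX l) ↔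
      cf rX w = (coL lY).lTensor X w ∧ (cf rY).lTensor X w = (cg lP).lTensor X w := by
  have hl' : coL lY ∘ₗ inc rY lP = (inc rY lP).lTensor B ∘ₗ l := LinearMap.ext fun z => (hl z).symm
  have e1 : ∀ t : X ⊗[k] Cot rY lP, cf rX ((inc rY lP).lTensor X t) =
      ((inc rY lP).lTensor B).lTensor X (cf rX t) := fun t => by
    simpa [LinearMap.lTensor] using
      cf_nat (r := rX) (r' := rX) (f := LinearMap.id) (by simp) (inc rY lP) t
  have e2 : ∀ t : X ⊗[k] Cot rY lP, (coL lY).lTensor X ((inc rY lP).lTensor X t) =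
      ((inc rY lP).lTensor B).lTensor X (cg l t) := fun t => by
    rw [← LinearMap.lTensor_comp_apply, hl', LinearMap.lTensor_comp_apply]; rfl
  constructor
  · rintro ⟨z, rfl⟩
    refine ⟨?_, ?_⟩
    · simp only [incRight, LinearMap.comp_apply]
      rw [e1, e2, incl_mem]
    · have : cf rY ∘ₗ inc rY lP = cg lP ∘ₗ inc rY lP := LinearMap.ext incl_mem
      simp only [incRight, LinearMap.comp_apply]
      rw [← LinearMap.lTensor_comp_apply, this, LinearMap.lTensor_comp_apply]
  · rintro ⟨h1, h2⟩
    obtain ⟨t, rfl⟩ := exists_lTensor _ _ w h2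
    refine ⟨⟨t, lTensor_inj (lTensor_inj (inc_inj rY lP)) ?_⟩, rfl⟩
    rw [← e1, ← e2]; exact h1

/-- The associativity isomorphism `(X □ Y) □ P ≃ X □ (Y □ P)`, restricted from the one of the
tensor product over `k`. -/
def cotAssoc (hr : ∀ z, (inc rX lY).rTensor B (r z) = coR rY (inc rX lY z))
    (hl : ∀ z, (inc rY lP).lTensor B (l z) = coL lY (inc rY lP z)) : Cot r lP ≃ₗ[k] Cot rX l :=
  LinearEquiv.ofInjective (incLeft lP r) incLeft_inj ≪≫ₗ
    (TensorProduct.assoc k X Y P).submoduleMap _ ≪≫ₗ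
    LinearEquiv.ofEq _ (LinearMap.range (incRight rX l)) (by
      ext w
      rw [mem_range_incRight hl, Submodule.mem_map]
      constructor
      · rintro ⟨v, hv, rfl⟩
        rw [mem_range_incLeft hr] at hv
        simp only [LinearEquiv.coe_coe]
        rw [cf_assoc, coL_assoc, cg_assoc, coR_assoc, hv.1, hv.2]
        exact ⟨rfl, rfl⟩
      · obtain ⟨v, rfl⟩ := (TensorProduct.assoc k X Y P).surjective w
        intro hv
        rw [cf_assoc, coL_assoc, cg_assoc, coR_assoc] at hv
        refine ⟨v, (mem_range_incLeft hr v).2 ⟨(reassoc₃ X B Y P).injective hv.1,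
          (TensorProduct.assoc k X Y (B ⊗[k] P)).injective hv.2⟩, rfl⟩) ≪≫ₗ
    (LinearEquiv.ofInjective (incRight rX l) incRight_inj).symm

lemma cotAssoc_spec (hr : ∀ z, (inc rX lY).rTensor B (r z) = coR rY (inc rX lY z))
    (hl : ∀ z, (inc rY lP).lTensor B (l z) = coL lY (inc rY lP z)) (z : Cot r lP) :
    incRight rX l (cotAssoc hr hl z) = TensorProduct.assoc k X Y P (incLeft lP r z) := by
  have h : ∀ w : LinearMap.range (incRight rX l), incRight rX l
      ((LinearEquiv.ofInjective (incRight rX l) incRight_inj).symm w) = w.1 := fun w => by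
    have := (LinearEquiv.ofInjective (incRight rX l) incRight_inj).apply_symm_apply w
    exact congrArg Subtype.val this
  simp only [cotAssoc, LinearEquiv.trans_apply]
  rw [h]
  rfl

end assoc

end CotUnbundled

namespace LComod

/-- The comodule `X ⊗ M` with coaction from the left factor. -/
def amb (X : LComod k B) (M : Type u) [AddCommGroup M] [Module k M] : LComod k B where
  carrier := X ⊗[k] M
  lcoact := coL X.lcoact
  lcoassoc := coL_coassoc X.lcoassoc
  lcounit := coL_counit X.lcounit

lemma coact_mem (M : LComod k B) (m : M) :
    cf (M := M) (Coalgebra.comul (R := k) (A := B)) (M.lcoact m) = cg M.lcoact (M.lcoact m) :=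
  M.coassoc_apply m

/-- The isomorphism `M ≃ B □ M` given by the coaction. -/
def leftUnit (M : LComod k B) : M ≃ₗ[k] Cot (Coalgebra.comul (R := k) (A := B)) M.lcoact :=
  LinearEquiv.ofBijective (M.lcoact.codRestrict _ M.coact_mem) ⟨fun x y h =>
      M.lcoact_inj (congrArg Subtype.val h), fun z => by
    refine ⟨TensorProduct.lid k M ((Coalgebra.counit (R := k) (A := B)).rTensor M z.1),
      Subtype.ext ?_⟩
    change M.lcoact _ = z.1
    have h1 : ∀ w : B ⊗[k] M, M.lcoact (TensorProduct.lid k M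
        ((Coalgebra.counit (R := k) (A := B)).rTensor M w)) =
        TensorProduct.lid k (B ⊗[k] M) ((Coalgebra.counit (R := k) (A := B)).rTensor (B ⊗[k] M)
          (cg M.lcoact w)) := fun w => by
      induction w with
      | zero => simp
      | add s t hs ht => simp only [map_add, hs, ht]
      | tmul x m => simp
    have h2 : ∀ w : B ⊗[k] M, TensorProduct.lid k (B ⊗[k] M)
        ((Coalgebra.counit (R := k) (A := B)).rTensor (B ⊗[k] M)
          (cf (Coalgebra.comul (R := k) (A := B)) w)) = w := fun w => by
      have : (TensorProduct.lid k (B ⊗[k] M)).toLinearMap ∘ₗ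
          (Coalgebra.counit (R := k) (A := B)).rTensor (B ⊗[k] M) ∘ₗ
          cf (Coalgebra.comul (R := k) (A := B)) = LinearMap.id := by
        refine TensorProduct.ext' fun b m => ?_
        have h3 : ∀ u : B ⊗[k] B, TensorProduct.lid k (B ⊗[k] M)
            ((Coalgebra.counit (R := k) (A := B)).rTensor (B ⊗[k] M)
              (TensorProduct.assoc k B B M (u ⊗ₜ m))) =
            TensorProduct.lid k B ((Coalgebra.counit (R := k) (A := B)).rTensor B u) ⊗ₜ m :=
          fun u => by
          induction u with
          | zero => simp
          | add s t hs ht => simp only [TensorProduct.add_tmul, map_add, hs, ht]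
          | tmul x m => simp [TensorProduct.smul_tmul']
        simp only [LinearMap.comp_apply, LinearEquiv.coe_coe, cf_tmul, h3,
          Coalgebra.rTensor_counit_comul, LinearMap.id_apply]
        simp
      exact DFunLike.congr_fun this w
    rw [h1, ← show cf (Coalgebra.comul (R := k) (A := B)) z.1 = cg M.lcoact z.1 from z.2, h2]⟩

lemma inc_leftUnit (M : LComod k B) (m : M) :
    inc (Coalgebra.comul (R := k) (A := B)) M.lcoact (M.leftUnit m) = M.lcoact m := rfl

end LComod

namespace Bicomod

lemma rcoact_mem (X : Bicomod k B) (x : X) :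
    cf (M := B) X.rcoact (X.rcoact x) = cg (Coalgebra.comul (R := k) (A := B)) (X.rcoact x) :=
  DFunLike.congr_fun X.rcoassoc x

lemma rcounit_apply (X : Bicomod k B) (x : X) : TensorProduct.rid k X
    ((Coalgebra.counit (R := k) (A := B)).lTensor X (X.rcoact x)) = x :=
  DFunLike.congr_fun X.rcounit x

/-- The isomorphism `X ≃ X □ B` given by the right coaction. -/
def rightUnit (X : Bicomod k B) : X ≃ₗ[k] Cot X.rcoact (Coalgebra.comul (R := k) (A := B)) :=
  LinearEquiv.ofBijective (X.rcoact.codRestrict _ X.rcoact_mem) ⟨fun x y h => by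
    rw [← X.rcounit_apply x, ← X.rcounit_apply y]
    have : X.rcoact x = X.rcoact y := congrArg Subtype.val h
    rw [this], fun z => by
    refine ⟨TensorProduct.rid k X ((Coalgebra.counit (R := k) (A := B)).lTensor X z.1),
      Subtype.ext ?_⟩
    change X.rcoact _ = z.1
    have h0 : ∀ (t : X ⊗[k] B) (b : B), (Coalgebra.counit (R := k) (A := B) b) • t =
        (TensorProduct.rid k B).toLinearMap.lTensor X
          ((((Coalgebra.counit (R := k) (A := B)).lTensor B).lTensor X)
            (TensorProduct.assoc k X B B (t ⊗ₜ b))) := fun t b => by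
      induction t with
      | zero => simp
      | add s t hs ht => simp only [TensorProduct.add_tmul, smul_add, map_add, hs, ht]
      | tmul x m => simp
    have h1 : ∀ w : X ⊗[k] B, X.rcoact (TensorProduct.rid k X
        ((Coalgebra.counit (R := k) (A := B)).lTensor X w)) =
        (TensorProduct.rid k B).toLinearMap.lTensor X
          ((((Coalgebra.counit (R := k) (A := B)).lTensor B).lTensor X)
            (cf X.rcoact w)) := fun w => by
      induction w with
      | zero => simp
      | add s t hs ht => simp only [map_add, hs, ht]
      | tmul x m => simp [h0]
    have h2 : ∀ w : X ⊗[k] B, (TensorProduct.rid k B).toLinearMap.lTensor X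
          ((((Coalgebra.counit (R := k) (A := B)).lTensor B).lTensor X)
            (cg (Coalgebra.comul (R := k) (A := B)) w)) = w := fun w => by
      induction w with
      | zero => simp
      | add s t hs ht => simp only [map_add, hs, ht]
      | tmul x m => simp
    rw [h1, show cf X.rcoact z.1 = cg (Coalgebra.comul (R := k) (A := B)) z.1 from z.2, h2]⟩

lemma inc_rightUnit (X : Bicomod k B) (x : X) :
    inc X.rcoact (Coalgebra.comul (R := k) (A := B)) (X.rightUnit x) = X.rcoact x := rfl

/-- The left coaction on `X □ M`, restricted from `X ⊗ M`. -/
def cotL (X : Bicomod k B) (M : LComod k B) :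
    Cot X.rcoact M.lcoact →ₗ[k] B ⊗[k] Cot X.rcoact M.lcoact :=
  liftL _ _ (coL X.lcoact ∘ₗ inc X.rcoact M.lcoact) (fun z => by
    rw [LinearMap.comp_apply, coL_cf X.bicomm, coL_cg, incl_mem])

lemma cotL_spec (X : Bicomod k B) (M : LComod k B) (z : Cot X.rcoact M.lcoact) :
    (inc X.rcoact M.lcoact).lTensor B (X.cotL M z) = coL X.lcoact (inc X.rcoact M.lcoact z) :=
  liftL_spec _ _ _ _ z

/-- The cotensor product `X □ M` of a bicomodule and a left comodule: the left comodule with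
underlying space the equalizer of `ρ ⊗ M` and `X ⊗ λ`, and coaction induced by that of `X`. -/
def cot (X : Bicomod k B) (M : LComod k B) : LComod k B :=
  LComod.ofInj (X.toLComod.amb M) (inc X.rcoact M.lcoact) (inc_inj _ _) (X.cotL M) (X.cotL_spec M)

/-- The bicomodule `X ⊗ Y` with outer coactions. -/
def amb (X Y : Bicomod k B) : Bicomod k B where
  toLComod := X.toLComod.amb Y
  rcoact := coR Y.rcoact
  rcoassoc := coR_coassoc Y.rcoassoc
  rcounit := coR_counit Y.rcounit
  bicomm := coL_coR X.lcoact Y.rcoact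

end Bicomod

section CotUnbundled₂

variable {X Y M N P : Type u} [AddCommGroup X] [Module k X] [AddCommGroup Y] [Module k Y]
  [AddCommGroup P] [Module k P]

lemma coR_cf (rX : X →ₗ[k] X ⊗[k] B) (rY : Y →ₗ[k] Y ⊗[k] B) (w : X ⊗[k] Y) :
    (cf rX).rTensor B (coR rY w) = coR (coR rY) (cf rX w) := by
  induction w with
  | zero => simp
  | add s t hs ht => simp only [map_add, hs, ht]
  | tmul x y =>
    have h1 : ∀ t : Y ⊗[k] B, (cf rX).rTensor B ((TensorProduct.assoc k X Y B).symm (x ⊗ₜ t)) =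
        (TensorProduct.assoc k X B Y).toLinearMap.rTensor B
          ((TensorProduct.assoc k (X ⊗[k] B) Y B).symm (rX x ⊗ₜ t)) := fun t => by
      induction t with
      | zero => simp
      | add s t hs ht => simp only [TensorProduct.tmul_add, map_add, hs, ht]
      | tmul x m => simp
    have h3 : ∀ (x : X) (b : B) (t : Y ⊗[k] B),
        (TensorProduct.assoc k X (B ⊗[k] Y) B).symm (x ⊗ₜ (TensorProduct.assoc k B Y B).symm
          (b ⊗ₜ t)) = (TensorProduct.assoc k X B Y).toLinearMap.rTensor B
          ((TensorProduct.assoc k (X ⊗[k] B) Y B).symm ((x ⊗ₜ b) ⊗ₜ t)) := fun x b t => by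
      induction t with
      | zero => simp
      | add s t hs ht => simp only [TensorProduct.tmul_add, map_add, hs, ht]
      | tmul x m => simp
    have h2 : ∀ s : X ⊗[k] B, coR (coR rY) (TensorProduct.assoc k X B Y (s ⊗ₜ y)) =
        (TensorProduct.assoc k X B Y).toLinearMap.rTensor B
          ((TensorProduct.assoc k (X ⊗[k] B) Y B).symm (s ⊗ₜ rY y)) := fun s => by
      induction s with
      | zero => simp
      | add s t hs ht => simp only [TensorProduct.add_tmul, map_add, hs, ht]
      | tmul x m => simp [h3]
    simp only [cf_tmul, coR_tmul, h1, h2]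

lemma coR_cg {lY : Y →ₗ[k] B ⊗[k] Y} {rY : Y →ₗ[k] Y ⊗[k] B}
    (h : rY.lTensor B ∘ₗ lY = (TensorProduct.assoc k B Y B).toLinearMap ∘ₗ lY.rTensor B ∘ₗ rY)
    (w : X ⊗[k] Y) : (cg lY).rTensor B (coR rY w) = coR (coR rY) (cg lY w) := by
  induction w with
  | zero => simp
  | add s t hs ht => simp only [map_add, hs, ht]
  | tmul x y =>
    have h1 : ∀ t : Y ⊗[k] B, (cg lY).rTensor B ((TensorProduct.assoc k X Y B).symm (x ⊗ₜ t)) =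
        (TensorProduct.assoc k X (B ⊗[k] Y) B).symm (x ⊗ₜ lY.rTensor B t) := fun t => by
      induction t with
      | zero => simp
      | add s t hs ht => simp only [TensorProduct.tmul_add, map_add, hs, ht]
      | tmul x m => simp
    have h2 : coR rY (lY y) = lY.rTensor B (rY y) := by
      have := DFunLike.congr_fun h y
      simp only [LinearMap.comp_apply, LinearEquiv.coe_coe] at this
      simp [coR, this]
    simp only [coR_tmul, cg_tmul, h1, h2]

lemma coL_coL (l : X →ₗ[k] B ⊗[k] X) (w : (X ⊗[k] Y) ⊗[k] P) :
    coL l (TensorProduct.assoc k X Y P w) =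
      (TensorProduct.assoc k X Y P).toLinearMap.lTensor B (coL (coL l) w) := by
  have : coL l ∘ₗ (TensorProduct.assoc k X Y P).toLinearMap =
      (TensorProduct.assoc k X Y P).toLinearMap.lTensor B ∘ₗ coL (coL l) := by
    refine TensorProduct.ext_threefold fun x y p => ?_
    simp only [LinearMap.comp_apply, LinearEquiv.coe_coe, TensorProduct.assoc_tmul, coL_tmul]
    induction l x with
    | zero => simp
    | add s t hs ht => simp only [TensorProduct.add_tmul, map_add, hs, ht]
    | tmul x m => simp
  exact DFunLike.congr_fun this w

lemma coR_coR (r : P →ₗ[k] P ⊗[k] B) (w : (X ⊗[k] Y) ⊗[k] P) :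
    coR (coR r) (TensorProduct.assoc k X Y P w) =
      (TensorProduct.assoc k X Y P).toLinearMap.rTensor B (coR r w) := by
  have : coR (coR r) ∘ₗ (TensorProduct.assoc k X Y P).toLinearMap =
      (TensorProduct.assoc k X Y P).toLinearMap.rTensor B ∘ₗ coR r := by
    refine TensorProduct.ext_threefold fun x y p => ?_
    simp only [LinearMap.comp_apply, LinearEquiv.coe_coe, TensorProduct.assoc_tmul, coR_tmul]
    induction r p with
    | zero => simp
    | add s t hs ht => simp only [TensorProduct.tmul_add, map_add, hs, ht]
    | tmul x m => simp
  exact DFunLike.congr_fun this w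

lemma cotMap_lcomm {M N : Type u} [AddCommGroup M] [Module k M] [AddCommGroup N] [Module k N]
    {rX : X →ₗ[k] X ⊗[k] B} {rY : Y →ₗ[k] Y ⊗[k] B}
    {lX : X →ₗ[k] B ⊗[k] X} {lY : Y →ₗ[k] B ⊗[k] Y} {lM : M →ₗ[k] B ⊗[k] M}
    {lN : N →ₗ[k] B ⊗[k] N} {f : X →ₗ[k] Y} (hf : rY ∘ₗ f = f.rTensor B ∘ₗ rX) {g : M →ₗ[k] N}
    (hg : lN ∘ₗ g = g.lTensor B ∘ₗ lM) (hf' : lY ∘ₗ f = f.lTensor B ∘ₗ lX)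
    {c : Cot rX lM →ₗ[k] B ⊗[k] Cot rX lM} (hc : ∀ z, (inc rX lM).lTensor B (c z) =
      coL lX (inc rX lM z))
    {d : Cot rY lN →ₗ[k] B ⊗[k] Cot rY lN} (hd : ∀ z, (inc rY lN).lTensor B (d z) =
      coL lY (inc rY lN z)) :
    d ∘ₗ cotMap f hf g hg = (cotMap f hf g hg).lTensor B ∘ₗ c := by
  refine LinearMap.ext fun z => lTensor_inj (inc_inj rY lN) ?_
  have h : inc rY lN ∘ₗ cotMap f hf g hg = TensorProduct.map f g ∘ₗ inc rX lM := rfl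
  rw [LinearMap.comp_apply, LinearMap.comp_apply, hd, inc_cotMap, coL_nat hf',
    ← LinearMap.lTensor_comp_apply, h, LinearMap.lTensor_comp_apply, hc]

lemma cotAssoc_lcomm {rX : X →ₗ[k] X ⊗[k] B} {lX : X →ₗ[k] B ⊗[k] X} {lY : Y →ₗ[k] B ⊗[k] Y}
    {rY : Y →ₗ[k] Y ⊗[k] B} {lP : P →ₗ[k] B ⊗[k] P} {r : Cot rX lY →ₗ[k] Cot rX lY ⊗[k] B}
    {l : Cot rY lP →ₗ[k] B ⊗[k] Cot rY lP}
    (hr : ∀ z, (inc rX lY).rTensor B (r z) = coR rY (inc rX lY z))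
    (hl : ∀ z, (inc rY lP).lTensor B (l z) = coL lY (inc rY lP z))
    {l' : Cot rX lY →ₗ[k] B ⊗[k] Cot rX lY}
    (hl' : ∀ z, (inc rX lY).lTensor B (l' z) = coL lX (inc rX lY z))
    {c : Cot r lP →ₗ[k] B ⊗[k] Cot r lP}
    (hc : ∀ z, (inc r lP).lTensor B (c z) = coL l' (inc r lP z))
    {d : Cot rX l →ₗ[k] B ⊗[k] Cot rX l}
    (hd : ∀ z, (inc rX l).lTensor B (d z) = coL lX (inc rX l z)) (z : Cot r lP) :
    d (cotAssoc hr hl z) = (cotAssoc hr hl).toLinearMap.lTensor B (c z) := by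
  refine lTensor_inj (incRight_inj (rX := rX) (l := l)) ?_
  have h1 : ∀ w, (incRight rX l).lTensor B (d w) = coL lX (incRight rX l w) := fun w => by
    rw [incRight, LinearMap.lTensor_comp_apply, hd]
    exact (coL_nat (f := LinearMap.id) (by simp) (inc rY lP) _).symm
  have h2 : ∀ w, (incLeft lP r).lTensor B (c w) = coL (coL lX) (incLeft lP r w) := fun w => by
    rw [incLeft, LinearMap.lTensor_comp_apply, hc]
    exact (coL_nat (LinearMap.ext fun z => (hl' z).symm) LinearMap.id _).symm
  have h3 : incRight rX l ∘ₗ (cotAssoc hr hl).toLinearMap =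
      (TensorProduct.assoc k X Y P).toLinearMap ∘ₗ incLeft lP r :=
    LinearMap.ext (cotAssoc_spec hr hl)
  rw [h1, cotAssoc_spec, coL_coL, ← LinearMap.lTensor_comp_apply, h3,
    LinearMap.lTensor_comp_apply, h2]

lemma cotAssoc_rcomm {rX : X →ₗ[k] X ⊗[k] B} {lY : Y →ₗ[k] B ⊗[k] Y}
    {rY : Y →ₗ[k] Y ⊗[k] B} {lP : P →ₗ[k] B ⊗[k] P} {rP : P →ₗ[k] P ⊗[k] B}
    {r : Cot rX lY →ₗ[k] Cot rX lY ⊗[k] B} {l : Cot rY lP →ₗ[k] B ⊗[k] Cot rY lP}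
    (hr : ∀ z, (inc rX lY).rTensor B (r z) = coR rY (inc rX lY z))
    (hl : ∀ z, (inc rY lP).lTensor B (l z) = coL lY (inc rY lP z))
    {r' : Cot rY lP →ₗ[k] Cot rY lP ⊗[k] B}
    (hr' : ∀ z, (inc rY lP).rTensor B (r' z) = coR rP (inc rY lP z))
    {c : Cot r lP →ₗ[k] Cot r lP ⊗[k] B}
    (hc : ∀ z, (inc r lP).rTensor B (c z) = coR rP (inc r lP z))
    {d : Cot rX l →ₗ[k] Cot rX l ⊗[k] B}
    (hd : ∀ z, (inc rX l).rTensor B (d z) = coR r' (inc rX l z)) (z : Cot r lP) :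
    d (cotAssoc hr hl z) = (cotAssoc hr hl).toLinearMap.rTensor B (c z) := by
  refine rTensor_inj (incRight_inj (rX := rX) (l := l)) ?_
  have h1 : ∀ w, (incRight rX l).rTensor B (d w) = coR (coR rP) (incRight rX l w) := fun w => by
    rw [incRight, LinearMap.rTensor_comp_apply, hd]
    exact (coR_nat LinearMap.id (LinearMap.ext fun z => (hr' z).symm) _).symm
  have h2 : ∀ w, (incLeft lP r).rTensor B (c w) = coR rP (incLeft lP r w) := fun w => by
    rw [incLeft, LinearMap.rTensor_comp_apply, hc]
    exact (coR_nat (inc rX lY) (g := LinearMap.id) (by simp) _).symm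
  have h3 : incRight rX l ∘ₗ (cotAssoc hr hl).toLinearMap =
      (TensorProduct.assoc k X Y P).toLinearMap ∘ₗ incLeft lP r :=
    LinearMap.ext (cotAssoc_spec hr hl)
  rw [h1, cotAssoc_spec, coR_coR, ← LinearMap.rTensor_comp_apply, h3,
    LinearMap.rTensor_comp_apply, h2]

end CotUnbundled₂

namespace Bicomod

/-- The right coaction on `X □ Y`, restricted from `X ⊗ Y`. -/
def cotR (X Y : Bicomod k B) :
    Cot X.rcoact Y.lcoact →ₗ[k] Cot X.rcoact Y.lcoact ⊗[k] B :=
  liftR _ _ (coR Y.rcoact ∘ₗ inc X.rcoact Y.lcoact) (fun z => by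
    rw [LinearMap.comp_apply, coR_cf, coR_cg Y.bicomm, incl_mem])

lemma cotR_spec (X Y : Bicomod k B) (z : Cot X.rcoact Y.lcoact) :
    (inc X.rcoact Y.lcoact).rTensor B (X.cotR Y z) = coR Y.rcoact (inc X.rcoact Y.lcoact z) :=
  liftR_spec _ _ _ _ z

/-- The cotensor product of bicomodules, with the outer coactions. -/
def cotB (X Y : Bicomod k B) : Bicomod k B :=
  Bicomod.ofInj (X.amb Y) (X.cot Y.toLComod) (inc X.rcoact Y.lcoact) (inc_inj _ _)
    (X.cotL_spec Y.toLComod) (X.cotR Y) (X.cotR_spec Y)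

/-- The functoriality of `X □ M` in both variables. -/
def cotHom {X Y : Bicomod k B} {M N : LComod k B} (f : X.toLComod ⟶ Y.toLComod)
    (hf : Y.rcoact ∘ₗ f.lin = f.lin.rTensor B ∘ₗ X.rcoact) (g : M ⟶ N) : X.cot M ⟶ Y.cot N where
  lin := cotMap f.lin hf g.lin g.lcomm
  lcomm := cotMap_lcomm hf g.lcomm f.lcomm (X.cotL_spec M) (Y.cotL_spec N)

/-- The associativity isomorphism `(X □ Y) □ M ≅ X □ (Y □ M)`. -/
def cotAssocIso (X Y : Bicomod k B) (M : LComod k B) :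
    (X.cotB Y).cot M ≅ X.cot (Y.cot M) :=
  LComod.isoMk (M := (X.cotB Y).cot M) (N := X.cot (Y.cot M))
    (cotAssoc (X.cotR_spec Y) (Y.cotL_spec M))
    (cotAssoc_lcomm (X.cotR_spec Y) (Y.cotL_spec M) (X.cotL_spec Y.toLComod)
      ((X.cotB Y).cotL_spec M) (X.cotL_spec (Y.cot M)))

end Bicomod

/-- The regular bicomodule `B`. -/
def Bicomod.reg (k B : Type u) [Field k] [Ring B] [Bialgebra k B] : Bicomod k B where
  carrier := B
  lcoact := Coalgebra.comul
  lcoassoc := Coalgebra.coassoc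
  lcounit := by ext; simp
  rcoact := Coalgebra.comul
  rcoassoc := Coalgebra.coassoc
  rcounit := by ext; simp
  bicomm := Coalgebra.coassoc.symm

/-- The isomorphism of comodules `M ≅ B □ M` given by the coaction. -/
def LComod.leftUnitIso (M : LComod k B) : M ≅ (Bicomod.reg k B).cot M :=
  LComod.isoMk (N := (Bicomod.reg k B).cot M) M.leftUnit fun m => by
    refine lTensor_inj (inc_inj (Coalgebra.comul (R := k) (A := B)) M.lcoact) ?_
    refine ((Bicomod.reg k B).cotL_spec M (M.leftUnit m)).trans ?_
    refine (M.coassoc_apply m).trans ?_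
    exact LinearMap.lTensor_comp_apply B (inc (Coalgebra.comul (R := k) (A := B)) M.lcoact)
      M.leftUnit.toLinearMap (M.lcoact m)

/-! ### The monoidal category of Hopf trimodules -/

section ActUnbundled

variable {X Y M N P : Type u} [AddCommGroup X] [Module k X] [AddCommGroup Y] [Module k Y]
  [AddCommGroup M] [Module k M] [AddCommGroup N] [Module k N] [AddCommGroup P] [Module k P]

/-- The diagonal action `b (x ⊗ y) = b₍₁₎ x ⊗ b₍₂₎ y` on `X ⊗ Y`. -/
def diagAct (aX : B →ₗ[k] Module.End k X) (aY : B →ₗ[k] Module.End k Y) :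
    B →ₗ[k] Module.End k (X ⊗[k] Y) := dact aX aY ∘ₗ Coalgebra.comul

lemma dact_comul (aX : B →ₗ[k] Module.End k X) (aY : B →ₗ[k] Module.End k Y) (b : B)
    (z : X ⊗[k] Y) : dact aX aY (Coalgebra.comul b) z = diagAct aX aY b z := rfl

lemma dact_mul (aX : B →ₐ[k] Module.End k X) (aY : B →ₐ[k] Module.End k Y) (u v : B ⊗[k] B) :
    dact aX.toLinearMap aY.toLinearMap (u * v) =
      dact aX.toLinearMap aY.toLinearMap u * dact aX.toLinearMap aY.toLinearMap v := by
  induction u with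
  | zero => simp
  | add s t hs ht => simp only [add_mul, map_add, hs, ht]
  | tmul b b' =>
    induction v with
    | zero => simp
    | add s t hs ht => simp only [mul_add, map_add, hs, ht]
    | tmul c c' => exact TensorProduct.ext' fun x y => by simp

lemma cf_dact {aX : B →ₗ[k] Module.End k X} (aY : B →ₗ[k] Module.End k Y)
    {rX : X →ₗ[k] X ⊗[k] B}
    (hX : ∀ b x, rX (aX b x) = dact aX (LinearMap.mul k B) (Coalgebra.comul b) (rX x))
    (b : B) (w : X ⊗[k] Y) : cf rX (diagAct aX aY b w) =
      dact aX (dact (LinearMap.mul k B) aY) (TensorProduct.assoc k B B B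
        ((Coalgebra.comul (R := k) (A := B)).rTensor B (Coalgebra.comul b))) (cf rX w) := by
  simp only [cf, LinearMap.comp_apply, diagAct, LinearEquiv.coe_coe]
  rw [dact_rT aY hX, dact_assoc]

lemma cg_dact (aX : B →ₗ[k] Module.End k X) {aY : B →ₗ[k] Module.End k Y}
    {lY : Y →ₗ[k] B ⊗[k] Y}
    (hY : ∀ b y, lY (aY b y) = dact (LinearMap.mul k B) aY (Coalgebra.comul b) (lY y))
    (b : B) (w : X ⊗[k] Y) : cg lY (diagAct aX aY b w) =
      dact aX (dact (LinearMap.mul k B) aY)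
        ((Coalgebra.comul (R := k) (A := B)).lTensor B (Coalgebra.comul b)) (cg lY w) := by
  simp only [cg, LinearMap.comp_apply, diagAct]
  rw [dact_lT aX hY]

lemma coL_dact {aX : B →ₗ[k] Module.End k X} (aY : B →ₗ[k] Module.End k Y)
    {lX : X →ₗ[k] B ⊗[k] X}
    (hX : ∀ b x, lX (aX b x) = dact (LinearMap.mul k B) aX (Coalgebra.comul b) (lX x))
    (b : B) (w : X ⊗[k] Y) : coL lX (diagAct aX aY b w) =
      dact (LinearMap.mul k B) (diagAct aX aY) (Coalgebra.comul b) (coL lX w) := by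
  have h := dact_lT (LinearMap.mul k B) (q := diagAct aX aY) (q' := dact aX aY)
    (f := LinearMap.id) (φ := Coalgebra.comul (R := k) (A := B)) (fun _ _ => rfl)
    (Coalgebra.comul b) (coL lX w)
  simp only [LinearMap.lTensor_id, LinearMap.id_apply] at h
  rw [h, ← Coalgebra.coassoc_apply, diagAct, LinearMap.comp_apply]
  simp only [coL, LinearMap.comp_apply, LinearEquiv.coe_coe]
  rw [dact_rT aY hX, dact_assoc]

lemma coR_dact (aX : B →ₗ[k] Module.End k X) {aY : B →ₗ[k] Module.End k Y}
    {rY : Y →ₗ[k] Y ⊗[k] B}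
    (hY : ∀ b y, rY (aY b y) = dact aY (LinearMap.mul k B) (Coalgebra.comul b) (rY y))
    (b : B) (w : X ⊗[k] Y) : coR rY (diagAct aX aY b w) =
      dact (diagAct aX aY) (LinearMap.mul k B) (Coalgebra.comul b) (coR rY w) := by
  have h := dact_rT (LinearMap.mul k B) (p := diagAct aX aY) (p' := dact aX aY)
    (f := LinearMap.id) (φ := Coalgebra.comul (R := k) (A := B)) (fun _ _ => rfl)
    (Coalgebra.comul b) (coR rY w)
  simp only [LinearMap.rTensor_id, LinearMap.id_apply] at h
  apply (TensorProduct.assoc k X Y B).injective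
  rw [h, dact_assoc, Coalgebra.coassoc_apply, diagAct, LinearMap.comp_apply]
  simp only [coR, LinearMap.comp_apply, LinearEquiv.coe_coe, LinearEquiv.apply_symm_apply]
  rw [dact_lT aX hY]

/-- The diagonal action on `X □ Y`. -/
def cotAct {aX : B →ₗ[k] Module.End k X} {aY : B →ₗ[k] Module.End k Y}
    {rX : X →ₗ[k] X ⊗[k] B} {lY : Y →ₗ[k] B ⊗[k] Y}
    (hX : ∀ b x, rX (aX b x) = dact aX (LinearMap.mul k B) (Coalgebra.comul b) (rX x))
    (hY : ∀ b y, lY (aY b y) = dact (LinearMap.mul k B) aY (Coalgebra.comul b) (lY y)) :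
    B →ₗ[k] Module.End k (Cot rX lY) where
  toFun b := (diagAct aX aY b).restrict (p := LinearMap.eqLocus (cf rX) (cg lY))
    (q := LinearMap.eqLocus (cf rX) (cg lY)) (fun w hw => by
      change cf rX _ = cg lY _
      rw [cf_dact aY hX, cg_dact aX hY, ← Coalgebra.coassoc_apply,
        show cf rX w = cg lY w from hw])
  map_add' b b' := LinearMap.ext fun z => Subtype.ext (by simp)
  map_smul' c b := LinearMap.ext fun z => Subtype.ext (by simp)

lemma inc_cotAct {aX : B →ₗ[k] Module.End k X} {aY : B →ₗ[k] Module.End k Y}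
    {rX : X →ₗ[k] X ⊗[k] B} {lY : Y →ₗ[k] B ⊗[k] Y}
    (hX : ∀ b x, rX (aX b x) = dact aX (LinearMap.mul k B) (Coalgebra.comul b) (rX x))
    (hY : ∀ b y, lY (aY b y) = dact (LinearMap.mul k B) aY (Coalgebra.comul b) (lY y))
    (b : B) (z : Cot rX lY) : inc rX lY (cotAct hX hY b z) = diagAct aX aY b (inc rX lY z) := rfl

lemma diagAct_assoc (aX : B →ₗ[k] Module.End k X) (aY : B →ₗ[k] Module.End k Y)
    (aP : B →ₗ[k] Module.End k P) (b : B) (w : (X ⊗[k] Y) ⊗[k] P) :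
    TensorProduct.assoc k X Y P (diagAct (diagAct aX aY) aP b w) =
      diagAct aX (diagAct aY aP) b (TensorProduct.assoc k X Y P w) := by
  have h := dact_rT aP (p := diagAct aX aY) (p' := dact aX aY)
    (f := LinearMap.id) (φ := Coalgebra.comul (R := k) (A := B)) (fun _ _ => rfl)
    (Coalgebra.comul b) w
  have h' := dact_lT aX (q := diagAct aY aP) (q' := dact aY aP)
    (f := LinearMap.id) (φ := Coalgebra.comul (R := k) (A := B)) (fun _ _ => rfl)
    (Coalgebra.comul b) (TensorProduct.assoc k X Y P w)
  simp only [LinearMap.lTensor_id, LinearMap.rTensor_id, LinearMap.id_apply] at h h'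
  rw [← dact_comul, ← dact_comul, h, h', dact_assoc, Coalgebra.coassoc_apply]

lemma diagAct_one (aX : B →ₐ[k] Module.End k X) (aY : B →ₐ[k] Module.End k Y) :
    diagAct aX.toLinearMap aY.toLinearMap 1 = 1 :=
  TensorProduct.ext' fun x y => by
    simp [diagAct, Algebra.TensorProduct.one_def]

lemma diagAct_mul (aX : B →ₐ[k] Module.End k X) (aY : B →ₐ[k] Module.End k Y) (b b' : B) :
    diagAct aX.toLinearMap aY.toLinearMap (b * b') =
      diagAct aX.toLinearMap aY.toLinearMap b * diagAct aX.toLinearMap aY.toLinearMap b' := by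
  simp only [diagAct, LinearMap.comp_apply, Bialgebra.comul_mul]
  exact dact_mul aX aY _ _

lemma mul_eq_dact (u v : B ⊗[k] B) :
    u * v = dact (LinearMap.mul k B) (LinearMap.mul k B) u v := by
  induction u with
  | zero => simp
  | add s t hs ht => simp only [add_mul, map_add, hs, ht, LinearMap.add_apply]
  | tmul c c' =>
    induction v with
    | zero => simp
    | add s t hs ht => simp only [mul_add, map_add, hs, ht]
    | tmul d d' => simp

end ActUnbundled

namespace HopfTrimodule

/-- The tensor product `X ⊗ Y` over `k` with outer coactions and diagonal action. -/
def amb (X Y : HopfTrimodule k B) : HopfTrimodule k B where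
  toBicomod := X.toBicomod.amb Y.toBicomod
  act := AlgHom.ofLinearMap (diagAct X.actL Y.actL)
    (diagAct_one X.act Y.act) (diagAct_mul X.act Y.act)
  act_lcoact := TensorProduct.ext' fun b z => by
    refine (coL_dact Y.actL X.lact b z).trans ?_
    exact (dact_eq_shuffleL (LinearMap.mul k B) (diagAct X.actL Y.actL) _ _).symm
  act_rcoact := TensorProduct.ext' fun b z => by
    refine (coR_dact X.actL Y.ract b z).trans ?_
    exact (dact_eq_shuffleR (diagAct X.actL Y.actL) (LinearMap.mul k B) _ _).symm

/-- The cotensor product `X □ Y` of Hopf trimodules: the cotensor product of bicomodules with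
the diagonal action `b (x ⊗ y) = b₍₁₎ x ⊗ b₍₂₎ y`. -/
def cotT (X Y : HopfTrimodule k B) : HopfTrimodule k B :=
  ofInj (X.amb Y) (X.cotB Y.toBicomod) (inc X.rcoact Y.lcoact) (inc_inj _ _)
    (X.cotL_spec Y.toLComod) (X.cotR_spec Y.toBicomod) (cotAct X.ract Y.lact)
    (inc_cotAct X.ract Y.lact)

/-- The regular Hopf trimodule `B`. -/
def reg (k B : Type u) [Field k] [Ring B] [Bialgebra k B] : HopfTrimodule k B where
  toBicomod := Bicomod.reg k B
  act := Algebra.lmul k B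
  act_lcoact := TensorProduct.ext' fun b x => by
    refine (Bialgebra.comul_mul b x).trans ?_
    exact (mul_eq_dact _ _).trans (dact_eq_shuffleL (LinearMap.mul k B) (LinearMap.mul k B)
      (Coalgebra.comul b) (Coalgebra.comul x)).symm
  act_rcoact := TensorProduct.ext' fun b x => by
    refine (Bialgebra.comul_mul b x).trans ?_
    exact (mul_eq_dact _ _).trans (dact_eq_shuffleR (LinearMap.mul k B) (LinearMap.mul k B)
      (Coalgebra.comul b) (Coalgebra.comul x)).symm

/-- The cotensor product of morphisms. -/
def cotMapT {X Y X' Y' : HopfTrimodule k B} (f : X ⟶ X') (g : Y ⟶ Y') : X.cotT Y ⟶ X'.cotT Y' where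
  lin := cotMap f.lin f.rcomm g.lin g.lcomm
  lcomm := cotMap_lcomm f.rcomm g.lcomm f.lcomm (X.cotL_spec Y.toLComod) (X'.cotL_spec Y'.toLComod)
  rcomm := LinearMap.ext fun z => by
    refine rTensor_inj (inc_inj X'.rcoact Y'.lcoact) ?_
    refine (X'.cotR_spec Y'.toBicomod _).trans ?_
    refine (coR_nat f.lin g.rcomm (inc X.rcoact Y.lcoact z)).trans ?_
    refine (congrArg _ (X.cotR_spec Y.toBicomod z).symm).trans ?_
    refine (LinearMap.rTensor_comp_apply B (TensorProduct.map f.lin g.lin)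
      (inc X.rcoact Y.lcoact) (X.cotR Y.toBicomod z)).symm.trans ?_
    exact LinearMap.rTensor_comp_apply B (inc X'.rcoact Y'.lcoact)
      (cotMap f.lin f.rcomm g.lin g.lcomm) (X.cotR Y.toBicomod z)
  acomm b z := inc_inj X'.rcoact Y'.lcoact
    (dact_nat X.actL Y.actL X'.actL Y'.actL f.lin g.lin f.acomm g.acomm (Coalgebra.comul b)
      (inc X.rcoact Y.lcoact z))

/-- The associator for the cotensor product. -/
def assocT (X Y Z : HopfTrimodule k B) : (X.cotT Y).cotT Z ≅ X.cotT (Y.cotT Z) :=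
  isoMk (X := (X.cotT Y).cotT Z) (Y := X.cotT (Y.cotT Z))
    { lin := (cotAssoc (X.cotR_spec Y.toBicomod) (Y.cotL_spec Z.toLComod)).toLinearMap
      lcomm := LinearMap.ext (cotAssoc_lcomm (X.cotR_spec Y.toBicomod) (Y.cotL_spec Z.toLComod)
        (X.cotL_spec Y.toLComod) ((X.cotB Y.toBicomod).cotL_spec Z.toLComod)
        (X.cotL_spec (Y.cot Z.toLComod)))
      rcomm := LinearMap.ext (cotAssoc_rcomm (X.cotR_spec Y.toBicomod) (Y.cotL_spec Z.toLComod)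
        (Y.cotR_spec Z.toBicomod) ((X.cotB Y.toBicomod).cotR_spec Z.toBicomod)
        (X.cotR_spec (Y.cotB Z.toBicomod)))
      acomm := fun b z => by
        refine incRight_inj (rX := X.rcoact) (l := Y.cotL Z.toLComod) ?_
        have h1 : ∀ w, incRight X.rcoact (Y.cotL Z.toLComod) ((X.cotT (Y.cotT Z)).actL b w) =
            diagAct X.actL (diagAct Y.actL Z.actL) b
              (incRight X.rcoact (Y.cotL Z.toLComod) w) := fun w =>
          dact_nat X.actL (Y.cotT Z).actL X.actL (diagAct Y.actL Z.actL) LinearMap.id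
            (inc Y.rcoact Z.lcoact) (fun _ _ => rfl) (fun _ _ => rfl) (Coalgebra.comul b) _
        have h2 : incLeft Z.lcoact (X.cotR Y.toBicomod) (((X.cotT Y).cotT Z).actL b z) =
            diagAct (diagAct X.actL Y.actL) Z.actL b
              (incLeft Z.lcoact (X.cotR Y.toBicomod) z) :=
          dact_nat (X.cotT Y).actL Z.actL (diagAct X.actL Y.actL) Z.actL
            (inc X.rcoact Y.lcoact) LinearMap.id (fun _ _ => rfl) (fun _ _ => rfl)
            (Coalgebra.comul b) _
        refine Eq.trans ?_ (h1 _).symm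
        refine (cotAssoc_spec (X.cotR_spec Y.toBicomod) (Y.cotL_spec Z.toLComod) _).trans ?_
        rw [h2, diagAct_assoc]
        exact congrArg _ (cotAssoc_spec (X.cotR_spec Y.toBicomod) (Y.cotL_spec Z.toLComod) z).symm }
    (cotAssoc (X.cotR_spec Y.toBicomod) (Y.cotL_spec Z.toLComod)) rfl

/-- The left unitor `X ≅ B □ X`. -/
def leftUnitT (X : HopfTrimodule k B) : X ≅ (reg k B).cotT X :=
  isoMk (Y := (reg k B).cotT X)
    { lin := X.leftUnit.toLinearMap
      lcomm := X.leftUnitIso.hom.lcomm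
      rcomm := LinearMap.ext fun x => by
        refine rTensor_inj (inc_inj (Coalgebra.comul (R := k) (A := B)) X.lcoact) ?_
        refine ((Bicomod.reg k B).cotR_spec X.toBicomod (X.leftUnit x)).trans ?_
        refine Eq.trans ?_ (LinearMap.rTensor_comp_apply B
          (inc (Coalgebra.comul (R := k) (A := B)) X.lcoact) X.leftUnit.toLinearMap (X.rcoact x))
        refine (TensorProduct.assoc k B X B).injective ?_
        have := DFunLike.congr_fun X.bicomm x
        refine Eq.trans ?_ this
        exact (TensorProduct.assoc k B X B).apply_symm_apply _
      acomm := fun b x => inc_inj (Coalgebra.comul (R := k) (A := B)) X.lcoact (X.lact b x) }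
    X.leftUnit rfl

/-- The right unitor `X ≅ X □ B`. -/
def rightUnitT (X : HopfTrimodule k B) : X ≅ X.cotT (reg k B) :=
  isoMk (Y := X.cotT (reg k B))
    { lin := X.rightUnit.toLinearMap
      lcomm := LinearMap.ext fun x => by
        refine lTensor_inj (inc_inj X.rcoact (Coalgebra.comul (R := k) (A := B))) ?_
        refine (X.cotL_spec (Bicomod.reg k B).toLComod (X.rightUnit x)).trans ?_
        refine Eq.trans ?_ (LinearMap.lTensor_comp_apply B
          (inc X.rcoact (Coalgebra.comul (R := k) (A := B))) X.rightUnit.toLinearMap (X.lcoact x))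
        exact (DFunLike.congr_fun X.bicomm x).symm
      rcomm := LinearMap.ext fun x => by
        refine rTensor_inj (inc_inj X.rcoact (Coalgebra.comul (R := k) (A := B))) ?_
        refine (X.cotR_spec (Bicomod.reg k B) (X.rightUnit x)).trans ?_
        refine Eq.trans ?_ (LinearMap.rTensor_comp_apply B
          (inc X.rcoact (Coalgebra.comul (R := k) (A := B))) X.rightUnit.toLinearMap (X.rcoact x))
        refine (TensorProduct.assoc k X B B).injective ?_
        refine Eq.trans ?_ (DFunLike.congr_fun X.rcoassoc x).symm
        exact (TensorProduct.assoc k X B B).apply_symm_apply _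
      acomm := fun b x => inc_inj X.rcoact (Coalgebra.comul (R := k) (A := B)) (X.ract b x) }
    X.rightUnit rfl

instance : MonoidalCategoryStruct (HopfTrimodule k B) where
  tensorObj := cotT
  tensorUnit := reg k B
  tensorHom := cotMapT
  whiskerLeft X _ _ f := cotMapT (𝟙 X) f
  whiskerRight f Y := cotMapT f (𝟙 Y)
  associator := assocT
  leftUnitor X := X.leftUnitT.symm
  rightUnitor X := X.rightUnitT.symm

lemma ext_cot {W X Y : HopfTrimodule k B} {f g : W ⟶ X.cotT Y}
    (h : ∀ w, inc X.rcoact Y.lcoact (f.lin w) = inc X.rcoact Y.lcoact (g.lin w)) : f = g :=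
  Hom.ext (LinearMap.ext fun w => inc_inj X.rcoact Y.lcoact (h w))

end HopfTrimodule

section

variable {X Y X₁ Y₁ X₂ Y₂ X₃ Y₃ Z Z₁ : Type u}
  [AddCommGroup X] [Module k X] [AddCommGroup Y] [Module k Y]
  [AddCommGroup X₁] [Module k X₁] [AddCommGroup Y₁] [Module k Y₁]
  [AddCommGroup X₂] [Module k X₂] [AddCommGroup Y₂] [Module k Y₂]
  [AddCommGroup X₃] [Module k X₃] [AddCommGroup Y₃] [Module k Y₃]
  [AddCommGroup Z] [Module k Z] [AddCommGroup Z₁] [Module k Z₁]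

lemma map_sq {a : X →ₗ[k] X₁} {c : X₁ →ₗ[k] X₃} {a' : X →ₗ[k] X₂} {c' : X₂ →ₗ[k] X₃}
    {b : Y →ₗ[k] Y₁} {d : Y₁ →ₗ[k] Y₃} {b' : Y →ₗ[k] Y₂} {d' : Y₂ →ₗ[k] Y₃}
    (h : ∀ x, c (a x) = c' (a' x)) (h' : ∀ y, d (b y) = d' (b' y)) (w : X ⊗[k] Y) :
    TensorProduct.map c d (TensorProduct.map a b w) =
      TensorProduct.map c' d' (TensorProduct.map a' b' w) := by
  rw [← LinearMap.comp_apply, ← LinearMap.comp_apply, ← TensorProduct.map_comp,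
    ← TensorProduct.map_comp, show c ∘ₗ a = c' ∘ₗ a' from LinearMap.ext h,
    show d ∘ₗ b = d' ∘ₗ b' from LinearMap.ext h']

lemma map_tri {a : X →ₗ[k] X₁} {c : X₁ →ₗ[k] X₃} {a' : X →ₗ[k] X₃}
    {b : Y →ₗ[k] Y₁} {d : Y₁ →ₗ[k] Y₃} {b' : Y →ₗ[k] Y₃}
    (h : ∀ x, c (a x) = a' x) (h' : ∀ y, d (b y) = b' y) (w : X ⊗[k] Y) :
    TensorProduct.map c d (TensorProduct.map a b w) = TensorProduct.map a' b' w := by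
  rw [← LinearMap.comp_apply, ← TensorProduct.map_comp, show c ∘ₗ a = a' from LinearMap.ext h,
    show d ∘ₗ b = b' from LinearMap.ext h']

lemma map_assoc_nat (f : X →ₗ[k] X₁) (g : Y →ₗ[k] Y₁) (h : Z →ₗ[k] Z₁)
    (w : (X ⊗[k] Y) ⊗[k] Z) :
    TensorProduct.map f (TensorProduct.map g h) (TensorProduct.assoc k X Y Z w) =
      TensorProduct.assoc k X₁ Y₁ Z₁ (TensorProduct.map (TensorProduct.map f g) h w) :=
  DFunLike.congr_fun (TensorProduct.map_map_comp_assoc_eq f g h) w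

lemma assoc_pentagon (w : ((X ⊗[k] Y) ⊗[k] Z) ⊗[k] X₁) :
    TensorProduct.map LinearMap.id (TensorProduct.assoc k Y Z X₁).toLinearMap
      (TensorProduct.assoc k X (Y ⊗[k] Z) X₁
        (TensorProduct.map (TensorProduct.assoc k X Y Z).toLinearMap LinearMap.id w)) =
    TensorProduct.assoc k X Y (Z ⊗[k] X₁) (TensorProduct.assoc k (X ⊗[k] Y) Z X₁ w) := by
  refine DFunLike.congr_fun (f := TensorProduct.map LinearMap.id
    (TensorProduct.assoc k Y Z X₁).toLinearMap ∘ₗ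
      (TensorProduct.assoc k X (Y ⊗[k] Z) X₁).toLinearMap ∘ₗ
        TensorProduct.map (TensorProduct.assoc k X Y Z).toLinearMap LinearMap.id)
    (g := (TensorProduct.assoc k X Y (Z ⊗[k] X₁)).toLinearMap ∘ₗ
      (TensorProduct.assoc k (X ⊗[k] Y) Z X₁).toLinearMap) ?_ w
  exact TensorProduct.ext_fourfold fun _ _ _ _ => rfl

end

namespace HopfTrimodule

lemma inc_cotMapT {X Y X' Y' : HopfTrimodule k B} (f : X ⟶ X') (g : Y ⟶ Y') (z : X.cotT Y) :
    inc X'.rcoact Y'.lcoact ((cotMapT f g).lin z) =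
      TensorProduct.map f.lin g.lin (inc X.rcoact Y.lcoact z) := rfl

@[simp] lemma id_lin (X : HopfTrimodule k B) : Hom.lin (𝟙 X) = LinearMap.id := rfl
@[simp] lemma comp_lin {X Y Z : HopfTrimodule k B} (f : X ⟶ Y) (g : Y ⟶ Z) :
    (f ≫ g).lin = g.lin ∘ₗ f.lin := rfl

/-- The inclusion of `X □ (Y □ Z)` into `X ⊗ (Y ⊗ Z)`. -/
def incR (X Y Z : HopfTrimodule k B) : X.cotT (Y.cotT Z) →ₗ[k] X ⊗[k] (Y ⊗[k] Z) :=
  incRight X.rcoact (Y.cotL Z.toLComod)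

/-- The inclusion of `(X □ Y) □ Z` into `(X ⊗ Y) ⊗ Z`. -/
def incLf (X Y Z : HopfTrimodule k B) : (X.cotT Y).cotT Z →ₗ[k] (X ⊗[k] Y) ⊗[k] Z :=
  incLeft Z.lcoact (X.cotR Y.toBicomod)

lemma incR_inj (X Y Z : HopfTrimodule k B) : Function.Injective (incR X Y Z) := incRight_inj

lemma incR_assocT (X Y Z : HopfTrimodule k B) (z : (X.cotT Y).cotT Z) :
    incR X Y Z ((assocT X Y Z).hom.lin z) = TensorProduct.assoc k X Y Z (incLf X Y Z z) :=
  cotAssoc_spec (X.cotR_spec Y.toBicomod) (Y.cotL_spec Z.toLComod) z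

lemma incR_map {X Y Z X' Y' Z' : HopfTrimodule k B} (f : X ⟶ X') (g : Y ⟶ Y') (h : Z ⟶ Z')
    (z : X.cotT (Y.cotT Z)) : incR X' Y' Z' ((cotMapT f (cotMapT g h)).lin z) =
      TensorProduct.map f.lin (TensorProduct.map g.lin h.lin) (incR X Y Z z) :=
  map_sq (a := f.lin) (c := LinearMap.id) (a' := LinearMap.id) (c' := f.lin)
    (b := (cotMapT g h).lin) (d := inc Y'.rcoact Z'.lcoact) (b' := inc Y.rcoact Z.lcoact)
    (d' := TensorProduct.map g.lin h.lin) (fun _ => rfl) (fun _ => rfl)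
    (inc X.rcoact (Y.cotL Z.toLComod) z)

lemma incLf_map {X Y Z X' Y' Z' : HopfTrimodule k B} (f : X ⟶ X') (g : Y ⟶ Y') (h : Z ⟶ Z')
    (z : (X.cotT Y).cotT Z) : incLf X' Y' Z' ((cotMapT (cotMapT f g) h).lin z) =
      TensorProduct.map (TensorProduct.map f.lin g.lin) h.lin (incLf X Y Z z) :=
  map_sq (b := h.lin) (d := LinearMap.id) (b' := LinearMap.id) (d' := h.lin)
    (a := (cotMapT f g).lin) (c := inc X'.rcoact Y'.lcoact) (a' := inc X.rcoact Y.lcoact)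
    (c' := TensorProduct.map f.lin g.lin) (fun _ => rfl) (fun _ => rfl)
    (inc (X.cotR Y.toBicomod) Z.lcoact z)

lemma assocT_naturality {X Y Z X' Y' Z' : HopfTrimodule k B} (f : X ⟶ X') (g : Y ⟶ Y')
    (h : Z ⟶ Z') : cotMapT (cotMapT f g) h ≫ (assocT X' Y' Z').hom =
      (assocT X Y Z).hom ≫ cotMapT f (cotMapT g h) :=
  Hom.ext (LinearMap.ext fun z => incR_inj X' Y' Z' (by
    refine (incR_assocT X' Y' Z' _).trans ?_
    refine Eq.trans ?_ (incR_map f g h _).symm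
    rw [incLf_map, incR_assocT]
    exact (DFunLike.congr_fun (TensorProduct.map_map_comp_assoc_eq f.lin g.lin h.lin)
      (incLf X Y Z z)).symm))

lemma leftUnitT_naturality {X Y : HopfTrimodule k B} (f : X ⟶ Y) :
    f ≫ Y.leftUnitT.hom = X.leftUnitT.hom ≫ cotMapT (𝟙 (reg k B)) f :=
  ext_cot fun w => DFunLike.congr_fun f.lcomm w

lemma rightUnitT_naturality {X Y : HopfTrimodule k B} (f : X ⟶ Y) :
    f ≫ Y.rightUnitT.hom = X.rightUnitT.hom ≫ cotMapT f (𝟙 (reg k B)) :=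
  ext_cot fun w => DFunLike.congr_fun f.rcomm w

lemma triangleT (X Y : HopfTrimodule k B) :
    cotMapT X.rightUnitT.hom (𝟙 Y) ≫ (assocT X (reg k B) Y).hom =
      cotMapT (𝟙 X) Y.leftUnitT.hom :=
  Hom.ext (LinearMap.ext fun z => incR_inj X (reg k B) Y (by
    refine (incR_assocT X (reg k B) Y _).trans ?_
    have h1 : incLf X (reg k B) Y ((cotMapT X.rightUnitT.hom (𝟙 Y)).lin z) =
        X.rcoact.rTensor Y (inc X.rcoact Y.lcoact z) :=
      map_tri (fun _ => rfl) (fun _ => rfl) (inc X.rcoact Y.lcoact z)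
    have h2 : incR X (reg k B) Y ((cotMapT (𝟙 X) Y.leftUnitT.hom).lin z) =
        Y.lcoact.lTensor X (inc X.rcoact Y.lcoact z) :=
      map_tri (fun _ => rfl) (fun _ => rfl) (inc X.rcoact Y.lcoact z)
    rw [h1]
    exact (incl_mem z).trans h2.symm))

lemma pentagonT (W X Y Z : HopfTrimodule k B) :
    cotMapT (assocT W X Y).hom (𝟙 Z) ≫ (assocT W (X.cotT Y) Z).hom ≫
      cotMapT (𝟙 W) (assocT X Y Z).hom =
    (assocT (W.cotT X) Y Z).hom ≫ (assocT W X (Y.cotT Z)).hom := by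
  refine Hom.ext (LinearMap.ext fun z => ?_)
  /- the inclusion into `W ⊗ (X ⊗ (Y ⊗ Z))` -/
  have inj : Function.Injective ((incR X Y Z).lTensor W ∘ₗ inc W.rcoact (X.cotT (Y.cotT Z)).lcoact) :=
    (lTensor_inj (incR_inj X Y Z)).comp (inc_inj _ _)
  refine inj ?_
  /- the inclusion of the source into `((W ⊗ X) ⊗ Y) ⊗ Z` -/
  let v : ((W ⊗[k] X) ⊗[k] Y) ⊗[k] Z :=
    TensorProduct.map (incLf W X Y) LinearMap.id (inc ((W.cotT X).cotT Y).rcoact Z.lcoact z)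
  let u := (cotMapT (assocT W X Y).hom (𝟙 Z)).lin z
  let w := (assocT W (X.cotT Y) Z).hom.lin u
  let y := (assocT (W.cotT X) Y Z).hom.lin z
  have hu : TensorProduct.map (TensorProduct.map LinearMap.id (inc X.rcoact Y.lcoact))
      LinearMap.id (incLf W (X.cotT Y) Z u) =
      TensorProduct.map (TensorProduct.assoc k W X Y).toLinearMap LinearMap.id v := by
    refine (map_tri (a' := incR W X Y) (b' := LinearMap.id) (fun _ => rfl) (fun _ => rfl)
      (inc (W.cotT (X.cotT Y)).rcoact Z.lcoact u)).trans ?_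
    exact map_sq (a := (assocT W X Y).hom.lin) (b := LinearMap.id) (incR_assocT W X Y)
      (fun _ => rfl) (inc ((W.cotT X).cotT Y).rcoact Z.lcoact z)
  have hw : TensorProduct.map LinearMap.id (incLf X Y Z)
      (inc W.rcoact ((X.cotT Y).cotT Z).lcoact w) = TensorProduct.assoc k W (X ⊗[k] Y) Z
      (TensorProduct.map (TensorProduct.assoc k W X Y).toLinearMap LinearMap.id v) := by
    rw [← hu]
    refine Eq.trans ?_ (map_assoc_nat (LinearMap.id (M := W)) (inc X.rcoact Y.lcoact)
      (LinearMap.id (M := Z)) (incLf W (X.cotT Y) Z u))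
    refine Eq.trans ?_ (congrArg (TensorProduct.map LinearMap.id
      (TensorProduct.map (inc X.rcoact Y.lcoact) LinearMap.id)) (incR_assocT W (X.cotT Y) Z u))
    exact (map_tri (fun _ => rfl) (fun _ => rfl) _).symm
  have hl : ∀ w, TensorProduct.map LinearMap.id (incR X Y Z)
      (inc W.rcoact (X.cotT (Y.cotT Z)).lcoact ((cotMapT (𝟙 W) (assocT X Y Z).hom).lin w)) =
      TensorProduct.map LinearMap.id (TensorProduct.assoc k X Y Z).toLinearMap
        (TensorProduct.map LinearMap.id (incLf X Y Z)
          (inc W.rcoact ((X.cotT Y).cotT Z).lcoact w)) := fun w =>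
    map_sq (a := LinearMap.id) (b := (assocT X Y Z).hom.lin) (fun _ => rfl) (incR_assocT X Y Z)
      (inc W.rcoact ((X.cotT Y).cotT Z).lcoact w)
  have hy : TensorProduct.map LinearMap.id (inc Y.rcoact Z.lcoact) (incLf W X (Y.cotT Z) y) =
      TensorProduct.assoc k (W ⊗[k] X) Y Z v := by
    have h1 : TensorProduct.map LinearMap.id (inc Y.rcoact Z.lcoact) (incLf W X (Y.cotT Z) y) =
        TensorProduct.map (inc W.rcoact X.lcoact) LinearMap.id (incR (W.cotT X) Y Z y) :=
      map_sq (a := inc W.rcoact X.lcoact) (c := LinearMap.id) (a' := LinearMap.id)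
        (c' := inc W.rcoact X.lcoact) (b := LinearMap.id) (d := inc Y.rcoact Z.lcoact)
        (b' := inc Y.rcoact Z.lcoact) (d' := LinearMap.id) (fun _ => rfl) (fun _ => rfl)
        (inc (W.cotT X).rcoact (Y.cotT Z).lcoact y)
    rw [h1]
    refine (congrArg (TensorProduct.map (inc W.rcoact X.lcoact) LinearMap.id)
      (incR_assocT (W.cotT X) Y Z z)).trans ?_
    have h2 := map_assoc_nat (inc W.rcoact X.lcoact) (LinearMap.id (M := Y)) (LinearMap.id (M := Z))
      (incLf (W.cotT X) Y Z z)
    rw [TensorProduct.map_id] at h2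
    refine h2.trans ?_
    refine congrArg (TensorProduct.assoc k (W ⊗[k] X) Y Z) ?_
    exact map_tri (fun _ => rfl) (fun _ => rfl) (inc ((W.cotT X).cotT Y).rcoact Z.lcoact z)
  have hr : TensorProduct.map LinearMap.id (incR X Y Z)
      (inc W.rcoact (X.cotT (Y.cotT Z)).lcoact ((assocT W X (Y.cotT Z)).hom.lin y)) =
      TensorProduct.assoc k W X (Y ⊗[k] Z) (TensorProduct.assoc k (W ⊗[k] X) Y Z v) := by
    have h2 := map_assoc_nat (LinearMap.id (M := W)) (LinearMap.id (M := X))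
      (inc Y.rcoact Z.lcoact) (incLf W X (Y.cotT Z) y)
    rw [TensorProduct.map_id] at h2
    rw [← hy]
    refine Eq.trans ?_ h2
    refine Eq.trans ?_ (congrArg (TensorProduct.map LinearMap.id
      (TensorProduct.map LinearMap.id (inc Y.rcoact Z.lcoact))) (incR_assocT W X (Y.cotT Z) y))
    exact (map_tri (fun _ => rfl) (fun _ => rfl) _).symm
  refine (hl w).trans ?_
  rw [hw, assoc_pentagon]
  exact hr.symm

instance : MonoidalCategory (HopfTrimodule k B) where
  tensorHom_def f g := ext_cot fun w => by
    change TensorProduct.map f.lin g.lin _ = TensorProduct.map LinearMap.id g.lin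
      (TensorProduct.map f.lin LinearMap.id _)
    rw [← LinearMap.comp_apply, ← TensorProduct.map_comp]; rfl
  id_tensorHom_id X Y := ext_cot fun w => DFunLike.congr_fun TensorProduct.map_id _
  tensorHom_comp_tensorHom f f' g g' := ext_cot fun w => 
    (DFunLike.congr_fun (TensorProduct.map_comp g.lin g'.lin f.lin f'.lin) _).symm
  whiskerLeft_id X Y := ext_cot fun w => DFunLike.congr_fun TensorProduct.map_id _
  id_whiskerRight X Y := ext_cot fun w => DFunLike.congr_fun TensorProduct.map_id _
  associator_naturality f g h := assocT_naturality f g h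
  leftUnitor_naturality {X Y} f := by
    change cotMapT (𝟙 (reg k B)) f ≫ Y.leftUnitT.inv = X.leftUnitT.inv ≫ f
    rw [Iso.comp_inv_eq, Category.assoc, Iso.eq_inv_comp, leftUnitT_naturality]
  rightUnitor_naturality {X Y} f := by
    change cotMapT f (𝟙 (reg k B)) ≫ Y.rightUnitT.inv = X.rightUnitT.inv ≫ f
    rw [Iso.comp_inv_eq, Category.assoc, Iso.eq_inv_comp, rightUnitT_naturality]
  pentagon W X Y Z := pentagonT W X Y Z
  triangle X Y := by
    have comp : ∀ {P Q R : HopfTrimodule k B} (f : P ⟶ Q) (g : Q ⟶ R) (V : HopfTrimodule k B),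
        cotMapT f (𝟙 V) ≫ cotMapT g (𝟙 V) = cotMapT (f ≫ g) (𝟙 V) := fun f g V =>
      ext_cot fun w => map_tri (fun _ => rfl) (fun _ => rfl) _
    have comp' : ∀ {P Q R : HopfTrimodule k B} (f : P ⟶ Q) (g : Q ⟶ R) (V : HopfTrimodule k B),
        cotMapT (𝟙 V) f ≫ cotMapT (𝟙 V) g = cotMapT (𝟙 V) (f ≫ g) := fun f g V =>
      ext_cot fun w => map_tri (fun _ => rfl) (fun _ => rfl) _
    have idd : ∀ P Q : HopfTrimodule k B, cotMapT (𝟙 P) (𝟙 Q) = 𝟙 (P.cotT Q) := fun P Q =>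
      ext_cot fun w => DFunLike.congr_fun TensorProduct.map_id _
    change (assocT X (reg k B) Y).hom ≫ cotMapT (𝟙 X) Y.leftUnitT.inv =
      cotMapT X.rightUnitT.inv (𝟙 Y)
    have key := congrArg (fun t => cotMapT X.rightUnitT.inv (𝟙 Y) ≫ t ≫
      cotMapT (𝟙 X) Y.leftUnitT.inv) (triangleT X Y)
    simp only [Category.assoc] at key
    rw [← Category.assoc, comp, comp', Iso.inv_hom_id, Iso.hom_inv_id, idd, idd, Category.comp_id,
      Category.id_comp] at key
    exact key

end HopfTrimodule

section ChiUnbundled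

variable {X M N : Type u} [AddCommGroup X] [Module k X] [AddCommGroup M] [Module k M]
  [AddCommGroup N] [Module k N]

/-- The linear map `M ⊗ (X ⊗ N) → X ⊗ (M ⊗ N)`, `m ⊗ (x ⊗ n) ↦ m₍₋₁₎ x ⊗ (m₍₀₎ ⊗ n)`. -/
def chiAmb (a : B →ₗ[k] Module.End k X) (lM : M →ₗ[k] B ⊗[k] M) :
    M ⊗[k] (X ⊗[k] N) →ₗ[k] X ⊗[k] (M ⊗[k] N) :=
  shuffleL a ∘ₗ TensorProduct.map lM LinearMap.id

lemma chiAmb_tmul (a : B →ₗ[k] Module.End k X) (lM : M →ₗ[k] B ⊗[k] M) (m : M) (w : X ⊗[k] N) :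
    chiAmb a lM (m ⊗ₜ w) = shuffleL a (lM m ⊗ₜ w) := by simp [chiAmb]

lemma cf_shuffle {a : B →ₗ[k] Module.End k X} {r : X →ₗ[k] X ⊗[k] B}
    (ha : ∀ b x, r (a b x) = dact a (LinearMap.mul k B) (Coalgebra.comul b) (r x))
    (s : B ⊗[k] M) (w : X ⊗[k] N) : cf r (shuffleL a (s ⊗ₜ w)) =
      (shuffleL (LinearMap.mul k B)).lTensor X (shuffleL a
        (TensorProduct.assoc k B B M ((Coalgebra.comul (R := k) (A := B)).rTensor M s) ⊗ₜ
          cf r w)) := by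
  induction s with
  | zero => simp
  | add s t hs ht => simp only [TensorProduct.add_tmul, map_add, hs, ht]
  | tmul b m =>
    induction w with
    | zero => simp
    | add s t hs ht => simp only [TensorProduct.tmul_add, map_add, hs, ht]
    | tmul x n =>
      simp only [shuffleL_tmul, cf_tmul, ha, LinearMap.rTensor_tmul]
      induction Coalgebra.comul (R := k) b with
      | zero => simp
      | add s t hs ht => simp only [TensorProduct.add_tmul, map_add, LinearMap.add_apply, hs, ht]
      | tmul c c' =>
        induction r x with
        | zero => simp
        | add s t hs ht => simp only [TensorProduct.tmul_add, TensorProduct.add_tmul, map_add, hs, ht]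
        | tmul y d => simp

lemma coL_shuffle {a : B →ₗ[k] Module.End k X} {l : X →ₗ[k] B ⊗[k] X}
    (ha : ∀ b x, l (a b x) = dact (LinearMap.mul k B) a (Coalgebra.comul b) (l x))
    (s : B ⊗[k] M) (w : X ⊗[k] N) : coL l (shuffleL a (s ⊗ₜ w)) =
      (shuffleL a).lTensor B (shuffleL (LinearMap.mul k B)
        (TensorProduct.assoc k B B M ((Coalgebra.comul (R := k) (A := B)).rTensor M s) ⊗ₜ
          coL l w)) := by
  induction s with
  | zero => simp
  | add s t hs ht => simp only [TensorProduct.add_tmul, map_add, hs, ht]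
  | tmul b m =>
    induction w with
    | zero => simp
    | add s t hs ht => simp only [TensorProduct.tmul_add, map_add, hs, ht]
    | tmul x n =>
      simp only [shuffleL_tmul, coL_tmul, ha, LinearMap.rTensor_tmul]
      induction Coalgebra.comul (R := k) b with
      | zero => simp
      | add s t hs ht => simp only [TensorProduct.add_tmul, map_add, LinearMap.add_apply, hs, ht]
      | tmul c c' =>
        induction l x with
        | zero => simp
        | add s t hs ht => simp only [TensorProduct.tmul_add, TensorProduct.add_tmul, map_add, hs, ht]
        | tmul y d => simp

lemma cg_shuffle (a : B →ₗ[k] Module.End k X) (lM : M →ₗ[k] B ⊗[k] M) (lN : N →ₗ[k] B ⊗[k] N)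
    (s : B ⊗[k] M) (w : X ⊗[k] N) : cg (diagL lM lN) (shuffleL a (s ⊗ₜ w)) =
      (shuffleL (LinearMap.mul k B)).lTensor X
        (shuffleL a (lM.lTensor B s ⊗ₜ cg lN w)) := by
  rw [cg, diagL, LinearMap.lTensor_comp_apply, shuffleL_nat]; rfl

/-- The interchange map `M ⊗ (X □ N) → X □ (M ⊗ N)`, `m ⊗ (x ⊗ n) ↦ m₍₋₁₎ x ⊗ (m₍₀₎ ⊗ n)`. -/
def chiLin {a : B →ₗ[k] Module.End k X} {r : X →ₗ[k] X ⊗[k] B} {lM : M →ₗ[k] B ⊗[k] M}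
    {lN : N →ₗ[k] B ⊗[k] N}
    (ha : ∀ b x, r (a b x) = dact a (LinearMap.mul k B) (Coalgebra.comul b) (r x))
    (hM : ∀ m, TensorProduct.assoc k B B M
      ((Coalgebra.comul (R := k) (A := B)).rTensor M (lM m)) = lM.lTensor B (lM m)) :
    M ⊗[k] Cot r lN →ₗ[k] Cot r (diagL lM lN) :=
  (chiAmb a lM ∘ₗ (inc r lN).lTensor M).codRestrict _ (fun t => by
    change cf r _ = cg (diagL lM lN) _
    induction t with
    | zero => simp
    | add s t hs ht => simp only [map_add, hs, ht]
    | tmul m z =>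
      simp only [LinearMap.comp_apply, LinearMap.lTensor_tmul, chiAmb_tmul]
      rw [cf_shuffle ha, cg_shuffle, hM, incl_mem])

lemma inc_chiLin {a : B →ₗ[k] Module.End k X} {r : X →ₗ[k] X ⊗[k] B} {lM : M →ₗ[k] B ⊗[k] M}
    {lN : N →ₗ[k] B ⊗[k] N}
    (ha : ∀ b x, r (a b x) = dact a (LinearMap.mul k B) (Coalgebra.comul b) (r x))
    (hM : ∀ m, TensorProduct.assoc k B B M
      ((Coalgebra.comul (R := k) (A := B)).rTensor M (lM m)) = lM.lTensor B (lM m))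
    (t : M ⊗[k] Cot r lN) : inc r (diagL lM lN) (chiLin ha hM t) =
      chiAmb a lM ((inc r lN).lTensor M t) := rfl

lemma chiLin_lcomm {a : B →ₗ[k] Module.End k X} {r : X →ₗ[k] X ⊗[k] B} {lM : M →ₗ[k] B ⊗[k] M}
    {lN : N →ₗ[k] B ⊗[k] N} {l : X →ₗ[k] B ⊗[k] X}
    (ha : ∀ b x, r (a b x) = dact a (LinearMap.mul k B) (Coalgebra.comul b) (r x))
    (hM : ∀ m, TensorProduct.assoc k B B M
      ((Coalgebra.comul (R := k) (A := B)).rTensor M (lM m)) = lM.lTensor B (lM m))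
    (hl : ∀ b x, l (a b x) = dact (LinearMap.mul k B) a (Coalgebra.comul b) (l x))
    {c : Cot r lN →ₗ[k] B ⊗[k] Cot r lN}
    (hc : ∀ z, (inc r lN).lTensor B (c z) = coL l (inc r lN z))
    {d : Cot r (diagL lM lN) →ₗ[k] B ⊗[k] Cot r (diagL lM lN)}
    (hd : ∀ z, (inc r (diagL lM lN)).lTensor B (d z) = coL l (inc r (diagL lM lN) z)) :
    d ∘ₗ chiLin ha hM = (chiLin ha hM).lTensor B ∘ₗ diagL lM c := by
  refine TensorProduct.ext' fun m z => lTensor_inj (inc_inj r (diagL lM lN)) ?_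
  have h : inc r (diagL lM lN) ∘ₗ chiLin ha hM =
    shuffleL a ∘ₗ TensorProduct.map lM (inc r lN) := TensorProduct.ext' fun m z =>
      (inc_chiLin ha hM _).trans (by
        rw [LinearMap.lTensor_tmul, chiAmb_tmul, LinearMap.comp_apply, TensorProduct.map_tmul])
  rw [LinearMap.comp_apply, LinearMap.comp_apply, hd, inc_chiLin, LinearMap.lTensor_tmul,
    chiAmb_tmul, coL_shuffle hl, hM, ← LinearMap.lTensor_comp_apply, h,
    LinearMap.lTensor_comp_apply, diagL_tmul, shuffleL_nat, hc]

lemma chiAmb_nat (a : B →ₗ[k] Module.End k X) {M' N' : Type u} [AddCommGroup M'] [Module k M']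
    [AddCommGroup N'] [Module k N'] {lM : M →ₗ[k] B ⊗[k] M} {lM' : M' →ₗ[k] B ⊗[k] M'}
    {f : M →ₗ[k] M'} (hf : lM' ∘ₗ f = f.lTensor B ∘ₗ lM) (g : N →ₗ[k] N')
    (w : M ⊗[k] (X ⊗[k] N)) :
    chiAmb a lM' (TensorProduct.map f (g.lTensor X) w) =
      (TensorProduct.map f g).lTensor X (chiAmb a lM w) := by
  induction w with
  | zero => simp
  | add s t hs ht => simp only [map_add, hs, ht]
  | tmul m w =>
    have := DFunLike.congr_fun hf m
    simp only [LinearMap.comp_apply] at this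
    rw [TensorProduct.map_tmul, chiAmb_tmul, chiAmb_tmul, this, shuffleL_nat]

lemma chiAmb_assoc_aux {P : Type u} [AddCommGroup P] [Module k P] (a : B →ₐ[k] Module.End k X)
    (s : B ⊗[k] M) (t : B ⊗[k] N) (w : X ⊗[k] P) :
    (TensorProduct.assoc k M N P).toLinearMap.lTensor X
      (shuffleL a.toLinearMap (shuffleL (LinearMap.mul k B) (s ⊗ₜ t) ⊗ₜ w)) =
    shuffleL a.toLinearMap (s ⊗ₜ shuffleL a.toLinearMap (t ⊗ₜ w)) := by
  induction s with
  | zero => simp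
  | add s t hs ht => simp only [TensorProduct.add_tmul, map_add, hs, ht]
  | tmul b m =>
    induction t with
    | zero => simp
    | add s t hs ht => simp only [TensorProduct.tmul_add, TensorProduct.add_tmul, map_add, hs, ht]
    | tmul c n =>
      induction w with
      | zero => simp
      | add s t hs ht => simp only [TensorProduct.tmul_add, map_add, hs, ht]
      | tmul x p => simp

lemma chiAmb_assoc {P : Type u} [AddCommGroup P] [Module k P] (a : B →ₐ[k] Module.End k X)
    (lM : M →ₗ[k] B ⊗[k] M) (lN : N →ₗ[k] B ⊗[k] N) (w : (M ⊗[k] N) ⊗[k] (X ⊗[k] P)) :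
    (TensorProduct.assoc k M N P).toLinearMap.lTensor X
      (chiAmb a.toLinearMap (diagL lM lN) w) =
    chiAmb a.toLinearMap lM ((chiAmb a.toLinearMap lN).lTensor M
      (TensorProduct.assoc k M N (X ⊗[k] P) w)) := by
  refine DFunLike.congr_fun (f := (TensorProduct.assoc k M N P).toLinearMap.lTensor X ∘ₗ
    chiAmb a.toLinearMap (diagL lM lN)) (g := chiAmb a.toLinearMap lM ∘ₗ
      (chiAmb a.toLinearMap lN).lTensor M ∘ₗ
        (TensorProduct.assoc k M N (X ⊗[k] P)).toLinearMap) ?_ w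
  refine TensorProduct.ext_threefold fun m n w => ?_
  simp only [LinearMap.comp_apply, LinearEquiv.coe_coe, TensorProduct.assoc_tmul,
    LinearMap.lTensor_tmul, chiAmb_tmul, diagL_tmul, chiAmb_assoc_aux]

lemma chiLin_assoc {P : Type u} [AddCommGroup P] [Module k P] {a : B →ₐ[k] Module.End k X}
    {r : X →ₗ[k] X ⊗[k] B} {lM : M →ₗ[k] B ⊗[k] M} {lN : N →ₗ[k] B ⊗[k] N}
    (ha : ∀ b x, r (a.toLinearMap b x) =
      dact a.toLinearMap (LinearMap.mul k B) (Coalgebra.comul b) (r x))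
    (hM : ∀ m, TensorProduct.assoc k B B M
      ((Coalgebra.comul (R := k) (A := B)).rTensor M (lM m)) = lM.lTensor B (lM m))
    (hN : ∀ m, TensorProduct.assoc k B B N
      ((Coalgebra.comul (R := k) (A := B)).rTensor N (lN m)) = lN.lTensor B (lN m))
    (lP : P →ₗ[k] B ⊗[k] P) (t : (M ⊗[k] N) ⊗[k] Cot r lP) :
    (TensorProduct.assoc k M N P).toLinearMap.lTensor X (chiAmb a.toLinearMap (diagL lM lN)
      ((inc r lP).lTensor (M ⊗[k] N) t)) =
    inc r (diagL lM (diagL lN lP)) (chiLin ha hM ((chiLin ha hN).lTensor M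
      (TensorProduct.assoc k M N _ t))) := by
  rw [chiAmb_assoc, inc_chiLin]
  refine congrArg (chiAmb a.toLinearMap lM) ?_
  refine DFunLike.congr_fun (f := (chiAmb a.toLinearMap lN).lTensor M ∘ₗ
    (TensorProduct.assoc k M N (X ⊗[k] P)).toLinearMap ∘ₗ (inc r lP).lTensor (M ⊗[k] N))
    (g := (inc r (diagL lN lP)).lTensor M ∘ₗ (chiLin ha hN).lTensor M ∘ₗ
      (TensorProduct.assoc k M N (Cot r lP)).toLinearMap) ?_ t
  exact TensorProduct.ext_threefold fun m n z => rfl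

lemma chiAmb_unit (a : B →ₐ[k] Module.End k X) (w : k ⊗[k] (X ⊗[k] N)) :
    (TensorProduct.lid k N).toLinearMap.lTensor X
      (chiAmb a.toLinearMap (TensorProduct.mk k B k 1) w) = TensorProduct.lid k (X ⊗[k] N) w := by
  refine DFunLike.congr_fun (f := (TensorProduct.lid k N).toLinearMap.lTensor X ∘ₗ
      (chiAmb a.toLinearMap (TensorProduct.mk k B k 1)))
      (g := (TensorProduct.lid k (X ⊗[k] N)).toLinearMap) ?_ w
  refine TensorProduct.ext' fun c w => ?_
  induction w with
  | zero => simp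
  | add s t hs ht => simp only [TensorProduct.tmul_add, map_add, hs, ht]
  | tmul x n => simp [chiAmb_tmul]

end ChiUnbundled

/-! ### Cotensor functors as lax module functors -/

lemma lid_nat {V W : Type u} [AddCommGroup V] [Module k V] [AddCommGroup W] [Module k W]
    (i : V →ₗ[k] W) (t : k ⊗[k] V) :
    i (TensorProduct.lid k V t) = TensorProduct.lid k W (i.lTensor k t) := by
  induction t with
  | zero => simp
  | add s t hs ht => simp only [map_add, hs, ht]
  | tmul c v => simp

namespace HopfTrimodule

/-- The functor `X □ -` on left comodules. -/
@[simps] def cotFunctor (X : HopfTrimodule k B) : LComod k B ⥤ LComod k B where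
  obj M := X.cot M
  map f := Bicomod.cotHom (X := X.toBicomod) (Y := X.toBicomod) (𝟙 X.toLComod) (by simp) f
  map_id M := LComod.hom_ext fun z => inc_inj X.rcoact M.lcoact
    (DFunLike.congr_fun TensorProduct.map_id _)
  map_comp {M N P} f g := LComod.hom_ext fun z => inc_inj X.rcoact P.lcoact
    (map_tri (a := LinearMap.id (M := X)) (c := LinearMap.id) (b := f.lin) (d := g.lin)
      (fun _ => rfl) (fun _ => rfl) (inc X.rcoact M.lcoact z)).symm

/-- The interchange morphism `χ : M ⊗ (X □ N) ⟶ X □ (M ⊗ N)`,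
`m ⊗ (x ⊗ n) ↦ m₍₋₁₎ x ⊗ (m₍₀₎ ⊗ n)`. -/
def chi (X : HopfTrimodule k B) (M N : LComod k B) : M ⊗ X.cot N ⟶ X.cot (M ⊗ N) where
  lin := chiLin (lN := N.lcoact) X.ract M.coassoc_apply
  lcomm := chiLin_lcomm X.ract M.coassoc_apply X.lact (X.cotL_spec N) (X.cotL_spec (M ⊗ N))

lemma inc_chi (X : HopfTrimodule k B) (M N : LComod k B) (t : M ⊗[k] Cot X.rcoact N.lcoact) :
    inc X.rcoact (M ⊗ N).lcoact ((X.chi M N).lin t) =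
      chiAmb X.actL M.lcoact ((inc X.rcoact N.lcoact).lTensor M t) := rfl

lemma chi_unit (X : HopfTrimodule k B) (N : LComod k B) :
    (λ_ (X.cot N)).hom = X.chi (𝟙_ (LComod k B)) N ≫ X.cotFunctor.map (λ_ N).hom := by
  refine LComod.hom_ext fun (t : k ⊗[k] Cot X.rcoact N.lcoact) => ?_
  have h1 : inc X.rcoact N.lcoact (TensorProduct.lid k _ t) =
      (TensorProduct.lid k N).toLinearMap.lTensor X
        (chiAmb X.act.toLinearMap (TensorProduct.mk k B k 1)
          ((inc X.rcoact N.lcoact).lTensor k t)) :=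
    (lid_nat (inc X.rcoact N.lcoact) t).trans
      (chiAmb_unit X.act ((inc X.rcoact N.lcoact).lTensor k t)).symm
  exact inc_inj X.rcoact N.lcoact h1

lemma chi_assoc (X : HopfTrimodule k B) (M N P : LComod k B) :
    X.chi (M ⊗ N) P ≫ X.cotFunctor.map (α_ M N P).hom =
      (α_ M N (X.cot P)).hom ≫ M ◁ X.chi N P ≫ X.chi M (N ⊗ P) := by
  refine LComod.hom_ext fun (t : (M ⊗[k] N) ⊗[k] Cot X.rcoact P.lcoact) => ?_
  have h1 := chiLin_assoc (a := X.act) X.ract M.coassoc_apply N.coassoc_apply P.lcoact t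
  exact inc_inj X.rcoact (M ⊗ (N ⊗ P)).lcoact h1

instance (X : HopfTrimodule k B) : X.cotFunctor.LaxLeftLinear (LComod k B) where
  μₗ M N := X.chi M N
  μₗ_naturality_left {M M'} f N := LComod.hom_ext fun t => inc_inj X.rcoact (M' ⊗ N).lcoact (by
    have h := chiAmb_nat X.actL f.lcomm (LinearMap.id (M := N))
      ((inc X.rcoact N.lcoact).lTensor M t)
    refine Eq.trans ?_ h
    refine congrArg (chiAmb X.actL M'.lcoact) ?_
    exact map_sq (a := f.lin) (c := LinearMap.id) (b := LinearMap.id) (d := inc X.rcoact N.lcoact)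
      (a' := LinearMap.id) (c' := f.lin) (b' := inc X.rcoact N.lcoact)
      (d' := LinearMap.id.lTensor X) (fun _ => rfl) (fun _ => by simp) t)
  μₗ_naturality_right M {N N'} f := LComod.hom_ext fun t => inc_inj X.rcoact (M ⊗ N').lcoact (by
    have h := chiAmb_nat X.actL (lM := M.lcoact) (lM' := M.lcoact) (f := LinearMap.id)
      (by simp) f.lin
      ((inc X.rcoact N.lcoact).lTensor M t)
    refine Eq.trans ?_ h
    refine congrArg (chiAmb X.actL M.lcoact) ?_
    exact map_sq (a := LinearMap.id) (c := LinearMap.id) (b := (X.cotFunctor.map f).lin)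
      (d := inc X.rcoact N'.lcoact)
      (a' := LinearMap.id) (c' := LinearMap.id) (b' := inc X.rcoact N.lcoact)
      (d' := f.lin.lTensor X) (fun _ => rfl) (fun _ => rfl) t)
  μₗ_associativity M N P := X.chi_assoc M N P
  μₗ_unitality N := X.chi_unit N

end HopfTrimodule

end Bicomod

/-! ### Lax module endofunctors -/

section LaxModEnd

open Functor.LaxLeftLinear MonoidalLeftAction

universe v w

variable (C : Type w) [Category.{v} C] [MonoidalCategory C]

/-- Lax left `C`-module endofunctors of the regular `C`-module `C`. -/
structure LaxModEnd where
  /-- the underlying functor -/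
  functor : C ⥤ C
  /-- the lax module structure `c ⊗ F d ⟶ F (c ⊗ d)` -/
  [lax : functor.LaxLeftLinear C]

attribute [instance] LaxModEnd.lax

variable {C}

namespace LaxModEnd

/-- The structure morphism `c ⊗ F d ⟶ F (c ⊗ d)` of a lax module functor. -/
def μ (F : LaxModEnd C) (c d : C) : c ⊗ F.functor.obj d ⟶ F.functor.obj (c ⊗ d) :=
  μₗ F.functor c d

lemma μ_natL (F : LaxModEnd C) {c c' : C} (f : c ⟶ c') (d : C) :
    f ▷ F.functor.obj d ≫ F.μ c' d = F.μ c d ≫ F.functor.map (f ▷ d) :=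
  Functor.LaxLeftLinear.μₗ_naturality_left F.functor f d

lemma μ_natR (F : LaxModEnd C) (c : C) {d d' : C} (f : d ⟶ d') :
    c ◁ F.functor.map f ≫ F.μ c d' = F.μ c d ≫ F.functor.map (c ◁ f) :=
  Functor.LaxLeftLinear.μₗ_naturality_right F.functor c f

lemma μ_assoc (F : LaxModEnd C) (c c' d : C) :
    F.μ (c ⊗ c') d ≫ F.functor.map (α_ c c' d).hom =
      (α_ c c' (F.functor.obj d)).hom ≫ c ◁ F.μ c' d ≫ F.μ c (c' ⊗ d) :=
  Functor.LaxLeftLinear.μₗ_associativity F.functor c c' d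

lemma μ_unit (F : LaxModEnd C) (d : C) :
    (λ_ (F.functor.obj d)).hom = F.μ (𝟙_ C) d ≫ F.functor.map (λ_ d).hom :=
  Functor.LaxLeftLinear.μₗ_unitality (C := C) F.functor d

/-- Module transformations between lax module functors: natural transformations compatible with
the structure morphisms. -/
@[ext]
structure Hom (F G : LaxModEnd C) where
  /-- the underlying natural transformation -/
  nat : F.functor ⟶ G.functor
  comm : ∀ c d : C, c ◁ nat.app d ≫ G.μ c d = F.μ c d ≫ nat.app (c ⊗ d)

instance : Category (LaxModEnd C) where
  Hom := Hom
  id F := ⟨𝟙 _, fun c d => by simp⟩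
  comp f g := ⟨f.nat ≫ g.nat, fun c d => by
    rw [NatTrans.comp_app, NatTrans.comp_app, MonoidalCategory.whiskerLeft_comp, Category.assoc,
      g.comm, ← Category.assoc, f.comm, Category.assoc]⟩

@[simp] lemma id_nat (F : LaxModEnd C) : Hom.nat (𝟙 F) = 𝟙 F.functor := rfl
@[simp] lemma comp_nat {F G H : LaxModEnd C} (f : F ⟶ G) (g : G ⟶ H) :
    (f ≫ g).nat = f.nat ≫ g.nat := rfl

lemma hom_ext {F G : LaxModEnd C} {f g : F ⟶ G} (h : ∀ c, f.nat.app c = g.nat.app c) : f = g :=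
  Hom.ext (NatTrans.ext (funext h))

/-- The identity lax module functor. -/
def unit : LaxModEnd C where
  functor := 𝟭 C
  lax :=
    { μₗ := fun c d => 𝟙 (c ⊗ d)
      μₗ_naturality_left := by intros; simp
      μₗ_naturality_right := by intros; simp
      μₗ_associativity := by intros; simp
      μₗ_unitality := by intros; simp }

lemma comp_natL (F G : LaxModEnd C) {c c' : C} (f : c ⟶ c') (d : C) :
    f ▷ F.functor.obj (G.functor.obj d) ≫ F.μ c' (G.functor.obj d) ≫ F.functor.map (G.μ c' d) =
      (F.μ c (G.functor.obj d) ≫ F.functor.map (G.μ c d)) ≫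
        F.functor.map (G.functor.map (f ▷ d)) := by
  rw [Category.assoc, ← F.functor.map_comp, ← μ_natL, F.functor.map_comp, reassoc_of% F.μ_natL]

lemma comp_natR (F G : LaxModEnd C) (c : C) {d d' : C} (f : d ⟶ d') :
    c ◁ F.functor.map (G.functor.map f) ≫ F.μ c (G.functor.obj d') ≫ F.functor.map (G.μ c d') =
      (F.μ c (G.functor.obj d) ≫ F.functor.map (G.μ c d)) ≫
        F.functor.map (G.functor.map (c ◁ f)) := by
  rw [Category.assoc, ← F.functor.map_comp, ← μ_natR, F.functor.map_comp, reassoc_of% F.μ_natR]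

lemma comp_assoc (F G : LaxModEnd C) (c c' d : C) :
    (F.μ (c ⊗ c') (G.functor.obj d) ≫ F.functor.map (G.μ (c ⊗ c') d)) ≫
        F.functor.map (G.functor.map (α_ c c' d).hom) =
      (α_ c c' (F.functor.obj (G.functor.obj d))).hom ≫
        c ◁ (F.μ c' (G.functor.obj d) ≫ F.functor.map (G.μ c' d)) ≫
          F.μ c (G.functor.obj (c' ⊗ d)) ≫ F.functor.map (G.μ c (c' ⊗ d)) := by
  rw [Category.assoc, ← F.functor.map_comp, G.μ_assoc, F.functor.map_comp, reassoc_of% F.μ_assoc,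
    F.functor.map_comp, MonoidalCategory.whiskerLeft_comp, Category.assoc, reassoc_of% F.μ_natR]

lemma comp_unit (F G : LaxModEnd C) (d : C) : (λ_ (F.functor.obj (G.functor.obj d))).hom =
    (F.μ (𝟙_ C) (G.functor.obj d) ≫ F.functor.map (G.μ (𝟙_ C) d)) ≫
      F.functor.map (G.functor.map (λ_ d).hom) := by
  rw [Category.assoc, ← F.functor.map_comp, ← G.μ_unit, F.μ_unit]

/-- The composite `F ∘ G` of lax module functors, with structure
`c ⊗ F (G d) ⟶ F (c ⊗ G d) ⟶ F (G (c ⊗ d))`. -/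
def comp (F G : LaxModEnd C) : LaxModEnd C where
  functor := G.functor ⋙ F.functor
  lax :=
    { μₗ := fun c d => F.μ c (G.functor.obj d) ≫ F.functor.map (G.μ c d)
      μₗ_naturality_left := fun f d => comp_natL F G f d
      μₗ_naturality_right := fun c _ _ f => comp_natR F G c f
      μₗ_associativity := fun c c' d => comp_assoc F G c c' d
      μₗ_unitality := fun d => comp_unit F G d }

lemma compMap_comm {F F' G G' : LaxModEnd C} (f : F ⟶ F') (g : G ⟶ G') (c d : C) :
    c ◁ (f.nat.app (G.functor.obj d) ≫ F'.functor.map (g.nat.app d)) ≫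
        F'.μ c (G'.functor.obj d) ≫ F'.functor.map (G'.μ c d) =
      (F.μ c (G.functor.obj d) ≫ F.functor.map (G.μ c d)) ≫
        f.nat.app (G.functor.obj (c ⊗ d)) ≫ F'.functor.map (g.nat.app (c ⊗ d)) := by
  rw [MonoidalCategory.whiskerLeft_comp, Category.assoc, reassoc_of% F'.μ_natR,
    ← F'.functor.map_comp, g.comm, F'.functor.map_comp, reassoc_of% f.comm]
  simp

/-- The horizontal composite of module transformations. -/
def compMap {F F' G G' : LaxModEnd C} (f : F ⟶ F') (g : G ⟶ G') : F.comp G ⟶ F'.comp G' where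
  nat := (g.nat ◫ f.nat : G.functor ⋙ F.functor ⟶ G'.functor ⋙ F'.functor)
  comm c d := by
    have := compMap_comm f g c d
    exact this

/-- An isomorphism from identity components. -/
def isoOfId {F G : LaxModEnd C} (e : F.functor ≅ G.functor)
    (h : ∀ c d : C, c ◁ e.hom.app d ≫ G.μ c d = F.μ c d ≫ e.hom.app (c ⊗ d)) :
    F ≅ G where
  hom := ⟨e.hom, h⟩
  inv := ⟨e.inv, fun c d => by
    have h' : c ◁ e.hom.app d ≫ c ◁ e.inv.app d = 𝟙 _ := by
      rw [← MonoidalCategory.whiskerLeft_comp]; simp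
    have h'' : c ◁ e.inv.app d ≫ c ◁ e.hom.app d = 𝟙 _ := by
      rw [← MonoidalCategory.whiskerLeft_comp]; simp
    have := congrArg (fun t => c ◁ e.inv.app d ≫ t ≫ e.inv.app (c ⊗ d)) (h c d)
    simp only [Category.assoc] at this
    rw [reassoc_of% h''] at this
    simp [this]⟩
  hom_inv_id := hom_ext fun c => by simp
  inv_hom_id := hom_ext fun c => by simp

lemma comp_coh₁ (F G H : LaxModEnd C) (c d : C) :
    c ◁ 𝟙 (F.functor.obj (G.functor.obj (H.functor.obj d))) ≫
        F.μ c (G.functor.obj (H.functor.obj d)) ≫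
          F.functor.map (G.μ c (H.functor.obj d) ≫ G.functor.map (H.μ c d)) =
      ((F.μ c (G.functor.obj (H.functor.obj d)) ≫ F.functor.map (G.μ c (H.functor.obj d))) ≫
        F.functor.map (G.functor.map (H.μ c d))) ≫ 𝟙 _ := by
  simp

lemma comp_coh₂ (F : LaxModEnd C) (c d : C) :
    c ◁ 𝟙 (F.functor.obj d) ≫ F.μ c d = (𝟙 (c ⊗ F.functor.obj d) ≫ F.μ c d) ≫ 𝟙 _ := by
  simp

lemma comp_coh₃ (F : LaxModEnd C) (c d : C) :
    c ◁ 𝟙 (F.functor.obj d) ≫ F.μ c d = (F.μ c d ≫ F.functor.map (𝟙 (c ⊗ d))) ≫ 𝟙 _ := by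
  simp

instance : MonoidalCategoryStruct (LaxModEnd C) where
  tensorObj := comp
  tensorUnit := unit
  tensorHom := compMap
  whiskerLeft F _ _ g := compMap (𝟙 F) g
  whiskerRight f G := compMap f (𝟙 G)
  associator F G H := isoOfId (F := (F.comp G).comp H) (G := F.comp (G.comp H))
    (Iso.refl (H.functor ⋙ G.functor ⋙ F.functor)) (fun c d => comp_coh₁ F G H c d)
  leftUnitor F := isoOfId (F := unit.comp F) (G := F) (Iso.refl F.functor)
    (fun c d => comp_coh₂ F c d)
  rightUnitor F := isoOfId (F := F.comp unit) (G := F) (Iso.refl F.functor)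
    (fun c d => comp_coh₃ F c d)

lemma compMap_app {F F' G G' : LaxModEnd C} (f : F ⟶ F') (g : G ⟶ G') (c : C) :
    (compMap f g).nat.app c = f.nat.app (G.functor.obj c) ≫ F'.functor.map (g.nat.app c) := rfl

lemma comp_app {F G H : LaxModEnd C} (f : F ⟶ G) (g : G ⟶ H) (c : C) :
    (f ≫ g).nat.app c = f.nat.app c ≫ g.nat.app c := rfl

instance : MonoidalCategory (LaxModEnd C) where
  tensorHom_def {F F' G G'} f g := hom_ext fun c => by
    change f.nat.app _ ≫ F'.functor.map _ =
      (f.nat.app _ ≫ F'.functor.map (𝟙 _)) ≫ 𝟙 (F'.functor.obj _) ≫ F'.functor.map _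
    simp
  id_tensorHom_id F G := hom_ext fun c => by
    change 𝟙 (F.functor.obj (G.functor.obj c)) ≫ F.functor.map (𝟙 _) = 𝟙 _
    simp
  tensorHom_comp_tensorHom {F F' F'' G G' G''} f f' g g' := hom_ext fun c => by
    change (f.nat.app _ ≫ F'.functor.map (f'.nat.app c)) ≫ g.nat.app _ ≫ F''.functor.map _ =
      (f.nat.app _ ≫ g.nat.app _) ≫ F''.functor.map (f'.nat.app c ≫ g'.nat.app c)
    simp
  whiskerLeft_id F G := hom_ext fun c => by
    change 𝟙 (F.functor.obj (G.functor.obj c)) ≫ F.functor.map (𝟙 _) = 𝟙 _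
    simp
  id_whiskerRight F G := hom_ext fun c => by
    change 𝟙 (F.functor.obj (G.functor.obj c)) ≫ F.functor.map (𝟙 _) = 𝟙 _
    simp
  associator_naturality {F G H F' G' H'} f g h := hom_ext fun c => by
    change ((f.nat.app _ ≫ F'.functor.map (g.nat.app _)) ≫ F'.functor.map (G'.functor.map _)) ≫
      𝟙 (F'.functor.obj (G'.functor.obj (H'.functor.obj c))) =
        𝟙 _ ≫ f.nat.app _ ≫ F'.functor.map (_ ≫ _)
    simp
  leftUnitor_naturality {F G} f := hom_ext fun c => by
    change (𝟙 (F.functor.obj c) ≫ f.nat.app c) ≫ 𝟙 _ = 𝟙 _ ≫ f.nat.app c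
    simp
  rightUnitor_naturality {F G} f := hom_ext fun c => by
    change (f.nat.app c ≫ G.functor.map (𝟙 c)) ≫ 𝟙 _ = 𝟙 _ ≫ f.nat.app c
    simp
  pentagon W X Y Z := hom_ext fun c => by
    let A := W.functor.obj (X.functor.obj (Y.functor.obj (Z.functor.obj c)))
    change (𝟙 A ≫ W.functor.map (X.functor.map (Y.functor.map (𝟙 _)))) ≫ 𝟙 A ≫ 𝟙 A ≫
      W.functor.map (𝟙 (X.functor.obj (Y.functor.obj (Z.functor.obj c)))) = 𝟙 A ≫ 𝟙 A
    simp [A]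
  triangle F G := hom_ext fun c => by
    let A := F.functor.obj (G.functor.obj c)
    change 𝟙 A ≫ 𝟙 A ≫ F.functor.map (𝟙 (G.functor.obj c)) = 𝟙 A ≫ F.functor.map (𝟙 _)
    simp

end LaxModEnd

end LaxModEnd

/-! ### The category of left exact finitary lax module endofunctors -/

section LexLax

variable (k B : Type u) [Field k] [Ring B] [Bialgebra k B]

/-- The property of a lax module endofunctor of the category of left comodules that its
underlying functor is `k`-linear, left exact, and finitary. -/
structure IsLexFinitary (F : LaxModEnd (LComod k B)) : Prop where
  additive : F.functor.Additive
  linear : F.functor.Linear k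
  lex : Limits.PreservesFiniteLimits F.functor
  finitary : Limits.PreservesFilteredColimits F.functor

/-- `IsLexFinitary` as a property of objects. -/
def lexFinitary : ObjectProperty (LaxModEnd (LComod k B)) := fun F => IsLexFinitary k B F

instance : (lexFinitary k B).IsMonoidal where
  prop_unit := ⟨inferInstanceAs (𝟭 (LComod k B)).Additive, inferInstanceAs ((𝟭 (LComod k B)).Linear k),
    inferInstanceAs (Limits.PreservesFiniteLimits (𝟭 (LComod k B))),
    inferInstanceAs (Limits.PreservesFilteredColimits (𝟭 (LComod k B)))⟩
  prop_tensor F G hF hG := by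
    obtain ⟨_, _, _, _⟩ := hF
    obtain ⟨_, _, _, _⟩ := hG
    exact ⟨inferInstanceAs (G.functor ⋙ F.functor).Additive,
      inferInstanceAs ((G.functor ⋙ F.functor).Linear k),
      Limits.comp_preservesFiniteLimits G.functor F.functor,
      Limits.comp_preservesFilteredColimits G.functor F.functor⟩

/-- The category of left exact finitary `k`-linear lax module endofunctors of the category of
left `B`-comodules, monoidal under composition. -/
abbrev LexLax : Type (u + 1) := (lexFinitary k B).FullSubcategory

variable {k B} in
lemma chiAmb_act {X Y M N : Type u} [AddCommGroup X] [Module k X] [AddCommGroup Y] [Module k Y]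
    [AddCommGroup M] [Module k M] [AddCommGroup N] [Module k N]
    {a : B →ₗ[k] Module.End k X} {a' : B →ₗ[k] Module.End k Y} {f : X →ₗ[k] Y}
    (hf : ∀ b x, f (a b x) = a' b (f x)) (lM : M →ₗ[k] B ⊗[k] M) (w : M ⊗[k] (X ⊗[k] N)) :
    chiAmb a' lM (TensorProduct.map LinearMap.id (TensorProduct.map f LinearMap.id) w) =
      TensorProduct.map f LinearMap.id (chiAmb a lM w) := by
  have h : ∀ (s : B ⊗[k] M) (w : X ⊗[k] N),
      shuffleL a' (s ⊗ₜ TensorProduct.map f LinearMap.id w) =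
        TensorProduct.map f LinearMap.id (shuffleL a (s ⊗ₜ w)) := fun s w => by
    induction s with
    | zero => simp
    | add s t hs ht => simp only [TensorProduct.add_tmul, map_add, hs, ht]
    | tmul b m =>
      induction w with
      | zero => simp
      | add s t hs ht => simp only [TensorProduct.tmul_add, map_add, hs, ht]
      | tmul x n => simp [hf]
  induction w with
  | zero => simp
  | add s t hs ht => simp only [map_add, hs, ht]
  | tmul m w => rw [TensorProduct.map_tmul, chiAmb_tmul, chiAmb_tmul, LinearMap.id_apply, h]

variable {k B} in
lemma HopfTrimodule.chi_natX {X Y : HopfTrimodule k B} (f : X ⟶ Y) (M N : LComod k B) :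
    M ◁ Bicomod.cotHom f.toL f.rcomm (𝟙 N) ≫ Y.chi M N =
      X.chi M N ≫ Bicomod.cotHom f.toL f.rcomm (𝟙 (M ⊗ N)) := by
  refine LComod.hom_ext fun (t : M ⊗[k] Cot X.rcoact N.lcoact) =>
    inc_inj Y.rcoact (M ⊗ N).lcoact ?_
  have h := chiAmb_act f.acomm M.lcoact
    (TensorProduct.map LinearMap.id (inc X.rcoact N.lcoact) t)
  refine Eq.trans ?_ h
  refine congrArg (chiAmb Y.actL M.lcoact) ?_
  exact map_sq (a := LinearMap.id) (c := LinearMap.id) (a' := LinearMap.id) (c' := LinearMap.id)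
    (b := cotMap f.lin f.rcomm LinearMap.id (lM := N.lcoact) (by simp))
    (d := inc Y.rcoact N.lcoact) (b' := inc X.rcoact N.lcoact)
    (d' := TensorProduct.map f.lin LinearMap.id) (fun _ => rfl) (fun _ => rfl) t

/-- The functor sending a Hopf trimodule `X` to the lax module functor `(X □ -, χ)`, and a
morphism `f` to `f □ -`. -/
def cotensorFunctor : HopfTrimodule k B ⥤ LaxModEnd (LComod k B) where
  obj X := ⟨X.cotFunctor⟩
  map {X Y} f :=
    { nat := { app := fun M => Bicomod.cotHom f.toL f.rcomm (𝟙 M)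
               naturality := fun M N g => LComod.hom_ext fun z => inc_inj Y.rcoact N.lcoact
                 (map_sq (a := LinearMap.id) (c := f.lin) (a' := f.lin) (c' := LinearMap.id)
                   (b := g.lin) (d := LinearMap.id) (b' := LinearMap.id) (d' := g.lin)
                   (fun _ => rfl) (fun _ => rfl) (inc X.rcoact M.lcoact z)) }
      comm := fun M N => HopfTrimodule.chi_natX f M N }
  map_id X := LaxModEnd.hom_ext fun M => LComod.hom_ext fun _ => inc_inj X.rcoact M.lcoact
    (DFunLike.congr_fun TensorProduct.map_id _)
  map_comp {X _ Z} f g := LaxModEnd.hom_ext fun M => LComod.hom_ext fun _ =>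
    inc_inj Z.rcoact M.lcoact (map_tri (a := f.lin) (c := g.lin)
      (b := LinearMap.id) (d := LinearMap.id) (fun _ => rfl) (fun _ => rfl)
      (inc X.rcoact M.lcoact _)).symm

end LexLax

end HopfTri

end Main

/-! A left exact, finitary, `k`-linear functor `F` on left `B`-comodules is determined by its value
at the regular comodule `B`, for two reasons. First, linearity gives a canonical map `F B ⊗ V → F (B
⊗ V)`, `z ⊗ v ↦ F (- ⊗ v) z`, for each vector space `V`. Coordinate functionals show that it is
injective. A finite basis splits `B ⊗ V` into copies of `B`, which gives surjectivity for
finite-dimensional `V`, and writing `V` as the filtered union of its finite-dimensional subspaces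
gives the rest (`swapLin_inj`, `swapLin_surj`). Secondly, each comodule `M` is the equalizer of the
two maps `B ⊗ M ⇉ B ⊗ (B ⊗ M)` between cofree comodules (`coactIsLimit`). Left exactness carries
this to an equalizer of `F B ⊗ M ⇉ F B ⊗ (B ⊗ M)`, that is, `F M ≅ F B □ M` (`coevEquiv`).

The structure of `F B` comes from the same maps. The right coaction is the image under `F` of the
comultiplication `B → B ⊗ B`. The action is the lax structure `B ⊗ F B → F (B ⊗ B)` followed by the
image of the multiplication. Since the diagonal coaction of `M ⊗ N` multiplies the coactions of `M`
and `N`, naturality of the lax structure along these coactions expresses it everywhere through the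
action on `F B` (`coev_μ`). This one formula gives both the compatibility of the action with the
right coaction and the fact that `F ≅ F B □ -` respects the lax structures.

In the other direction, `X ⊗ -` is exact and commutes with colimits, so `X □ -`, cut out of it by an
equation, is left exact and finitary. The trimodule reconstructed from `X □ -` is `X □ B ≅ X`.

The monoidal structure maps are restrictions of the associators of `⊗`, or coactions. Their
coherence is verified after the injective inclusion of the cotensor products into iterated tensor
products. The compatibility with the interchange maps is coassociativity of `M`: acting diagonally
through `m₍₋₁₎` on `X ⊗ Y` is acting on `X` and then on `Y` (`chiAmb_diagAct`, `assocM_chi`). -/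

noncomputable section Main

namespace HopfTri

open Limits

/-! ### Equalizers, direct sums and cofree objects in the category of comodules. -/

section LComodLimits

variable {k B : Type u} [Field k] [Ring B] [Bialgebra k B]

namespace LComod

/-! ### Finite limits of left comodules -/

/-- The factorization of a morphism of comodules through an injective one. -/
def factor {E M N : LComod k B} (i : E ⟶ M) (hi : Function.Injective i.lin) (g : N ⟶ M)
    (h : ∀ x, g.lin x ∈ LinearMap.range i.lin) : N ⟶ E where
  lin := LinearMap.codRestrictOfInjective g.lin i.lin hi h
  -- Over a field `B ⊗ i` is again injective, so colinearity may be tested after composing with it,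
  -- where it follows from the colinearity of `g` and of `i`.
  lcomm := LinearMap.ext fun x => lTensor_inj hi (by
    have h' : i.lin ∘ₗ LinearMap.codRestrictOfInjective g.lin i.lin hi h = g.lin :=
      LinearMap.ext fun x => LinearMap.codRestrictOfInjective_comp_apply ..
    rw [LinearMap.comp_apply, LinearMap.comp_apply, ← LinearMap.lTensor_comp_apply, h',
      ← lcomm_apply, ← lcomm_apply, LinearMap.codRestrictOfInjective_comp_apply])

lemma factor_spec {E M N : LComod k B} (i : E ⟶ M) (hi : Function.Injective i.lin) (g : N ⟶ M)
    (h : ∀ x, g.lin x ∈ LinearMap.range i.lin) (x : N) : i.lin ((factor i hi g h).lin x) = g.lin x :=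
  LinearMap.codRestrictOfInjective_comp_apply ..

lemma congr_lin {M N : LComod k B} {f g : M ⟶ N} (h : f = g) (m : M) : f.lin m = g.lin m := by
  rw [h]

/-- A fork of comodules whose underlying fork of vector spaces is exact is an equalizer. -/
def isLimitFork {E M N : LComod k B} {f g : M ⟶ N} (i : E ⟶ M) (w : i ≫ f = i ≫ g)
    (hi : Function.Injective i.lin) (hex : ∀ m, f.lin m = g.lin m → ∃ e, i.lin e = m) :
    IsLimit (Fork.ofι i w) :=
  Fork.IsLimit.mk' _ fun s =>
    ⟨factor i hi s.ι fun x => hex _ (congr_lin s.condition x),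
      hom_ext fun x => factor_spec i hi _ _ x,
      fun {_} hm => hom_ext fun x => hi ((congr_lin hm x).trans (factor_spec i hi _ _ x).symm)⟩

/-- The equalizer of two morphisms of comodules. -/
def eqObj {M N : LComod k B} (f g : M ⟶ N) : LComod k B :=
  M.ofInj (incl f.lin g.lin) (incl_inj _ _)
    (liftL f.lin g.lin (M.lcoact ∘ₗ incl f.lin g.lin) fun z => by
      rw [LinearMap.comp_apply, ← lcomm_apply, ← lcomm_apply, incl_mem])
    (fun z => liftL_spec _ _ _ _ z)

/-- The inclusion of the equalizer. -/
def eqι {M N : LComod k B} (f g : M ⟶ N) : eqObj f g ⟶ M where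
  lin := incl f.lin g.lin
  lcomm := LinearMap.ext fun z => (liftL_spec f.lin g.lin
    (M.lcoact ∘ₗ incl f.lin g.lin) (fun z => by
      rw [LinearMap.comp_apply, ← lcomm_apply, ← lcomm_apply, incl_mem]) z).symm

lemma eqι_condition {M N : LComod k B} (f g : M ⟶ N) : eqι f g ≫ f = eqι f g ≫ g :=
  hom_ext fun (z : Eq2 f.lin g.lin) => incl_mem z

/-- The equalizer fork is a limit. -/
def eqIsLimit {M N : LComod k B} (f g : M ⟶ N) :
    IsLimit (Fork.ofι (eqι f g) (eqι_condition f g)) :=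
  isLimitFork (eqι f g) _ (incl_inj f.lin g.lin) fun m hm => ⟨(⟨m, hm⟩ : Eq2 f.lin g.lin), rfl⟩

instance : HasEqualizers (LComod k B) :=
  have : ∀ {M N : LComod k B} {f g : M ⟶ N}, HasLimit (parallelPair f g) :=
    fun {_ _ f g} => ⟨_, eqIsLimit f g⟩
  hasEqualizers_of_hasLimit_parallelPair _

/-- Equalizers of comodules are exact on underlying vector spaces. -/
lemma exists_of_isLimit_fork {E M N : LComod k B} {f g : M ⟶ N} {i : E ⟶ M}
    {w : i ≫ f = i ≫ g} (h : IsLimit (Fork.ofι i w)) :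
    Function.Injective i.lin ∧ ∀ m, f.lin m = g.lin m → ∃ e, i.lin e = m := by
  -- Any two limits are isomorphic, so it is enough to transport both properties from the explicit
  -- equalizer.
  let e := h.conePointUniqueUpToIso (eqIsLimit f g)
  have he : e.hom ≫ eqι f g = i :=
    h.conePointUniqueUpToIso_hom_comp (eqIsLimit f g) WalkingParallelPair.zero
  have he' : e.inv ≫ i = eqι f g :=
    h.conePointUniqueUpToIso_inv_comp (eqIsLimit f g) WalkingParallelPair.zero
  refine ⟨fun x y hxy => ?_, fun m hm => ⟨e.inv.lin (⟨m, hm⟩ : Eq2 f.lin g.lin), ?_⟩⟩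
  · rw [← he] at hxy
    have h1 := congrArg e.inv.lin (incl_inj f.lin g.lin
      (a₁ := e.hom.lin x) (a₂ := e.hom.lin y) hxy)
    have h2 := fun x => congr_lin e.hom_inv_id x
    exact (h2 x).symm.trans (h1.trans (h2 y))
  · exact congr_lin he' (⟨m, hm⟩ : Eq2 f.lin g.lin)

/-- Coassociativity is inherited along any map that intertwines `c` with a genuine coaction. Here
`c` is only a candidate: on a direct sum the two inclusions together suffice to verify the axiom, so
nothing has to be computed there. `counit_of_hom` plays the same role for the counit. -/
lemma coassoc_of_hom (M : LComod k B) {E : Type u} [AddCommGroup E] [Module k E] (i : M →ₗ[k] E)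
    {c : E →ₗ[k] B ⊗[k] E} (h : c ∘ₗ i = i.lTensor B ∘ₗ M.lcoact) :
    ((TensorProduct.assoc k B B E).toLinearMap ∘ₗ
      (Coalgebra.comul (R := k) (A := B)).rTensor E ∘ₗ c) ∘ₗ i = (c.lTensor B ∘ₗ c) ∘ₗ i := by
  refine LinearMap.ext fun m => ?_
  have h0 : c (i m) = i.lTensor B (M.lcoact m) := DFunLike.congr_fun h m
  have h2 : ∀ t : (B ⊗[k] B) ⊗[k] M,
      (i.lTensor B).lTensor B (TensorProduct.assoc k B B M t) =
      TensorProduct.assoc k B B E (i.lTensor (B ⊗[k] B) t) := fun t => by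
    refine DFunLike.congr_fun (f := (i.lTensor B).lTensor B ∘ₗ
      (TensorProduct.assoc k B B M).toLinearMap) (g :=
      (TensorProduct.assoc k B B E).toLinearMap ∘ₗ (i.lTensor (B ⊗[k] B))) ?_ t
    exact TensorProduct.ext_threefold fun _ _ _ => rfl
  simp only [LinearMap.comp_apply, LinearEquiv.coe_coe]
  rw [h0, ← LinearMap.lTensor_comp_apply, h, LinearMap.lTensor_comp_apply, ← coassoc_apply, h2,
    ← LinearMap.comp_apply, LinearMap.rTensor_comp_lTensor, ← LinearMap.lTensor_comp_rTensor]
  rfl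

lemma counit_of_hom (M : LComod k B) {E : Type u} [AddCommGroup E] [Module k E] (i : M →ₗ[k] E)
    {c : E →ₗ[k] B ⊗[k] E} (h : c ∘ₗ i = i.lTensor B ∘ₗ M.lcoact) :
    ((TensorProduct.lid k E).toLinearMap ∘ₗ
      (Coalgebra.counit (R := k) (A := B)).rTensor E ∘ₗ c) ∘ₗ i = i := by
  refine LinearMap.ext fun m => ?_
  have h0 : c (i m) = i.lTensor B (M.lcoact m) := DFunLike.congr_fun h m
  have h1 := congrArg i (M.counit_apply m)
  rw [lid_nat] at h1
  refine Eq.trans ?_ h1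
  simp only [LinearMap.comp_apply, LinearEquiv.coe_coe]
  rw [h0, ← LinearMap.comp_apply ((Coalgebra.counit (R := k) (A := B)).rTensor E),
    LinearMap.rTensor_comp_lTensor, ← LinearMap.lTensor_comp_rTensor, LinearMap.comp_apply]

/-- The coaction on a direct sum. -/
def prodCoact (M N : LComod k B) : M × N →ₗ[k] B ⊗[k] (M × N) :=
  ((LinearMap.inl k M N).lTensor B ∘ₗ M.lcoact).coprod
    ((LinearMap.inr k M N).lTensor B ∘ₗ N.lcoact)

/-- The direct sum of two comodules. -/
def prod (M N : LComod k B) : LComod k B where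
  carrier := M × N
  lcoact := prodCoact M N
  lcoassoc := LinearMap.prod_ext
    (M.coassoc_of_hom (LinearMap.inl k M N) (LinearMap.coprod_inl _ _))
    (N.coassoc_of_hom (LinearMap.inr k M N) (LinearMap.coprod_inr _ _))
  lcounit := LinearMap.prod_ext
    (M.counit_of_hom (LinearMap.inl k M N) (LinearMap.coprod_inl _ _))
    (N.counit_of_hom (LinearMap.inr k M N) (LinearMap.coprod_inr _ _))

lemma fst_prodCoact (M N : LComod k B) : M.lcoact ∘ₗ LinearMap.fst k M N =
    (LinearMap.fst k M N).lTensor B ∘ₗ prodCoact M N :=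
  LinearMap.prod_ext
    (by rw [LinearMap.comp_assoc, LinearMap.comp_assoc, prodCoact, LinearMap.coprod_inl,
      LinearMap.fst_comp_inl, ← LinearMap.comp_assoc, ← LinearMap.lTensor_comp]; simp)
    (by rw [LinearMap.comp_assoc, LinearMap.comp_assoc, prodCoact, LinearMap.coprod_inr,
      LinearMap.fst_comp_inr, ← LinearMap.comp_assoc, ← LinearMap.lTensor_comp]; simp)

lemma snd_prodCoact (M N : LComod k B) : N.lcoact ∘ₗ LinearMap.snd k M N =
    (LinearMap.snd k M N).lTensor B ∘ₗ prodCoact M N :=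
  LinearMap.prod_ext
    (by rw [LinearMap.comp_assoc, LinearMap.comp_assoc, prodCoact, LinearMap.coprod_inl,
      LinearMap.snd_comp_inl, ← LinearMap.comp_assoc, ← LinearMap.lTensor_comp]; simp)
    (by rw [LinearMap.comp_assoc, LinearMap.comp_assoc, prodCoact, LinearMap.coprod_inr,
      LinearMap.snd_comp_inr, ← LinearMap.comp_assoc, ← LinearMap.lTensor_comp]; simp)

/-- The direct sum as a bicone. -/
def prodBicone (M N : LComod k B) : BinaryBicone M N where
  pt := prod M N
  fst := ⟨LinearMap.fst k M N, fst_prodCoact M N⟩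
  snd := ⟨LinearMap.snd k M N, snd_prodCoact M N⟩
  inl := ⟨LinearMap.inl k M N, LinearMap.coprod_inl _ _⟩
  inr := ⟨LinearMap.inr k M N, LinearMap.coprod_inr _ _⟩
  inl_fst := hom_ext fun _ => rfl
  inl_snd := hom_ext fun _ => rfl
  inr_fst := hom_ext fun _ => rfl
  inr_snd := hom_ext fun _ => rfl

instance : HasBinaryBiproducts (LComod k B) where
  has_binary_biproduct M N := hasBinaryBiproduct_of_total (prodBicone M N)
    -- In a preadditive category a bicone is a biproduct as soon as `fst ≫ inl + snd ≫ inr` is the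
    -- identity.
    (hom_ext fun (z : M × N) => Prod.ext (add_zero z.1) (zero_add z.2))

/-- The zero comodule. -/
def zeroObj (k B : Type u) [Field k] [Ring B] [Bialgebra k B] : LComod k B where
  carrier := PUnit
  lcoact := 0
  lcoassoc := by simp
  lcounit := LinearMap.ext fun _ => rfl

instance : HasZeroObject (LComod k B) := ⟨zeroObj k B, ⟨fun _ => ⟨⟨⟨0⟩, fun f =>
    hom_ext fun x => (congrArg f.lin (Subsingleton.elim (α := PUnit) x 0)).trans (map_zero f.lin)⟩⟩,
  fun _ => ⟨⟨⟨0⟩, fun _ => hom_ext fun _ => Subsingleton.elim (α := PUnit) _ _⟩⟩⟩⟩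

/-- With equalizers and a zero object, this permits reducing the preservation of finite limits by an
additive functor to the preservation of kernels. -/
instance : HasFiniteProducts (LComod k B) :=
  hasFiniteProducts_of_has_binary_and_terminal

/-! ### Filtered colimits of left comodules -/

/-- This is the identity `(B ⊗ ε) Δ = id`, tensored with `V`. It is what allows a comodule map into
`B ⊗ V` to be recovered from its composite with `ε ⊗ V`. -/
lemma coL_comul_counit {V : Type u} [AddCommGroup V] [Module k V] (w : B ⊗[k] V) :
    ((TensorProduct.lid k V).toLinearMap ∘ₗ
      (Coalgebra.counit (R := k) (A := B)).rTensor V).lTensor B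
        (coL (Coalgebra.comul (R := k) (A := B)) w) = w := by
  refine DFunLike.congr_fun (f := ((TensorProduct.lid k V).toLinearMap ∘ₗ
      (Coalgebra.counit (R := k) (A := B)).rTensor V).lTensor B ∘ₗ
        coL (Coalgebra.comul (R := k) (A := B))) (g := LinearMap.id) ?_ w
  refine TensorProduct.ext' fun b v => ?_
  have h : ∀ u : B ⊗[k] B, ((TensorProduct.lid k V).toLinearMap ∘ₗ
      (Coalgebra.counit (R := k) (A := B)).rTensor V).lTensor B
        (TensorProduct.assoc k B B V (u ⊗ₜ v)) =
      TensorProduct.rid k B ((Coalgebra.counit (R := k) (A := B)).lTensor B u) ⊗ₜ v := fun u => by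
    induction u with
    | zero => simp
    | add s t hs ht => simp only [TensorProduct.add_tmul, map_add, hs, ht]
    | tmul b c => simp [TensorProduct.smul_tmul]
  simp only [LinearMap.comp_apply, coL_tmul, h, Coalgebra.lTensor_counit_comul,
    LinearMap.id_apply, TensorProduct.rid_tmul, one_smul]

/-- The forgetful functor to vector spaces. -/
def forget (k B : Type u) [Field k] [Ring B] [Bialgebra k B] : LComod k B ⥤ ModuleCat.{u} k where
  obj M := ModuleCat.of k M
  map f := ModuleCat.ofHom f.lin

/-- The map `X ⊗ V ⟶ X ⊗ W` induced by a linear map. -/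
def ambMap (X : LComod k B) {V W : Type u} [AddCommGroup V] [Module k V] [AddCommGroup W]
    [Module k W] (f : V →ₗ[k] W) : X.amb V ⟶ X.amb W where
  lin := f.lTensor X
  lcomm := LinearMap.ext fun z => coL_nat (l := X.lcoact) (f := LinearMap.id) (by simp) f z

lemma ambMap_id (X : LComod k B) (V : Type u) [AddCommGroup V] [Module k V] :
    X.ambMap (LinearMap.id (R := k) (M := V)) = 𝟙 (X.amb V) :=
  hom_ext fun z => LinearMap.lTensor_id_apply X V z

lemma ambMap_comp (X : LComod k B) {V W U : Type u} [AddCommGroup V] [Module k V]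
    [AddCommGroup W] [Module k W] [AddCommGroup U] [Module k U] (g : W →ₗ[k] U) (f : V →ₗ[k] W) :
    X.ambMap (g ∘ₗ f) = X.ambMap f ≫ X.ambMap g :=
  hom_ext fun z => LinearMap.lTensor_comp_apply X g f z

/-- The regular left comodule `B`. -/
abbrev reg (k B : Type u) [Field k] [Ring B] [Bialgebra k B] : LComod k B :=
  (Bicomod.reg k B).toLComod

/-- The cofree comodule functor. -/
def cofree (k B : Type u) [Field k] [Ring B] [Bialgebra k B] : ModuleCat.{u} k ⥤ LComod k B where
  obj V := (reg k B).amb V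
  map f := (reg k B).ambMap f.hom
  map_id V := ambMap_id _ V
  map_comp f g := ambMap_comp _ g.hom f.hom

/-- The coaction as a morphism to a cofree comodule. -/
def coactHom (M : LComod k B) : M ⟶ (reg k B).amb M where
  lin := M.lcoact
  lcomm := M.lcoassoc

lemma lid_counit_nat {V W : Type u} [AddCommGroup V] [Module k V] [AddCommGroup W]
    [Module k W] (f : V →ₗ[k] W) (w : B ⊗[k] V) :
    TensorProduct.lid k W ((Coalgebra.counit (R := k) (A := B)).rTensor W (f.lTensor B w)) =
      f (TensorProduct.lid k V ((Coalgebra.counit (R := k) (A := B)).rTensor V w)) := by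
  induction w with
  | zero => simp
  | add s t hs ht => simp only [map_add, hs, ht]
  | tmul b v => simp

/-- The forgetful functor is left adjoint to the cofree comodule functor. -/
def forgetAdj (k B : Type u) [Field k] [Ring B] [Bialgebra k B] : forget k B ⊣ cofree k B :=
  Adjunction.mkOfHomEquiv
    { homEquiv := fun M V =>
        { toFun := fun f => M.coactHom ≫ (reg k B).ambMap f.hom
          invFun := fun g => ModuleCat.ofHom ((TensorProduct.lid k V).toLinearMap ∘ₗ
            (Coalgebra.counit (R := k) (A := B)).rTensor V ∘ₗ g.lin)
          left_inv := fun f => ModuleCat.hom_ext (LinearMap.ext fun m =>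
            (lid_counit_nat f.hom (M.lcoact m)).trans (congrArg f.hom (M.counit_apply m)))
          -- Colinearity of `g` replaces the coaction of the source by that of `B ⊗ V`, where the
          -- counit cancels the comultiplication.
          right_inv := fun g => hom_ext fun m => by
            refine Eq.trans ?_ (coL_comul_counit (B := B) (g.lin m))
            refine Eq.trans ?_ (congrArg _ (lcomm_apply g m).symm)
            exact LinearMap.lTensor_comp_apply B ((TensorProduct.lid k V).toLinearMap ∘ₗ
              (Coalgebra.counit (R := k) (A := B)).rTensor V) g.lin (M.lcoact m) }
      homEquiv_naturality_left_symm := fun f g => rfl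
      homEquiv_naturality_right := fun {M V W} f g =>
        congrArg (M.coactHom ≫ ·) (ambMap_comp (reg k B) g.hom f.hom) }

/-- Being a left adjoint, `forget` preserves colimits, so the elements of a colimit of comodules can
be studied in vector spaces. -/
instance : PreservesColimitsOfSize.{u, u} (forget k B) :=
  (forgetAdj k B).leftAdjoint_preservesColimits

end LComod

end LComodLimits

/-! ### Filtered colimits of comodules in terms of elements. -/

section LComodColimits

variable {k B : Type u} [Field k] [Ring B] [Bialgebra k B]

namespace LComod

variable {J : Type u} [SmallCategory J] [IsFiltered J] {K : J ⥤ LComod k B} {c : Cocone K}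

/-- Every element of a filtered colimit comes from some stage. -/
lemma exists_rep_of_isColimit (G : LComod k B ⥤ ModuleCat.{u} k) [PreservesFilteredColimits G]
    (hc : IsColimit c) (x : G.obj c.pt) :
    ∃ (j : J) (y : G.obj (K.obj j)), (G.map (c.ι.app j)).hom y = x :=
  Concrete.isColimit_exists_rep (K ⋙ G) (isColimitOfPreserves G hc) x

/-- An element vanishing in a filtered colimit vanishes at some stage. -/
lemma exists_eq_zero_of_isColimit (G : LComod k B ⥤ ModuleCat.{u} k) [PreservesFilteredColimits G]
    (hc : IsColimit c) {j : J} (y : G.obj (K.obj j)) (hy : (G.map (c.ι.app j)).hom y = 0) :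
    ∃ (j' : J) (f : j ⟶ j'), (G.map (K.map f)).hom y = 0 := by
  obtain ⟨j', f, g, h⟩ := Concrete.isColimit_exists_of_rep_eq (K ⋙ G) (isColimitOfPreserves G hc)
    y 0 (hy.trans (map_zero (G.map (c.ι.app j)).hom).symm)
  exact ⟨j', f, h.trans (map_zero (G.map (K.map g)).hom)⟩

/-- A criterion for a cocone over a filtered diagram of comodules to be a colimit. -/
def isColimitOfElementwise (hs : ∀ x : c.pt, ∃ (j : J) (y : K.obj j), (c.ι.app j).lin y = x)
    (hz : ∀ (j : J) (y : K.obj j), (c.ι.app j).lin y = 0 →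
      ∃ (j' : J) (f : j ⟶ j'), (K.map f).lin y = 0) : IsColimit c := by
  -- The two hypotheses describe a filtered colimit of sets, once equality of two elements is read
  -- as vanishing of their difference. The forgetful functor from vector spaces to sets reflects
  -- such colimits.
  have h1 : IsColimit ((CategoryTheory.forget (ModuleCat k)).mapCocone ((forget k B).mapCocone c)) :=
    Types.FilteredColimit.isColimitOf' _ _ (fun x => by
      obtain ⟨j, y, h⟩ := hs x
      exact ⟨j, y, h.symm⟩) (fun j (x y : K.obj j) h => by
      obtain ⟨j', f, h'⟩ := hz j (x - y) (by rw [map_sub]; exact sub_eq_zero.2 h)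
      exact ⟨j', f, sub_eq_zero.1 ((map_sub (K.map f).lin x y).symm.trans h')⟩)
  have h2 : IsColimit ((forget k B).mapCocone c) := isColimitOfReflects _ h1
  have fac : ∀ (s : Cocone K) (j : J) (y : K.obj j),
      (h2.desc ((forget k B).mapCocone s)).hom ((c.ι.app j).lin y) = (s.ι.app j).lin y :=
    fun s j y => ConcreteCategory.congr_hom (h2.fac ((forget k B).mapCocone s) j) y
  exact
    { desc := fun s =>
        { lin := (h2.desc ((forget k B).mapCocone s)).hom
          -- Every element comes from some stage, and there the induced map is the leg of `s`, which
          -- is colinear.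
          lcomm := LinearMap.ext fun x => by
            obtain ⟨j, y, rfl⟩ := hs x
            have e : (h2.desc ((forget k B).mapCocone s)).hom ∘ₗ (c.ι.app j).lin =
              (s.ι.app j).lin := LinearMap.ext (fac s j)
            refine (congrArg s.pt.lcoact (fac s j y)).trans ?_
            refine (lcomm_apply (s.ι.app j) y).trans ?_
            refine Eq.trans ?_ (congrArg ((h2.desc ((forget k B).mapCocone s)).hom.lTensor B)
              (lcomm_apply (c.ι.app j) y).symm)
            rw [← e]
            exact LinearMap.lTensor_comp_apply B _ _ _ }
      fac := fun s j => hom_ext (fac s j)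
      uniq := fun s m hm => hom_ext fun x => by
        obtain ⟨j, y, rfl⟩ := hs x
        exact (congr_lin (hm j) y).trans (fac s j y).symm }

/-- The functor `M ↦ X ⊗ M` to vector spaces. -/
def tensorForget (B : Type u) [Ring B] [Bialgebra k B] (X : Type u) [AddCommGroup X] [Module k X] :
    LComod k B ⥤ ModuleCat.{u} k :=
  forget k B ⋙ tensorLeft (ModuleCat.of k X)

/-- Both factors are left adjoints and so preserve colimits. -/
instance (X : Type u) [AddCommGroup X] [Module k X] :
    PreservesFilteredColimits (tensorForget (k := k) B X) :=
  inferInstanceAs (PreservesFilteredColimits (forget k B ⋙ tensorLeft (ModuleCat.of k X)))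

lemma exists_lTensor_rep_of_isColimit (X : Type u) [AddCommGroup X] [Module k X]
    (hc : IsColimit c) (x : X ⊗[k] c.pt) :
    ∃ (j : J) (y : X ⊗[k] K.obj j), (c.ι.app j).lin.lTensor X y = x :=
  exists_rep_of_isColimit (tensorForget B X) hc x

lemma exists_lTensor_eq_zero_of_isColimit (X : Type u) [AddCommGroup X] [Module k X]
    (hc : IsColimit c) {j : J} (y : X ⊗[k] K.obj j) (hy : (c.ι.app j).lin.lTensor X y = 0) :
    ∃ (j' : J) (f : j ⟶ j'), (K.map f).lin.lTensor X y = 0 :=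
  exists_eq_zero_of_isColimit (tensorForget B X) hc y hy

/-- Reassociation reduces this to the single tensor factor `X ⊗ Y`. The case `Y = B` is the one
needed, since the equation cutting out `X □ M` lives in `X ⊗ (B ⊗ M)`. -/
lemma exists_lTensor_lTensor_eq_zero_of_isColimit (X Y : Type u) [AddCommGroup X] [Module k X]
    [AddCommGroup Y] [Module k Y] (hc : IsColimit c) {j : J} (y : X ⊗[k] (Y ⊗[k] K.obj j))
    (hy : ((c.ι.app j).lin.lTensor Y).lTensor X y = 0) :
    ∃ (j' : J) (f : j ⟶ j'), ((K.map f).lin.lTensor Y).lTensor X y = 0 := by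
  obtain ⟨y, rfl⟩ := (TensorProduct.assoc k X Y (K.obj j)).surjective y
  have e : ∀ {M N : LComod k B} (f : M ⟶ N) (y : (X ⊗[k] Y) ⊗[k] M),
      (f.lin.lTensor Y).lTensor X (TensorProduct.assoc k X Y M y) =
        TensorProduct.assoc k X Y N (f.lin.lTensor (X ⊗[k] Y) y) := fun f y => by
    simp [LinearMap.lTensor_tensor]
  obtain ⟨j', f, h⟩ := exists_lTensor_eq_zero_of_isColimit (X ⊗[k] Y) hc y
    ((TensorProduct.assoc k X Y c.pt).injective (by rw [map_zero, ← hy]; exact (e _ y).symm))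
  exact ⟨j', f, by rw [e, h, map_zero]⟩

end LComod

/-! ### Cotensor functors are linear, left exact and finitary. -/

namespace HopfTrimodule

instance (X : HopfTrimodule k B) : X.cotFunctor.Additive where
  map_add {M N f g} := LComod.hom_ext fun (z : Cot X.rcoact M.lcoact) =>
    inc_inj X.rcoact N.lcoact (DFunLike.congr_fun (LinearMap.lTensor_add X f.lin g.lin)
      (inc X.rcoact M.lcoact z))

instance (X : HopfTrimodule k B) : X.cotFunctor.Linear k where
  map_smul {M N} f c := LComod.hom_ext fun (z : Cot X.rcoact M.lcoact) =>
    inc_inj X.rcoact N.lcoact (DFunLike.congr_fun (LinearMap.lTensor_smul X c f.lin)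
      (inc X.rcoact M.lcoact z))

lemma cf_map (X : HopfTrimodule k B) {M N : LComod k B} (f : M ⟶ N) (w : X ⊗[k] M) :
    cf X.rcoact (f.lin.lTensor X w) = (f.lin.lTensor B).lTensor X (cf X.rcoact w) :=
  cf_nat (r := X.rcoact) (r' := X.rcoact) (f := LinearMap.id) (by simp) f.lin w

lemma cg_map (X : HopfTrimodule k B) {M N : LComod k B} (f : M ⟶ N) (w : X ⊗[k] M) :
    cg N.lcoact (f.lin.lTensor X w) = (f.lin.lTensor B).lTensor X (cg M.lcoact w) :=
  cg_nat (X := X) LinearMap.id f.lcomm w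

lemma cot_map_inj (X : HopfTrimodule k B) {M N : LComod k B} (f : M ⟶ N)
    (hf : Function.Injective f.lin) : Function.Injective (X.cotFunctor.map f).lin :=
  fun _ _ (h : (_ : Cot X.rcoact N.lcoact) = _) =>
    inc_inj X.rcoact M.lcoact (lTensor_inj hf (congrArg (inc X.rcoact N.lcoact) h))

/-- The map `X ⊗ (B ⊗ f)` is injective and both maps in the cotensor condition are natural, so the
condition can be tested in the larger comodule `N`. -/
lemma cot_mem_of_lTensor (X : HopfTrimodule k B) {M N : LComod k B} (f : M ⟶ N)
    (hf : Function.Injective f.lin) (w : X ⊗[k] M) (z : Cot X.rcoact N.lcoact)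
    (h : f.lin.lTensor X w = inc X.rcoact N.lcoact z) : cf X.rcoact w = cg M.lcoact w := by
  refine lTensor_inj (X := X) (lTensor_inj (X := B) hf) ?_
  rw [← X.cf_map, ← X.cg_map, h, incl_mem]

/-- By exactness of `X ⊗ -`, an element of `X □ M` equalized by `f` and `g` lies in the tensor
product of `X` with their equalizer. By `cot_mem_of_lTensor` it satisfies the cotensor condition
already there. -/
lemma preservesEqualizers (X : HopfTrimodule k B) :
    PreservesLimitsOfShape WalkingParallelPair X.cotFunctor := by
  have h : ∀ {M N : LComod k B} (f g : M ⟶ N), PreservesLimit (parallelPair f g) X.cotFunctor :=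
    fun {M N} f g => preservesLimit_of_preserves_limit_cone (LComod.eqIsLimit f g)
      ((isLimitMapConeForkEquiv X.cotFunctor (LComod.eqι_condition f g)).symm
        (LComod.isLimitFork _ _ (X.cot_map_inj _ (incl_inj f.lin g.lin))
          fun (z : Cot X.rcoact M.lcoact) hz => by
            obtain ⟨w, hw⟩ := exists_lTensor f.lin g.lin (inc X.rcoact M.lcoact z)
              (congrArg (inc X.rcoact N.lcoact) hz)
            exact ⟨(⟨w, X.cot_mem_of_lTensor (LComod.eqι f g) (incl_inj f.lin g.lin) w z hw⟩ :
              Cot X.rcoact (LComod.eqObj f g).lcoact), inc_inj X.rcoact M.lcoact hw⟩))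
  exact ⟨fun {K} => preservesLimit_of_iso_diagram X.cotFunctor (diagramIsoParallelPair K).symm⟩

/-- An additive functor preserves finite direct sums, so only kernels remain, and these are
equalizers. -/
lemma preservesFiniteLimits (X : HopfTrimodule k B) : PreservesFiniteLimits X.cotFunctor := by
  have := X.preservesEqualizers
  exact Functor.preservesFiniteLimits_of_preservesKernels X.cotFunctor

/-- Elements of `X ⊗ colim` come from a stage and vanish at a stage; the cotensor condition is a
single equation, so it too is satisfied at some stage if it is satisfied in the colimit. -/
lemma preservesFilteredColimits (X : HopfTrimodule k B) :
    PreservesFilteredColimits X.cotFunctor where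
  preserves_filtered_colimits J _ _ := ⟨fun {K} => ⟨fun {c} hc => ⟨by
    refine LComod.isColimitOfElementwise (fun (z : Cot X.rcoact c.pt.lcoact) => ?_)
      (fun j (z : Cot X.rcoact (K.obj j).lcoact) hz => ?_)
    · obtain ⟨j, w, hw⟩ := LComod.exists_lTensor_rep_of_isColimit X hc (inc X.rcoact c.pt.lcoact z)
      -- The representative `w` need not lie in the cotensor product. The difference of its two
      -- images becomes zero in the colimit, hence at some `j'`, and the image of `w` at `j'` does
      -- lie in it.
      obtain ⟨j', f, h⟩ := LComod.exists_lTensor_lTensor_eq_zero_of_isColimit X B hc (j := j)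
        (cf X.rcoact w - cg (K.obj j).lcoact w) (by
          rw [map_sub, ← X.cf_map, ← X.cg_map]
          exact sub_eq_zero.2 ((congrArg _ hw).trans ((incl_mem z).trans (congrArg _ hw).symm)))
      refine ⟨j', (⟨(K.map f).lin.lTensor X w, ?_⟩ : Cot X.rcoact (K.obj j').lcoact), ?_⟩
      · refine (X.cf_map _ _).trans (Eq.trans ?_ (X.cg_map _ _).symm)
        rw [map_sub] at h
        exact sub_eq_zero.1 h
      · refine inc_inj X.rcoact c.pt.lcoact (Eq.trans ?_ hw)
        refine (LinearMap.lTensor_comp_apply X _ _ w).symm.trans ?_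
        exact DFunLike.congr_fun (congrArg (fun g => LinearMap.lTensor X (LComod.Hom.lin g))
          (c.w f)) w
    · obtain ⟨j', f, h⟩ := LComod.exists_lTensor_eq_zero_of_isColimit X hc
        (inc X.rcoact (K.obj j).lcoact z) (congrArg (inc X.rcoact c.pt.lcoact) hz)
      exact ⟨j', f, inc_inj X.rcoact (K.obj j').lcoact h⟩⟩⟩⟩

end HopfTrimodule

/-- The cotensor functor takes values in left exact finitary linear functors. -/
theorem lexFinitary_cotensorFunctor (X : HopfTrimodule k B) :
    lexFinitary k B ((cotensorFunctor k B).obj X) :=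
  ⟨inferInstanceAs X.cotFunctor.Additive, inferInstanceAs (X.cotFunctor.Linear k),
    X.preservesFiniteLimits, X.preservesFilteredColimits⟩

end LComodColimits

/-! ### Linear finitary functors commute with tensoring by a vector space. -/

section Copower

variable {k B : Type u} [Field k] [Ring B] [Bialgebra k B]

namespace LComod

variable {V W : Type u} [AddCommGroup V] [Module k V] [AddCommGroup W] [Module k W]

lemma assoc_tmul_right {Y X : Type u} [AddCommGroup X] [Module k X] [AddCommGroup Y] [Module k Y]
    (v : V) (t : Y ⊗[k] X) :
    TensorProduct.assoc k Y X V (t ⊗ₜ v) = ((TensorProduct.mk k X V).flip v).lTensor Y t := by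
  induction t with
  | zero => simp
  | add s t hs ht => simp only [TensorProduct.add_tmul, map_add, hs, ht]
  | tmul b y => rfl

lemma rid_lTensor_coL {X : Type u} [AddCommGroup X] [Module k X] (l : X →ₗ[k] B ⊗[k] X)
    (f : V →ₗ[k] k) :
    l ∘ₗ (TensorProduct.rid k X).toLinearMap ∘ₗ f.lTensor X =
      ((TensorProduct.rid k X).toLinearMap ∘ₗ f.lTensor X).lTensor B ∘ₗ coL l := by
  refine TensorProduct.ext' fun x v => ?_
  simp only [LinearMap.comp_apply, coL_tmul, LinearMap.lTensor_tmul, LinearEquiv.coe_coe,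
    TensorProduct.rid_tmul, map_smul]
  induction l x with
  | zero => simp
  | add s t hs ht => simp only [TensorProduct.add_tmul, map_add, smul_add, hs, ht]
  | tmul b y => simp

/-- On `x ⊗ v` this is the expansion of `v` in the basis. -/
lemma sum_mk_rid_lTensor_coord {X : Type u} [AddCommGroup X] [Module k X] {ι : Type*} [Fintype ι]
    (b : Module.Basis ι k V) : ∑ i, (TensorProduct.mk k X V).flip (b i) ∘ₗ
      (TensorProduct.rid k X).toLinearMap ∘ₗ (b.coord i).lTensor X = LinearMap.id := by
  refine TensorProduct.ext' fun x v => ?_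
  rw [LinearMap.sum_apply]
  simp only [LinearMap.comp_apply, LinearMap.lTensor_tmul, LinearEquiv.coe_coe,
    TensorProduct.rid_tmul, LinearMap.flip_apply, TensorProduct.mk_apply,
    TensorProduct.smul_tmul, ← TensorProduct.tmul_sum, LinearMap.id_apply]
  exact congrArg _ (b.sum_repr v)

/-- The morphism `X ⟶ X ⊗ V`, `x ↦ x ⊗ v`. -/
def ambIn (X : LComod k B) (v : V) : X ⟶ X.amb V where
  lin := (TensorProduct.mk k X V).flip v
  lcomm := LinearMap.ext fun x => (coL_tmul X.lcoact x v).trans (assoc_tmul_right v (X.lcoact x))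

lemma ambIn_lin (X : LComod k B) (v : V) (x : X) : (X.ambIn v).lin x = x ⊗ₜ[k] v := rfl

lemma ambIn_add (X : LComod k B) (v w : V) : X.ambIn (v + w) = X.ambIn v + X.ambIn w :=
  hom_ext fun x => TensorProduct.tmul_add x v w

lemma ambIn_smul (X : LComod k B) (r : k) (v : V) : X.ambIn (r • v) = r • X.ambIn v :=
  hom_ext fun x => TensorProduct.tmul_smul r x v

lemma ambIn_ambMap (X : LComod k B) (f : V →ₗ[k] W) (v : V) :
    X.ambIn v ≫ X.ambMap f = X.ambIn (f v) := hom_ext fun _ => rfl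

/-- The morphism `X ⊗ V ⟶ X`, `x ⊗ v ↦ f v • x`. -/
def ambOut (X : LComod k B) (f : V →ₗ[k] k) : X.amb V ⟶ X where
  lin := (TensorProduct.rid k X).toLinearMap ∘ₗ f.lTensor X
  lcomm := rid_lTensor_coL X.lcoact f

lemma ambOut_lin (X : LComod k B) (f : V →ₗ[k] k) (z : X ⊗[k] V) :
    (X.ambOut f).lin z = TensorProduct.rid k X (f.lTensor X z) := rfl

lemma ambIn_ambOut (X : LComod k B) (f : V →ₗ[k] k) (v : V) :
    X.ambIn v ≫ X.ambOut f = f v • 𝟙 X := hom_ext fun x => by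
  simp [ambIn_lin, ambOut_lin]

lemma sum_lin {M N : LComod k B} {ι : Type*} (s : Finset ι) (f : ι → (M ⟶ N)) :
    (∑ i ∈ s, f i).lin = ∑ i ∈ s, (f i).lin :=
  map_sum (AddMonoidHom.mk' (fun g : M ⟶ N => g.lin) add_lin) f s

/-- This exhibits `X ⊗ V` as a direct sum of copies of `X`, one for each basis vector, by an
identity between morphisms of comodules that every additive functor preserves. -/
lemma sum_ambOut_ambIn (X : LComod k B) {ι : Type*} [Fintype ι] (b : Module.Basis ι k V) :
    ∑ i, X.ambOut (b.coord i) ≫ X.ambIn (b i) = 𝟙 (X.amb V) := hom_ext fun z => by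
  rw [sum_lin]
  exact DFunLike.congr_fun (sum_mk_rid_lTensor_coord (X := X) b) z

end LComod

section Swap

variable (F : LComod k B ⥤ LComod k B) [F.Additive] [F.Linear k] (X : LComod k B)
  (V : Type u) [AddCommGroup V] [Module k V]

/-- The canonical map `F X ⊗ V → F (X ⊗ V)`, `z ⊗ v ↦ F (- ⊗ v) z`. -/
def swapLin : F.obj X ⊗[k] V →ₗ[k] F.obj (X.amb V) :=
  TensorProduct.lift (LinearMap.flip
    { toFun := fun v => (F.map (X.ambIn v)).lin
      -- Linearity in `v` is where additivity and `k`-linearity of `F` enter.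
      map_add' := fun v w => by rw [LComod.ambIn_add, F.map_add]; rfl
      map_smul' := fun r v => by rw [LComod.ambIn_smul, F.map_smul]; rfl })

variable {V}

lemma swapLin_tmul (z : F.obj X) (v : V) :
    swapLin F X V (z ⊗ₜ v) = (F.map (X.ambIn v)).lin z := by simp [swapLin]

lemma swapLin_nat {W : Type u} [AddCommGroup W] [Module k W] (f : V →ₗ[k] W)
    (w : F.obj X ⊗[k] V) : (F.map (X.ambMap f)).lin (swapLin F X V w) =
      swapLin F X W (f.lTensor (F.obj X) w) := by
  induction w with
  | zero => simp
  | add s t hs ht => simp only [map_add, hs, ht]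
  | tmul z v =>
    rw [swapLin_tmul, LinearMap.lTensor_tmul, swapLin_tmul, ← LComod.ambIn_ambMap, F.map_comp]
    rfl

/-- Each `F (- ⊗ v)` is a morphism of comodules, so the coaction on `F X ⊗ V` that matches the one
on `F (X ⊗ V)` is that of the left factor. -/
lemma swapLin_lcomm (w : F.obj X ⊗[k] V) :
    (F.obj (X.amb V)).lcoact (swapLin F X V w) =
      (swapLin F X V).lTensor B (coL (F.obj X).lcoact w) := by
  induction w with
  | zero => simp
  | add s t hs ht => simp only [map_add, hs, ht]
  | tmul z v =>
    rw [swapLin_tmul, LComod.lcomm_apply, coL_tmul]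
    induction (F.obj X).lcoact z with
    | zero => simp
    | add s t hs ht => simp only [TensorProduct.add_tmul, map_add, hs, ht]
    | tmul b y =>
      rw [TensorProduct.assoc_tmul, LinearMap.lTensor_tmul, LinearMap.lTensor_tmul, swapLin_tmul]

/-- The composite `X → X ⊗ V → X` through `v` and `f` is the scalar `f v`, and `F` is linear. Hence
functionals on `V` can be evaluated after `swapLin`. -/
lemma ambOut_swapLin (f : V →ₗ[k] k) (w : F.obj X ⊗[k] V) :
    (F.map (X.ambOut f)).lin (swapLin F X V w) =
      TensorProduct.rid k (F.obj X) (f.lTensor (F.obj X) w) := by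
  induction w with
  | zero => simp
  | add s t hs ht => simp only [map_add, hs, ht]
  | tmul z v =>
    have h : F.map (X.ambIn v) ≫ F.map (X.ambOut f) = f v • 𝟙 (F.obj X) := by
      rw [← F.map_comp, LComod.ambIn_ambOut, F.map_smul, F.map_id]
    rw [swapLin_tmul, LinearMap.lTensor_tmul, TensorProduct.rid_tmul]
    exact LComod.congr_lin h z

/-- By `ambOut_swapLin` the coordinates of `w` with respect to a basis of `V` are determined by its
image. Neither finite dimension nor preservation of colimits is involved. -/
lemma swapLin_inj : Function.Injective (swapLin F X V) := by
  refine (injective_iff_map_eq_zero _).2 fun w hw => ?_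
  let b := Module.Basis.ofVectorSpace k V
  classical
  refine (TensorProduct.equivFinsuppOfBasisRight (M := F.obj X) b).injective ?_
  rw [map_zero]
  refine Finsupp.ext fun i => ?_
  have h := ambOut_swapLin F X (b.coord i) w
  rw [hw, map_zero] at h
  exact (TensorProduct.equivFinsuppOfBasisRight_apply b w i).trans h.symm

/-- Applying `F` to the decomposition of the identity in `sum_ambOut_ambIn` writes each element of
`F (X ⊗ V)` as a sum of images of the maps `F (- ⊗ b i)`. -/
lemma swapLin_surj_of_finite [Module.Finite k V] : Function.Surjective (swapLin F X V) := by
  intro z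
  let b := Module.Free.chooseBasis k V
  refine ⟨∑ i, (F.map (X.ambOut (b.coord i))).lin z ⊗ₜ b i, ?_⟩
  have h := congrArg (fun g => F.map g) (X.sum_ambOut_ambIn b)
  simp only [F.map_id, F.map_sum, F.map_comp] at h
  refine Eq.trans ?_ (LComod.congr_lin h z)
  rw [map_sum, LComod.sum_lin, LinearMap.sum_apply]
  exact Finset.sum_congr rfl fun i _ => swapLin_tmul F X _ _

/-- The diagram of the comodules `X ⊗ span S`, for finite subsets `S` of `V`. -/
def spanDiagram (V : Type u) [AddCommGroup V] [Module k V] : Finset V ⥤ LComod k B where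
  obj S := X.amb (Submodule.span k (S : Set V))
  map f := X.ambMap (Submodule.inclusion (Submodule.span_mono (leOfHom f)))
  map_id S := X.ambMap_id (Submodule.span k (S : Set V))
  map_comp f g := X.ambMap_comp (Submodule.inclusion (Submodule.span_mono (leOfHom g)))
    (Submodule.inclusion (Submodule.span_mono (leOfHom f)))

/-- The cocone from `X ⊗ span S` to `X ⊗ V`. -/
def spanCocone (V : Type u) [AddCommGroup V] [Module k V] : Cocone (spanDiagram X V) where
  pt := X.amb V
  ι :=
    { app := fun S => X.ambMap (Submodule.span k (S : Set V)).subtype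
      naturality := fun _ _ _ => (X.ambMap_comp _ _).symm }

/-- `X ⊗ V` is the filtered colimit of the `X ⊗ span S`. -/
def spanIsColimit (V : Type u) [AddCommGroup V] [Module k V] : IsColimit (spanCocone X V) :=
  LComod.isColimitOfElementwise (fun (z : X ⊗[k] V) => by
      classical
      induction z with
      | zero => exact ⟨∅, 0, map_zero _⟩
      | tmul x v => exact ⟨{v}, x ⊗ₜ ⟨v, Submodule.subset_span (by simp)⟩, rfl⟩
      | add s t hs ht =>
        obtain ⟨S, y, rfl⟩ := hs
        obtain ⟨T, z, rfl⟩ := ht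
        refine ⟨S ∪ T, ((spanDiagram X V).map (homOfLE Finset.subset_union_left)).lin y +
          ((spanDiagram X V).map (homOfLE Finset.subset_union_right)).lin z, ?_⟩
        rw [map_add]
        exact congrArg₂ _ (LComod.congr_lin ((spanCocone X V).w _) y)
          (LComod.congr_lin ((spanCocone X V).w _) z))
    -- The legs of the cocone are injective by flatness, so an element that vanishes in `X ⊗ V` is
    -- zero from the start and no later stage is needed.
    (fun S y hy => ⟨S, 𝟙 S, by
      have : y = 0 := lTensor_inj (X := X) (Submodule.span k (S : Set V)).injective_subtype
        (hy.trans (map_zero ((Submodule.span k (S : Set V)).subtype.lTensor X)).symm)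
      exact (congrArg ((spanDiagram X V).map (𝟙 S)).lin this).trans (map_zero _)⟩)

/-- Since `F` preserves the filtered colimit of the `X ⊗ span S`, each element of `F (X ⊗ V)` comes
from a finite-dimensional subspace, where `swapLin_surj_of_finite` applies; naturality brings the
preimage to `V`. -/
lemma swapLin_surj [PreservesFilteredColimits F] : Function.Surjective (swapLin F X V) := by
  intro z
  obtain ⟨S, y, rfl⟩ := LComod.exists_rep_of_isColimit (F ⋙ LComod.forget k B)
    (spanIsColimit X V) z
  obtain ⟨w, rfl⟩ := swapLin_surj_of_finite F X (V := Submodule.span k (S : Set V)) y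
  exact ⟨_, (swapLin_nat F X _ w).symm⟩

variable (V) in
/-- The canonical isomorphism `F X ⊗ V ≃ F (X ⊗ V)`. -/
def swap [PreservesFilteredColimits F] : F.obj X ⊗[k] V ≃ₗ[k] F.obj (X.amb V) :=
  LinearEquiv.ofBijective (swapLin F X V) ⟨swapLin_inj F X, swapLin_surj F X⟩

end Swap

end Copower

/-! ### The Hopf trimodule `F B` of a lax module functor `F`. -/

section Reconstruction

variable {k B : Type u} [Field k] [Ring B] [Bialgebra k B]

namespace LComod

lemma coactHom_nat {M N : LComod k B} (f : M ⟶ N) :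
    f ≫ N.coactHom = M.coactHom ≫ (reg k B).ambMap f.lin :=
  hom_ext fun m => lcomm_apply f m

/-- The comultiplication as a morphism `B ⟶ B ⊗ B` to a cofree comodule. -/
def regCoact (k B : Type u) [Field k] [Ring B] [Bialgebra k B] : reg k B ⟶ (reg k B).amb B :=
  (reg k B).coactHom

/-- The coaction of a cofree comodule. -/
def freeCoact (B : Type u) [Ring B] [Bialgebra k B] (V : Type u) [AddCommGroup V] [Module k V] :
    (reg k B).amb V ⟶ (reg k B).amb (B ⊗[k] V) :=
  ((reg k B).amb V).coactHom

/-- The insertion `b ↦ b ⊗ v` is colinear. This lets the image under `F` of the coaction of `B ⊗ V`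
be computed from the image of the comultiplication alone. -/
lemma ambIn_freeCoact {V : Type u} [AddCommGroup V] [Module k V] (v : V) :
    (reg k B).ambIn v ≫ freeCoact B V =
      regCoact k B ≫ (reg k B).ambMap ((TensorProduct.mk k B V).flip v) :=
  coactHom_nat ((reg k B).ambIn v)

/-- The multiplication of `B` as a morphism of left comodules. -/
def mulHom (k B : Type u) [Field k] [Ring B] [Bialgebra k B] : reg k B ⊗ reg k B ⟶ reg k B where
  lin := TensorProduct.lift (LinearMap.mul k B)
  lcomm := (HopfTrimodule.reg k B).act_lcoact

/-- The unit of `B` as a morphism of left comodules. -/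
def unitHom (k B : Type u) [Field k] [Ring B] [Bialgebra k B] : 𝟙_ (LComod k B) ⟶ reg k B where
  lin := Algebra.linearMap k B
  lcomm := LinearMap.ext_ring (by
    change Coalgebra.comul (Algebra.linearMap k B 1) =
      (Algebra.linearMap k B).lTensor B (1 ⊗ₜ 1)
    simp [Algebra.TensorProduct.one_def])

lemma mulHom_assoc : mulHom k B ▷ reg k B ≫ mulHom k B =
    (α_ (reg k B) (reg k B) (reg k B)).hom ≫ reg k B ◁ mulHom k B ≫ mulHom k B :=
  Hom.ext (TensorProduct.ext_threefold fun (a b c : B) => mul_assoc a b c)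

lemma unitHom_mulHom : unitHom k B ▷ reg k B ≫ mulHom k B = (λ_ (reg k B)).hom :=
  Hom.ext (TensorProduct.ext' fun (r : k) (b : B) => (Algebra.smul_def r b).symm)

/-- The morphism `(B ⊗ M) ⊗ (B ⊗ N) ⟶ B ⊗ (M ⊗ N)` given by the multiplication of `B`. -/
def shuffleHom (M N : Type u) [AddCommGroup M] [Module k M] [AddCommGroup N] [Module k N] :
    (reg k B).amb M ⊗ (reg k B).amb N ⟶ (reg k B).amb (M ⊗[k] N) where
  lin := shuffleL (LinearMap.mul k B)
  -- Colinearity expresses that the comultiplication of `B` is multiplicative, in the form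
  -- `comul_shuffle`.
  lcomm := TensorProduct.ext' fun (s : B ⊗[k] M) (t : B ⊗[k] N) =>
    (comul_shuffle s t).trans (congrArg ((shuffleL (LinearMap.mul k B)).lTensor B)
      (diagL_tmul (coL (Coalgebra.comul (R := k) (A := B))) (coL (Coalgebra.comul (R := k) (A := B)))
        s t).symm)

/-- On the slices through `m` and `n` the shuffle is just the multiplication of `B`. This links the
lax structure at cofree comodules with the action on `F B`, which is defined through `mulHom`. -/
lemma ambIn_shuffleHom {M N : Type u} [AddCommGroup M] [Module k M] [AddCommGroup N] [Module k N]
    (m : M) (n : N) : ((reg k B).ambIn m ⊗ₘ (reg k B).ambIn n) ≫ shuffleHom M N =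
      mulHom k B ≫ (reg k B).ambIn (m ⊗ₜ[k] n) :=
  Hom.ext (TensorProduct.ext' fun (b c : B) => shuffleL_tmul (LinearMap.mul k B) b m c n)

lemma regCoact_ambOut_counit :
    regCoact k B ≫ (reg k B).ambOut (Coalgebra.counit (R := k) (A := B)) = 𝟙 (reg k B) :=
  hom_ext fun (b : B) => by
    change TensorProduct.rid k B ((Coalgebra.counit (R := k) (A := B)).lTensor B
      (Coalgebra.comul b)) = b
    simp

lemma coactHom_condition (M : LComod k B) : M.coactHom ≫ freeCoact B M =
    M.coactHom ≫ (reg k B).ambMap M.lcoact := coactHom_nat M.coactHom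

/-- A comodule is an equalizer of cofree comodules. -/
def coactIsLimit (M : LComod k B) : IsLimit (Fork.ofι M.coactHom M.coactHom_condition) :=
  isLimitFork _ _ M.lcoact_inj fun z hz => by
    -- The condition `hz` says that `z` lies in `B □ M`, which the coaction identifies with `M`.
    obtain ⟨m, hm⟩ := M.leftUnit.surjective ⟨z, hz⟩
    exact ⟨m, congrArg (inc (Coalgebra.comul (R := k) (A := B)) M.lcoact) hm⟩

end LComod

open LComod

lemma LaxModEnd.μ_nat {C : Type*} [Category* C] [MonoidalCategory C] (F : LaxModEnd C)
    {c c' d d' : C} (f : c ⟶ c') (g : d ⟶ d') :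
    F.μ c d ≫ F.functor.map (f ⊗ₘ g) = (f ⊗ₘ F.functor.map g) ≫ F.μ c' d' := by
  rw [MonoidalCategory.tensorHom_def, MonoidalCategory.tensorHom_def, Category.assoc, F.μ_natR, F.functor.map_comp,
    ← Category.assoc, ← F.μ_natL, Category.assoc]

namespace LexLax

variable (F : LexLax k B)

instance : F.obj.functor.Additive := F.property.additive
instance : F.obj.functor.Linear k := F.property.linear
instance : PreservesFiniteLimits F.obj.functor := F.property.lex
instance : PreservesFilteredColimits F.obj.functor := F.property.finitary

/-- The value of a functor at the regular comodule. -/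
abbrev base : LComod k B := F.obj.functor.obj (reg k B)

/-- The canonical isomorphism `F B ⊗ V ≃ F (B ⊗ V)`. -/
abbrev swap (V : Type u) [AddCommGroup V] [Module k V] :
    F.base ⊗[k] V ≃ₗ[k] F.obj.functor.obj ((reg k B).amb V) :=
  HopfTri.swap F.obj.functor (reg k B) V

lemma swap_tmul {V : Type u} [AddCommGroup V] [Module k V] (x : F.base) (v : V) :
    F.swap V (x ⊗ₜ v) = (F.obj.functor.map ((reg k B).ambIn v)).lin x :=
  swapLin_tmul F.obj.functor (reg k B) x v

lemma swap_nat {V W : Type u} [AddCommGroup V] [Module k V] [AddCommGroup W] [Module k W]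
    (f : V →ₗ[k] W) (w : F.base ⊗[k] V) :
    (F.obj.functor.map ((reg k B).ambMap f)).lin (F.swap V w) =
      F.swap W (f.lTensor F.base w) := swapLin_nat F.obj.functor (reg k B) f w

/-- The map `F M → F B ⊗ M` obtained from `F M → F (B ⊗ M)`. -/
def coev (M : LComod k B) : F.obj.functor.obj M →ₗ[k] F.base ⊗[k] M :=
  (F.swap M).symm.toLinearMap ∘ₗ (F.obj.functor.map M.coactHom).lin

lemma swap_coev {M : LComod k B} (w : F.obj.functor.obj M) :
    F.swap M (F.coev M w) = (F.obj.functor.map M.coactHom).lin w :=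
  (F.swap M).apply_symm_apply _

lemma map_lin_comp {M N P : LComod k B} (f : M ⟶ N) (g : N ⟶ P) (w : F.obj.functor.obj M) :
    (F.obj.functor.map g).lin ((F.obj.functor.map f).lin w) =
      (F.obj.functor.map (f ≫ g)).lin w := by
  rw [F.obj.functor.map_comp]; rfl

lemma coev_nat {M N : LComod k B} (f : M ⟶ N) (w : F.obj.functor.obj M) :
    F.coev N ((F.obj.functor.map f).lin w) = f.lin.lTensor F.base (F.coev M w) := by
  refine (F.swap N).injective ?_
  rw [swap_coev, ← swap_nat, swap_coev, map_lin_comp, map_lin_comp, coactHom_nat]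

/-- Both ingredients of `coev` are colinear: `F.map M.coactHom` as a morphism of comodules, and
`swap` by `swapLin_lcomm`. For `M = B` this is the commutation of the two coactions on `F B`. -/
lemma coev_lcomm {M : LComod k B} (w : F.obj.functor.obj M) :
    (F.coev M).lTensor B ((F.obj.functor.obj M).lcoact w) =
      coL F.base.lcoact (F.coev M w) := by
  refine lTensor_inj (X := B) (F.swap M).injective ?_
  have h := swapLin_lcomm F.obj.functor (reg k B) (F.coev M w)
  refine Eq.trans ?_ h
  refine Eq.trans ?_ (congrArg _ (F.swap_coev w).symm)
  rw [lcomm_apply, ← LinearMap.lTensor_comp_apply]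
  exact DFunLike.congr_fun (congrArg (LinearMap.lTensor B) (LinearMap.ext F.swap_coev)) _

/-- The right coaction on `F B`. -/
def rco : F.base →ₗ[k] F.base ⊗[k] B := F.coev (reg k B)

lemma swap_rco (x : F.base) : F.swap B (F.rco x) = (F.obj.functor.map (regCoact k B)).lin x :=
  F.swap_coev (M := reg k B) x

/-- On `x ⊗ v`, naturality of `swap` along `b ↦ b ⊗ v` leaves only the definition of `rco`. Thus one
of the two maps cutting out `F B □ M` is the image under `F` of one arrow of the cofree fork of `M`;
for the other arrow this is `swap_nat`. -/
lemma swap_cf {V : Type u} [AddCommGroup V] [Module k V] (t : F.base ⊗[k] V) :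
    F.swap (B ⊗[k] V) (cf F.rco t) =
      (F.obj.functor.map (freeCoact B V)).lin (F.swap V t) := by
  refine DFunLike.congr_fun (f := (F.swap (B ⊗[k] V)).toLinearMap ∘ₗ cf F.rco)
    (g := (F.obj.functor.map (freeCoact B V)).lin ∘ₗ (F.swap V).toLinearMap) ?_ t
  refine TensorProduct.ext' fun x v => ?_
  have h := F.swap_nat ((TensorProduct.mk k B V).flip v) (F.rco x)
  rw [swap_rco, map_lin_comp, ← ambIn_freeCoact, ← map_lin_comp, ← swap_tmul] at h
  refine Eq.trans ?_ h.symm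
  simp only [LinearMap.comp_apply, LinearEquiv.coe_coe]
  rw [cf_tmul, assoc_tmul_right]

/-- This is `F` applied to the fork `coactHom_condition` and transported along `swap`. -/
lemma coev_mem {M : LComod k B} (w : F.obj.functor.obj M) :
    cf F.rco (F.coev M w) = cg M.lcoact (F.coev M w) := by
  refine (F.swap (B ⊗[k] M)).injective ?_
  rw [swap_cf, swap_coev, map_lin_comp, coactHom_condition, ← map_lin_comp, ← swap_coev]
  exact F.swap_nat M.lcoact (F.coev M w)

/-- The bicomodule structure on `F B`. -/
def bicomod : Bicomod k B where
  toLComod := F.base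
  rcoact := F.rco
  -- The right coaction is `coev` at the comodule `B`, whose own coaction is the comultiplication,
  -- so coassociativity is an instance of `coev_mem`.
  rcoassoc := LinearMap.ext fun x => F.coev_mem (M := reg k B) x
  rcounit := LinearMap.ext fun x => by
    -- The map `B ⊗ ε` splits the comultiplication, and `swap` turns the image of this splitting
    -- under `F` into `F B ⊗ ε`.
    have h := ambOut_swapLin F.obj.functor (reg k B) (Coalgebra.counit (R := k) (A := B)) (F.rco x)
    refine h.symm.trans ?_
    refine (congrArg _ (F.swap_rco x)).trans ?_
    rw [map_lin_comp, regCoact_ambOut_counit, F.obj.functor.map_id]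
    rfl
  bicomm := LinearMap.ext fun x => F.coev_lcomm (M := reg k B) x

/-- The action `B ⊗ F B ⟶ F B`. -/
def actHom : reg k B ⊗ F.base ⟶ F.base :=
  F.obj.μ (reg k B) (reg k B) ≫ F.obj.functor.map (mulHom k B)

/-- Naturality and associativity of the lax structure bring both multiplications inside `F`, where
the claim is the associativity of `B`. -/
lemma actHom_assoc : mulHom k B ▷ F.base ≫ F.actHom =
    (α_ (reg k B) (reg k B) F.base).hom ≫ reg k B ◁ F.actHom ≫ F.actHom := by
  simp only [actHom, MonoidalCategory.whiskerLeft_comp, Category.assoc]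
  rw [reassoc_of% F.obj.μ_natR, ← reassoc_of% F.obj.μ_assoc, ← F.obj.functor.map_comp,
    ← F.obj.functor.map_comp, ← mulHom_assoc, F.obj.functor.map_comp, reassoc_of% F.obj.μ_natL]

lemma unitHom_actHom : unitHom k B ▷ F.base ≫ F.actHom = (λ_ F.base).hom := by
  rw [actHom, reassoc_of% F.obj.μ_natL, ← F.obj.functor.map_comp, unitHom_mulHom, F.obj.μ_unit]

/-- The action of `B` on `F B` as a linear map. -/
def actLin : B →ₗ[k] Module.End k F.base := TensorProduct.curry (N := F.base) F.actHom.lin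

/-- The structure map `M ⊗ F N → F (M ⊗ N)` as a linear map. -/
def μLin (M N : LComod k B) :
    M ⊗[k] F.obj.functor.obj N →ₗ[k] F.obj.functor.obj (M ⊗ N) := (F.obj.μ M N).lin

lemma μLin_nat {M N M' N' : LComod k B} (f : M ⟶ M') (g : N ⟶ N') (m : M)
    (w : F.obj.functor.obj N) : (F.obj.functor.map (f ⊗ₘ g)).lin (F.μLin M N (m ⊗ₜ[k] w)) =
      F.μLin M' N' (f.lin m ⊗ₜ[k] (F.obj.functor.map g).lin w) :=
  congr_lin (F.obj.μ_nat f g) (m ⊗ₜ[k] w)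

/-- The structure map `(B ⊗ M) ⊗ F (B ⊗ N) → F ((B ⊗ M) ⊗ (B ⊗ N))`, followed by the image of the
multiplication `(B ⊗ M) ⊗ (B ⊗ N) → B ⊗ (M ⊗ N)`. -/
def shuffleμ (M N : Type u) [AddCommGroup M] [Module k M] [AddCommGroup N] [Module k N] :
    (B ⊗[k] M) ⊗[k] F.obj.functor.obj ((reg k B).amb N) →ₗ[k]
      F.obj.functor.obj ((reg k B).amb (M ⊗[k] N)) :=
  (F.obj.functor.map (shuffleHom M N)).lin ∘ₗ F.μLin ((reg k B).amb M) ((reg k B).amb N)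

/-- Naturality of the lax structure along the insertions of `m` and `n` reduces it to the pair `(B,
B)`; there `ambIn_shuffleHom` turns the shuffle into the multiplication that defines the action. -/
lemma swap_actLin {M N : Type u} [AddCommGroup M] [Module k M] [AddCommGroup N] [Module k N]
    (b : B) (x : F.base) (m : M) (n : N) : F.swap (M ⊗[k] N) (F.actLin b x ⊗ₜ[k] (m ⊗ₜ[k] n)) =
      F.shuffleμ M N ((b ⊗ₜ[k] m) ⊗ₜ[k] F.swap N (x ⊗ₜ[k] n)) := by
  have h := congrArg (F.obj.functor.map (shuffleHom M N)).lin
    (F.μLin_nat ((reg k B).ambIn m) ((reg k B).ambIn n) b x)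
  rw [map_lin_comp, ambIn_shuffleHom, ← map_lin_comp] at h
  rw [swap_tmul, swap_tmul]
  exact h

/-- This is the linear extension of `swap_actLin`: at cofree comodules, and up to the shuffle, the
lax structure is the action of `B` on `F B`. -/
lemma shuffle_swap {M N : Type u} [AddCommGroup M] [Module k M] [AddCommGroup N] [Module k N]
    (s : B ⊗[k] M) (t : F.base ⊗[k] N) :
    F.shuffleμ M N (s ⊗ₜ[k] F.swap N t) = F.swap (M ⊗[k] N) (shuffleL F.actLin (s ⊗ₜ t)) := by
  refine DFunLike.congr_fun
    (f := F.shuffleμ M N ∘ₗ TensorProduct.map LinearMap.id (F.swap N).toLinearMap)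
    (g := (F.swap (M ⊗[k] N)).toLinearMap ∘ₗ shuffleL F.actLin) ?_ (s ⊗ₜ t)
  refine TensorProduct.ext_fourfold' fun b m x n => ?_
  refine (F.swap_actLin b x m n).symm.trans ?_
  exact congrArg (F.swap (M ⊗[k] N)) (shuffleL_tmul F.actLin b m x n).symm

/-- The coaction of `M ⊗ N` is the tensor product of the two coactions followed by `shuffleHom`, so
naturality of the lax structure along the coactions reduces the general case to cofree comodules,
which is `shuffle_swap`. The right-hand side is the interchange formula `m₍₋₁₎ x ⊗ (m₍₀₎ ⊗ n)`: the
lax structure carries no information beyond the action. -/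
lemma coev_μ {M N : LComod k B} (m : M) (w : F.obj.functor.obj N) :
    F.coev (M ⊗ N) (F.μLin M N (m ⊗ₜ[k] w)) =
      shuffleL F.actLin (M.lcoact m ⊗ₜ F.coev N w) := by
  refine (F.swap (M ⊗[k] N)).injective ?_
  refine (F.swap_coev (M := M ⊗ N) _).trans ?_
  rw [← shuffle_swap, swap_coev]
  refine Eq.trans ?_ (congrArg (F.obj.functor.map (shuffleHom M N)).lin
    (F.μLin_nat M.coactHom N.coactHom m w))
  exact (F.map_lin_comp (M.coactHom ⊗ₘ N.coactHom) (shuffleHom M N) _).symm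

/-- This is the colinearity of `actHom` for the diagonal coaction on its source. -/
lemma lco_actLin (b : B) (x : F.base) : F.base.lcoact (F.actLin b x) =
    dact (LinearMap.mul k B) F.actLin (Coalgebra.comul b) (F.base.lcoact x) := by
  have h : TensorProduct.lift F.actLin = F.actHom.lin :=
    TensorProduct.ext' fun b x => TensorProduct.lift.tmul b x
  refine Eq.trans ?_ (dact_eq_shuffleL (LinearMap.mul k B) F.actLin _ _)
  rw [h]
  refine (lcomm_apply F.actHom (b ⊗ₜ[k] x)).trans (congrArg (F.actHom.lin.lTensor B) ?_)
  exact diagL_tmul (Coalgebra.comul (R := k) (A := B)) F.base.lcoact b x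

/-- Naturality of `coev` along the multiplication of `B` reduces this to `coev_μ` with `M = N = B`.
-/
lemma rco_actLin (b : B) (x : F.base) : F.rco (F.actLin b x) =
    dact F.actLin (LinearMap.mul k B) (Coalgebra.comul b) (F.rco x) := by
  refine (F.coev_nat (mulHom k B) (F.μLin (reg k B) (reg k B) (b ⊗ₜ[k] x))).trans ?_
  refine (congrArg _ (F.coev_μ (M := reg k B) (N := reg k B) b x)).trans ?_
  exact dact_eq_shuffleL F.actLin (LinearMap.mul k B) _ _

/-- The Hopf trimodule `F B`. -/
def trimodule : HopfTrimodule k B where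
  toBicomod := F.bicomod
  act := AlgHom.ofLinearMap F.actLin
    -- The unit of `B` is rewritten as the image of `1 : k`, so that `unitHom_actHom` applies to `1
    -- ⊗ x`.
    (LinearMap.ext fun x => (congrArg (fun b => F.actLin b x) (map_one (algebraMap k B)).symm).trans
      ((congr_lin F.unitHom_actHom ((1 : k) ⊗ₜ[k] x)).trans (one_smul k x)))
    (fun b c => LinearMap.ext fun x => congr_lin F.actHom_assoc ((b ⊗ₜ[k] c) ⊗ₜ[k] x))
  act_lcoact := TensorProduct.ext' fun b x => by
    refine Eq.trans ?_ (dact_eq_shuffleL (LinearMap.mul k B) F.actLin (Coalgebra.comul b)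
      (F.base.lcoact x)).symm
    exact F.lco_actLin b x
  act_rcoact := TensorProduct.ext' fun b x => by
    refine Eq.trans ?_ (dact_eq_shuffleR F.actLin (LinearMap.mul k B) (Coalgebra.comul b)
      (F.rco x)).symm
    exact F.rco_actLin b x

end LexLax

end Reconstruction

/-! ### The equivalence of categories. -/

section Equivalence

variable {k B : Type u} [Field k] [Ring B] [Bialgebra k B]

open LComod

namespace LexLax

variable {F G : LexLax k B}

/-- On `x ⊗ v` this is naturality of `φ` along the insertion of `v`. -/
lemma swap_app (φ : F ⟶ G) {V : Type u} [AddCommGroup V] [Module k V] (t : F.base ⊗[k] V) :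
    G.swap V ((φ.hom.nat.app (reg k B)).lin.rTensor V t) =
      (φ.hom.nat.app ((reg k B).amb V)).lin (F.swap V t) := by
  refine DFunLike.congr_fun
    (f := (G.swap V).toLinearMap ∘ₗ (φ.hom.nat.app (reg k B)).lin.rTensor V)
    (g := (φ.hom.nat.app ((reg k B).amb V)).lin ∘ₗ (F.swap V).toLinearMap) ?_ t
  refine TensorProduct.ext' fun x v => ?_
  refine (G.swap_tmul _ v).trans ?_
  refine Eq.trans ?_ (congrArg (φ.hom.nat.app ((reg k B).amb V)).lin (F.swap_tmul x v).symm)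
  exact (congr_lin (φ.hom.nat.naturality ((reg k B).ambIn v)) x).symm

/-- Naturality of `φ` along the coaction of `M` combines with `swap_app`. Under `coev` the component
of `φ` at `M` becomes `φ_B □ M`, so `φ` is determined by its component at `B`; for `M = B` it is
right colinearity of that component. -/
lemma coev_app (φ : F ⟶ G) {M : LComod k B} (w : F.obj.functor.obj M) :
    G.coev M ((φ.hom.nat.app M).lin w) =
      (φ.hom.nat.app (reg k B)).lin.rTensor M (F.coev M w) := by
  refine (G.swap M).injective ?_
  rw [swap_coev, swap_app, swap_coev]
  exact (congr_lin (φ.hom.nat.naturality M.coactHom) w).symm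

/-- Compatibility of `φ` with the lax structures at `(B, B)`, together with naturality along the
multiplication, makes its component at `B` linear for the actions. -/
lemma actHom_app (φ : F ⟶ G) : F.actHom ≫ φ.hom.nat.app (reg k B) =
    reg k B ◁ φ.hom.nat.app (reg k B) ≫ G.actHom := by
  have h := φ.hom.comm (reg k B) (reg k B)
  rw [actHom, actHom, Category.assoc, φ.hom.nat.naturality, ← reassoc_of% h]

/-- The Hopf trimodule morphism `F B ⟶ G B` of a module transformation `F ⟶ G`. -/
def trimoduleMap (φ : F ⟶ G) : F.trimodule ⟶ G.trimodule where
  lin := (φ.hom.nat.app (reg k B)).lin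
  lcomm := (φ.hom.nat.app (reg k B)).lcomm
  rcomm := LinearMap.ext fun x => coev_app φ (M := reg k B) x
  acomm b x := congr_lin (actHom_app φ) (b ⊗ₜ[k] x)

variable (k B) in
/-- The functor `F ↦ F B`. -/
def trimoduleFunctor : LexLax k B ⥤ HopfTrimodule k B where
  obj F := F.trimodule
  map φ := trimoduleMap φ
  map_id _ := rfl
  map_comp _ _ := rfl

/-- Left exactness keeps the fork `coactIsLimit` an equalizer, and equalizers of comodules are
injective on elements; `swap` is bijective. -/
lemma coev_inj (F : LexLax k B) (M : LComod k B) : Function.Injective (F.coev M) := by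
  have h := exists_of_isLimit_fork (isLimitForkMapOfIsLimit F.obj.functor
    M.coactHom_condition M.coactIsLimit)
  exact (F.swap M).symm.injective.comp h.1

/-- Surjectivity comes from the same preserved equalizer: `swap_cf` and `swap_nat` translate the
cotensor condition on `z` into the statement that the two image arrows agree on `F.swap M z`. -/
lemma exists_coev (F : LexLax k B) (M : LComod k B) (z : F.base ⊗[k] M)
    (hz : cf F.rco z = cg M.lcoact z) : ∃ w, F.coev M w = z := by
  have h := exists_of_isLimit_fork (isLimitForkMapOfIsLimit F.obj.functor
    M.coactHom_condition M.coactIsLimit)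
  obtain ⟨w, hw⟩ := h.2 (F.swap M z) (by
    rw [← swap_cf, hz]
    exact (F.swap_nat M.lcoact z).symm)
  exact ⟨w, (F.swap M).injective ((F.swap_coev w).trans hw)⟩

/-- The isomorphism `F M ≃ F B □ M`. -/
def coevEquiv (F : LexLax k B) (M : LComod k B) :
    F.obj.functor.obj M ≃ₗ[k] Cot F.rco M.lcoact :=
  LinearEquiv.ofBijective ((F.coev M).codRestrict _ fun w => F.coev_mem w)
    ⟨fun _ _ h => F.coev_inj M (congrArg Subtype.val h), fun z =>
      (F.exists_coev M z.1 z.2).imp fun _ h => Subtype.ext h⟩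

/-- The isomorphism of comodules `F M ≅ F B □ M`. -/
def coevIso (F : LexLax k B) (M : LComod k B) :
    F.obj.functor.obj M ≅ F.trimodule.cot M :=
  LComod.isoMk (N := F.trimodule.cot M) (F.coevEquiv M) fun w => by
    refine lTensor_inj (inc_inj F.rco M.lcoact) ?_
    refine (F.trimodule.cotL_spec M _).trans ?_
    refine (F.coev_lcomm w).symm.trans ?_
    exact LinearMap.lTensor_comp_apply B (inc F.rco M.lcoact) (F.coevEquiv M).toLinearMap _

/-- The natural isomorphism `F ≅ F B □ -`. -/
def coevNatIso (F : LexLax k B) : F.obj.functor ≅ F.trimodule.cotFunctor :=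
  NatIso.ofComponents F.coevIso fun {_ N} f => LComod.hom_ext fun w =>
    inc_inj F.rco N.lcoact (F.coev_nat f w)

/-- The isomorphism `F ≅ F B □ -` of lax module functors. -/
def coevLaxIso (F : LexLax k B) : F.obj ≅ (cotensorFunctor k B).obj F.trimodule :=
  LaxModEnd.isoOfId (F := F.obj) (G := (cotensorFunctor k B).obj F.trimodule) F.coevNatIso
    fun M N => by
      refine Hom.ext (TensorProduct.ext' fun (m : M) (w : F.obj.functor.obj N) => ?_)
      refine inc_inj F.rco (M ⊗ N).lcoact ?_
      -- The formula `coev_μ` is the interchange map of `F B □ -`, written in the ambient tensor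
      -- product.
      refine Eq.trans ?_ (F.coev_μ m w).symm
      exact chiAmb_tmul F.actLin M.lcoact m (F.coev N w)

end LexLax

variable (k B) in
/-- The functor from Hopf trimodules to left exact finitary lax module endofunctors. -/
abbrev cotensorLexLax : HopfTrimodule k B ⥤ LexLax k B :=
  (lexFinitary k B).lift (cotensorFunctor k B) lexFinitary_cotensorFunctor

namespace HopfTrimodule

variable (X : HopfTrimodule k B)

/-- For the functor `X □ -` the insertions act on the ambient tensor product, so `swap` is a
restriction of the associator. -/
lemma inc_swap {V : Type u} [AddCommGroup V] [Module k V]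
    (t : Cot X.rcoact (Coalgebra.comul (R := k) (A := B)) ⊗[k] V) :
    inc X.rcoact ((LComod.reg k B).amb V).lcoact (((cotensorLexLax k B).obj X).swap V t) =
      TensorProduct.assoc k X B V
        ((inc X.rcoact (Coalgebra.comul (R := k) (A := B))).rTensor V t) := by
  refine DFunLike.congr_fun
    (f := inc X.rcoact ((LComod.reg k B).amb V).lcoact ∘ₗ
      (((cotensorLexLax k B).obj X).swap V).toLinearMap)
    (g := (TensorProduct.assoc k X B V).toLinearMap ∘ₗ
        (inc X.rcoact (Coalgebra.comul (R := k) (A := B))).rTensor V) ?_ t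
  refine TensorProduct.ext' fun z v => ?_
  refine (congrArg (inc X.rcoact ((LComod.reg k B).amb V).lcoact)
    (((cotensorLexLax k B).obj X).swap_tmul z v)).trans ?_
  exact (assoc_tmul_right v (inc X.rcoact (Coalgebra.comul (R := k) (A := B)) z)).symm

/-- Written in `X ⊗ (B ⊗ B)`, this is coassociativity of the right coaction of `X`. -/
lemma rco_rightUnit (x : X) : ((cotensorLexLax k B).obj X).rco (X.rightUnit x) =
    X.rightUnit.toLinearMap.rTensor B (X.rcoact x) := by
  refine (((cotensorLexLax k B).obj X).swap B).injective ?_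
  refine (((cotensorLexLax k B).obj X).swap_rco _).trans ?_
  refine inc_inj X.rcoact ((LComod.reg k B).amb B).lcoact ?_
  refine Eq.trans ?_ (X.inc_swap _).symm
  refine (X.rcoact_mem x).symm.trans ?_
  exact congrArg (TensorProduct.assoc k X B B) (LinearMap.rTensor_comp_apply B
    (inc X.rcoact (Coalgebra.comul (R := k) (A := B))) X.rightUnit.toLinearMap (X.rcoact x))

/-- The reconstructed action on `X □ B` is the interchange at `(B, B)` followed by multiplication,
that is, the diagonal action on `X ⊗ B`; the right coaction of `X` is linear for it by `ract`. -/
lemma actLin_rightUnit (b : B) (x : X) :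
    X.rightUnit (X.actL b x) = ((cotensorLexLax k B).obj X).actLin b (X.rightUnit x) := by
  refine inc_inj X.rcoact (Coalgebra.comul (R := k) (A := B)) ?_
  refine (X.ract b x).trans ?_
  refine (dact_eq_shuffleL X.actL (LinearMap.mul k B) _ _).symm.trans ?_
  refine congrArg ((TensorProduct.lift (LinearMap.mul k B)).lTensor X) ?_
  exact (chiAmb_tmul X.actL (Coalgebra.comul (R := k) (A := B)) b (X.rcoact x)).symm

/-- The isomorphism `X ≅ X □ B` onto the trimodule reconstructed from `X □ -`. -/
def reconstructIso : X ≅ ((cotensorLexLax k B).obj X).trimodule :=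
  isoMk (Y := ((cotensorLexLax k B).obj X).trimodule)
    { lin := X.rightUnit.toLinearMap
      lcomm := X.rightUnitT.hom.lcomm
      rcomm := LinearMap.ext fun x => X.rco_rightUnit x
      acomm := X.actLin_rightUnit }
    X.rightUnit rfl

end HopfTrimodule

variable (k B) in
/-- Hopf trimodules are equivalent to left exact finitary lax module endofunctors. -/
def cotensorEquivalence : HopfTrimodule k B ≌ LexLax k B :=
  CategoryTheory.Equivalence.mk (cotensorLexLax k B) (LexLax.trimoduleFunctor k B)
    (NatIso.ofComponents HopfTrimodule.reconstructIso fun {X Y} f =>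
      -- Naturality of `X ≅ X □ B` in `X` is right colinearity of `f`.
      HopfTrimodule.Hom.ext (LinearMap.ext fun x =>
        inc_inj Y.rcoact (Coalgebra.comul (R := k) (A := B)) (DFunLike.congr_fun f.rcomm x)))
    (NatIso.ofComponents (fun F => ((lexFinitary k B).isoMk F.coevLaxIso).symm) fun {F G} φ => by
      rw [Iso.symm_hom, Iso.symm_hom, Iso.comp_inv_eq, Category.assoc, Iso.eq_inv_comp]
      refine ObjectProperty.hom_ext _ (LaxModEnd.hom_ext fun M => LComod.hom_ext fun w => ?_)
      -- Naturality of `F ≅ F B □ -` in `F` is `coev_app`.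
      exact inc_inj G.rco M.lcoact (LexLax.coev_app φ w).symm)

instance : (cotensorLexLax k B).IsEquivalence := (cotensorEquivalence k B).isEquivalence_functor

end Equivalence

/-! ### Compatibility with cotensor products and composition. -/

section Monoidal

variable {k B : Type u} [Field k] [Ring B] [Bialgebra k B]

/-- Interchange with the diagonal action on `X ⊗ Y` is interchange with `X` followed by
interchange with `Y`. -/
lemma chiAmb_diagAct {X Y M N : Type u} [AddCommGroup X] [Module k X] [AddCommGroup Y] [Module k Y]
    [AddCommGroup M] [Module k M] [AddCommGroup N] [Module k N]
    (aX : B →ₗ[k] Module.End k X) (aY : B →ₗ[k] Module.End k Y) {lM : M →ₗ[k] B ⊗[k] M}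
    (hM : ∀ m, TensorProduct.assoc k B B M
      ((Coalgebra.comul (R := k) (A := B)).rTensor M (lM m)) = lM.lTensor B (lM m))
    (w : M ⊗[k] ((X ⊗[k] Y) ⊗[k] N)) :
    TensorProduct.assoc k X Y (M ⊗[k] N) (chiAmb (diagAct aX aY) lM w) =
      (chiAmb aY lM).lTensor X
        (chiAmb aX lM ((TensorProduct.assoc k X Y N).toLinearMap.lTensor M w)) := by
  have h1 : ∀ (u : B ⊗[k] B) (m : M) (x : X) (y : Y) (n : N),
      TensorProduct.assoc k X Y (M ⊗[k] N) (dact aX aY u (x ⊗ₜ y) ⊗ₜ[k] (m ⊗ₜ[k] n)) =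
        (shuffleL aY).lTensor X (shuffleL aX
          (TensorProduct.assoc k B B M (u ⊗ₜ m) ⊗ₜ (x ⊗ₜ (y ⊗ₜ n)))) := fun u m x y n => by
    induction u with
    | zero => simp
    | add s t hs ht => simp only [TensorProduct.add_tmul, map_add, LinearMap.add_apply, hs, ht]
    | tmul b c => simp
  have h2 : ∀ (s : B ⊗[k] M) (x : X) (y : Y) (n : N),
      TensorProduct.assoc k X Y (M ⊗[k] N)
        (shuffleL (diagAct aX aY) (s ⊗ₜ ((x ⊗ₜ y) ⊗ₜ n))) =
        (shuffleL aY).lTensor X (shuffleL aX (TensorProduct.assoc k B B M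
          ((Coalgebra.comul (R := k) (A := B)).rTensor M s) ⊗ₜ (x ⊗ₜ (y ⊗ₜ n)))) :=
    fun s x y n => by
    induction s with
    | zero => simp
    | add s t hs ht => simp only [TensorProduct.add_tmul, map_add, hs, ht]
    | tmul b m =>
      rw [LinearMap.rTensor_tmul, ← h1, shuffleL_tmul]
      rfl
  have h3 : ∀ (s : B ⊗[k] M) (x : X) (y : Y) (n : N),
      (chiAmb aY lM).lTensor X (shuffleL aX (s ⊗ₜ (x ⊗ₜ (y ⊗ₜ n)))) =
        (shuffleL aY).lTensor X (shuffleL aX (lM.lTensor B s ⊗ₜ (x ⊗ₜ (y ⊗ₜ n)))) :=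
    fun s x y n => by
    induction s with
    | zero => simp
    | add s t hs ht => simp only [TensorProduct.add_tmul, map_add, hs, ht]
    | tmul b m => simp [chiAmb_tmul]
  refine DFunLike.congr_fun (f := (TensorProduct.assoc k X Y (M ⊗[k] N)).toLinearMap ∘ₗ
    chiAmb (diagAct aX aY) lM) (g := (chiAmb aY lM).lTensor X ∘ₗ chiAmb aX lM ∘ₗ
      (TensorProduct.assoc k X Y N).toLinearMap.lTensor M) ?_ w
  refine TensorProduct.ext' fun m w => ?_
  induction w with
  | zero => simp
  | add s t hs ht => simp only [TensorProduct.tmul_add, map_add, hs, ht]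
  | tmul z n =>
    induction z with
    | zero => simp
    | add s t hs ht => simp only [TensorProduct.tmul_add, TensorProduct.add_tmul, map_add, hs, ht]
    | tmul x y =>
      simp only [LinearMap.comp_apply, LinearEquiv.coe_coe, LinearMap.lTensor_tmul, chiAmb_tmul,
        TensorProduct.assoc_tmul]
      -- The diagonal action comultiplies `m₍₋₁₎`, whereas two successive interchanges coact on `m`
      -- twice; coassociativity of `M` makes these equal.
      rw [h2, h3, hM]

namespace HopfTrimodule

/-- The morphism `f □ g` for a morphism `f` of Hopf trimodules and `g` of left comodules. -/
def cotM {X Y : HopfTrimodule k B} {M N : LComod k B} (f : X ⟶ Y) (g : M ⟶ N) :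
    X.cot M ⟶ Y.cot N := Bicomod.cotHom f.toL f.rcomm g

lemma cotM_comp {X Y Z : HopfTrimodule k B} {M N P : LComod k B} (f : X ⟶ Y) (f' : Y ⟶ Z)
    (g : M ⟶ N) (g' : N ⟶ P) : cotM f g ≫ cotM f' g' = cotM (f ≫ f') (g ≫ g') :=
  LComod.hom_ext fun (z : Cot X.rcoact M.lcoact) => inc_inj Z.rcoact P.lcoact
    (map_tri (fun _ => rfl) (fun _ => rfl) (inc X.rcoact M.lcoact z))

lemma cotM_id (X : HopfTrimodule k B) (M : LComod k B) : cotM (𝟙 X) (𝟙 M) = 𝟙 (X.cot M) :=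
  LComod.hom_ext fun _ => inc_inj X.rcoact M.lcoact (DFunLike.congr_fun TensorProduct.map_id _)

lemma cotMapT_id (X Y : HopfTrimodule k B) : cotMapT (𝟙 X) (𝟙 Y) = 𝟙 (X.cotT Y) :=
  id_tensorHom_id X Y

/-- The inclusion of `X □ (Y □ M)` into `X ⊗ (Y ⊗ M)`. -/
def incRM (X Y : HopfTrimodule k B) (M : LComod k B) : X.cot (Y.cot M) →ₗ[k] X ⊗[k] (Y ⊗[k] M) :=
  incRight X.rcoact (Y.cotL M)

/-- The inclusion of `(X □ Y) □ M` into `(X ⊗ Y) ⊗ M`. -/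
def incLM (X Y : HopfTrimodule k B) (M : LComod k B) :
    (X.cotT Y).cot M →ₗ[k] (X ⊗[k] Y) ⊗[k] M :=
  incLeft M.lcoact (X.cotR Y.toBicomod)

lemma incRM_inj (X Y : HopfTrimodule k B) (M : LComod k B) : Function.Injective (incRM X Y M) :=
  incRight_inj

/-- The associativity isomorphism `(X □ Y) □ M ≅ X □ (Y □ M)`. -/
abbrev assocM (X Y : HopfTrimodule k B) (M : LComod k B) :
    (X.cotT Y).cot M ≅ X.cot (Y.cot M) := X.cotAssocIso Y.toBicomod M

lemma incRM_assocM (X Y : HopfTrimodule k B) (M : LComod k B) (z : (X.cotT Y).cot M) :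
    incRM X Y M ((assocM X Y M).hom.lin z) = TensorProduct.assoc k X Y M (incLM X Y M z) :=
  cotAssoc_spec (X.cotR_spec Y.toBicomod) (Y.cotL_spec M) z

lemma incRM_map {X Y X' Y' : HopfTrimodule k B} {M M' : LComod k B} (f : X ⟶ X') (g : Y ⟶ Y')
    (h : M ⟶ M') (z : X.cot (Y.cot M)) : incRM X' Y' M' ((cotM f (cotM g h)).lin z) =
      TensorProduct.map f.lin (TensorProduct.map g.lin h.lin) (incRM X Y M z) :=
  map_sq (a := f.lin) (c := LinearMap.id) (a' := LinearMap.id) (c' := f.lin)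
    (b := (cotM g h).lin) (d := inc Y'.rcoact M'.lcoact) (b' := inc Y.rcoact M.lcoact)
    (d' := TensorProduct.map g.lin h.lin) (fun _ => rfl) (fun _ => rfl)
    (inc X.rcoact (Y.cotL M) z)

lemma incLM_map {X Y X' Y' : HopfTrimodule k B} {M M' : LComod k B} (f : X ⟶ X') (g : Y ⟶ Y')
    (h : M ⟶ M') (z : (X.cotT Y).cot M) : incLM X' Y' M' ((cotM (cotMapT f g) h).lin z) =
      TensorProduct.map (TensorProduct.map f.lin g.lin) h.lin (incLM X Y M z) :=
  map_sq (b := h.lin) (d := LinearMap.id) (b' := LinearMap.id) (d' := h.lin)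
    (a := (cotMapT f g).lin) (c := inc X'.rcoact Y'.lcoact) (a' := inc X.rcoact Y.lcoact)
    (c' := TensorProduct.map f.lin g.lin) (fun _ => rfl) (fun _ => rfl)
    (inc (X.cotR Y.toBicomod) M.lcoact z)

lemma assocM_naturality {X Y X' Y' : HopfTrimodule k B} {M M' : LComod k B} (f : X ⟶ X')
    (g : Y ⟶ Y') (h : M ⟶ M') : cotM (cotMapT f g) h ≫ (assocM X' Y' M').hom =
      (assocM X Y M).hom ≫ cotM f (cotM g h) :=
  LComod.hom_ext fun z => incRM_inj X' Y' M' (by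
    refine (incRM_assocM X' Y' M' _).trans ?_
    refine Eq.trans ?_ (incRM_map f g h _).symm
    rw [incLM_map, incRM_assocM]
    exact (map_assoc_nat f.lin g.lin h.lin (incLM X Y M z)).symm)

/-- All maps are restricted from ambient tensor products, so after inclusion into `X ⊗ (Y ⊗ (M ⊗
N))` the claim becomes `chiAmb_diagAct`. -/
lemma assocM_chi (X Y : HopfTrimodule k B) (M N : LComod k B) :
    M ◁ (assocM X Y N).hom ≫ X.chi M (Y.cot N) ≫ cotM (𝟙 X) (Y.chi M N) =
      (X.cotT Y).chi M N ≫ (assocM X Y (M ⊗ N)).hom := by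
  refine LComod.hom_ext fun (t : M ⊗[k] (X.cotT Y).cot N) => incRM_inj X Y (M ⊗ N) ?_
  refine Eq.trans ?_ (incRM_assocM X Y (M ⊗ N) _).symm
  have h1 : incLM X Y (M ⊗ N) (((X.cotT Y).chi M N).lin t) =
      chiAmb (diagAct X.actL Y.actL) M.lcoact ((incLM X Y N).lTensor M t) := by
    -- The inclusion `X □ Y → X ⊗ Y` is linear for the diagonal action, so it commutes with the
    -- interchange.
    have h := chiAmb_act (f := inc X.rcoact Y.lcoact) (a := (X.cotT Y).actL)
      (a' := diagAct X.actL Y.actL) (fun _ _ => rfl) M.lcoact (N := N)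
      ((inc (X.cotR Y.toBicomod) N.lcoact).lTensor M t)
    refine Eq.trans h.symm ?_
    refine congrArg (chiAmb (diagAct X.actL Y.actL) M.lcoact) ?_
    exact map_tri (fun _ => rfl) (fun _ => rfl) t
  have h2 : ∀ s : M ⊗[k] X.cot (Y.cot N),
      incRM X Y (M ⊗ N) ((X.chi M (Y.cot N) ≫ cotM (𝟙 X) (Y.chi M N)).lin s) =
        (chiAmb Y.actL M.lcoact).lTensor X
          (chiAmb X.actL M.lcoact ((incRM X Y N).lTensor M s)) := fun s => by
    -- The intermediate term applies the interchange of `X` before including `Y □ N` into `Y ⊗ N`.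
    -- The first half is the description of the interchange of `Y` on ambient elements, the second
    -- is naturality of the interchange of `X` along that inclusion.
    refine Eq.trans (b := (chiAmb Y.actL M.lcoact).lTensor X
      (((inc Y.rcoact N.lcoact).lTensor M).lTensor X
        (chiAmb X.actL M.lcoact ((inc X.rcoact (Y.cotL N)).lTensor M s)))) ?_ ?_
    · exact map_sq (a := LinearMap.id) (c := LinearMap.id) (a' := LinearMap.id)
        (c' := LinearMap.id) (b := chiLin (lN := N.lcoact) Y.ract M.coassoc_apply)
        (d := inc Y.rcoact (diagL M.lcoact N.lcoact))
        (b' := (inc Y.rcoact N.lcoact).lTensor M) (d' := chiAmb Y.actL M.lcoact)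
        (fun _ => rfl) (inc_chiLin Y.ract M.coassoc_apply)
        (chiAmb X.actL M.lcoact ((inc X.rcoact (Y.cotL N)).lTensor M s))
    · refine congrArg ((chiAmb Y.actL M.lcoact).lTensor X) ?_
      have h := chiAmb_nat X.actL (lM := M.lcoact) (lM' := M.lcoact) (f := LinearMap.id)
        (by simp) (inc Y.rcoact N.lcoact) ((inc X.rcoact (Y.cotL N)).lTensor M s)
      refine Eq.trans h.symm ?_
      refine congrArg (chiAmb X.actL M.lcoact) ?_
      exact map_tri (fun _ => rfl) (fun _ => rfl) s
  rw [h1]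
  refine Eq.trans ?_ (chiAmb_diagAct X.actL Y.actL M.coassoc_apply _).symm
  refine (h2 _).trans ?_
  refine congrArg (fun w => (chiAmb Y.actL M.lcoact).lTensor X (chiAmb X.actL M.lcoact w)) ?_
  exact map_sq (a := LinearMap.id) (c := LinearMap.id) (a' := LinearMap.id) (c' := LinearMap.id)
    (b := (assocM X Y N).hom.lin) (d := incRM X Y N) (b' := incLM X Y N)
    (d' := (TensorProduct.assoc k X Y N).toLinearMap) (fun _ => rfl) (incRM_assocM X Y N) t

/-- The associators are restricted from those of `⊗`, so after inclusion into `W ⊗ (X ⊗ (Y ⊗ M))`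
this is the pentagon `assoc_pentagon`. It differs from `pentagonT` only in that the last factor is
merely a left comodule. -/
lemma pentagonM (W X Y : HopfTrimodule k B) (M : LComod k B) :
    cotM (assocT W X Y).hom (𝟙 M) ≫ (assocM W (X.cotT Y) M).hom ≫
      cotM (𝟙 W) (assocM X Y M).hom =
    (assocM (W.cotT X) Y M).hom ≫ (assocM W X (Y.cot M)).hom := by
  refine LComod.hom_ext fun z => ?_
  have inj : Function.Injective
      ((incRM X Y M).lTensor W ∘ₗ inc W.rcoact (X.cot (Y.cot M)).lcoact) :=
    (lTensor_inj (incRM_inj X Y M)).comp (inc_inj _ _)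
  refine inj ?_
  -- The element `v` is the image of `z` in the fully left-bracketed tensor product; each element
  -- along the two paths is expressed by reassociating `v`.
  let v : ((W ⊗[k] X) ⊗[k] Y) ⊗[k] M :=
    TensorProduct.map (incLf W X Y) LinearMap.id (inc ((W.cotT X).cotT Y).rcoact M.lcoact z)
  let u := (cotM (assocT W X Y).hom (𝟙 M)).lin z
  let w := (assocM W (X.cotT Y) M).hom.lin u
  let y := (assocM (W.cotT X) Y M).hom.lin z
  have hu : TensorProduct.map (TensorProduct.map LinearMap.id (inc X.rcoact Y.lcoact))
      LinearMap.id (incLM W (X.cotT Y) M u) =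
      TensorProduct.map (TensorProduct.assoc k W X Y).toLinearMap LinearMap.id v := by
    refine (map_tri (a' := incR W X Y) (b' := LinearMap.id) (fun _ => rfl) (fun _ => rfl)
      (inc (W.cotT (X.cotT Y)).rcoact M.lcoact u)).trans ?_
    exact map_sq (a := (assocT W X Y).hom.lin) (b := LinearMap.id) (incR_assocT W X Y)
      (fun _ => rfl) (inc ((W.cotT X).cotT Y).rcoact M.lcoact z)
  have hw : TensorProduct.map LinearMap.id (incLM X Y M)
      (inc W.rcoact ((X.cotT Y).cot M).lcoact w) = TensorProduct.assoc k W (X ⊗[k] Y) M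
      (TensorProduct.map (TensorProduct.assoc k W X Y).toLinearMap LinearMap.id v) := by
    rw [← hu]
    refine Eq.trans ?_ (map_assoc_nat (LinearMap.id (M := W)) (inc X.rcoact Y.lcoact)
      (LinearMap.id (M := M)) (incLM W (X.cotT Y) M u))
    refine Eq.trans ?_ (congrArg (TensorProduct.map LinearMap.id
      (TensorProduct.map (inc X.rcoact Y.lcoact) LinearMap.id)) (incRM_assocM W (X.cotT Y) M u))
    exact (map_tri (fun _ => rfl) (fun _ => rfl) _).symm
  have hl : ∀ w, TensorProduct.map LinearMap.id (incRM X Y M)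
      (inc W.rcoact (X.cot (Y.cot M)).lcoact ((cotM (𝟙 W) (assocM X Y M).hom).lin w)) =
      TensorProduct.map LinearMap.id (TensorProduct.assoc k X Y M).toLinearMap
        (TensorProduct.map LinearMap.id (incLM X Y M)
          (inc W.rcoact ((X.cotT Y).cot M).lcoact w)) := fun w =>
    map_sq (a := LinearMap.id) (b := (assocM X Y M).hom.lin) (fun _ => rfl) (incRM_assocM X Y M)
      (inc W.rcoact ((X.cotT Y).cot M).lcoact w)
  have hy : TensorProduct.map LinearMap.id (inc Y.rcoact M.lcoact) (incLM W X (Y.cot M) y) =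
      TensorProduct.assoc k (W ⊗[k] X) Y M v := by
    have h1 : TensorProduct.map LinearMap.id (inc Y.rcoact M.lcoact) (incLM W X (Y.cot M) y) =
        TensorProduct.map (inc W.rcoact X.lcoact) LinearMap.id (incRM (W.cotT X) Y M y) :=
      map_sq (a := inc W.rcoact X.lcoact) (c := LinearMap.id) (a' := LinearMap.id)
        (c' := inc W.rcoact X.lcoact) (b := LinearMap.id) (d := inc Y.rcoact M.lcoact)
        (b' := inc Y.rcoact M.lcoact) (d' := LinearMap.id) (fun _ => rfl) (fun _ => rfl)
        (inc (W.cotT X).rcoact (Y.cot M).lcoact y)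
    rw [h1]
    refine (congrArg (TensorProduct.map (inc W.rcoact X.lcoact) LinearMap.id)
      (incRM_assocM (W.cotT X) Y M z)).trans ?_
    have h2 := map_assoc_nat (inc W.rcoact X.lcoact) (LinearMap.id (M := Y)) (LinearMap.id (M := M))
      (incLM (W.cotT X) Y M z)
    rw [TensorProduct.map_id] at h2
    refine h2.trans ?_
    refine congrArg (TensorProduct.assoc k (W ⊗[k] X) Y M) ?_
    exact map_tri (fun _ => rfl) (fun _ => rfl) (inc ((W.cotT X).cotT Y).rcoact M.lcoact z)
  have hr : TensorProduct.map LinearMap.id (incRM X Y M)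
      (inc W.rcoact (X.cot (Y.cot M)).lcoact ((assocM W X (Y.cot M)).hom.lin y)) =
      TensorProduct.assoc k W X (Y ⊗[k] M) (TensorProduct.assoc k (W ⊗[k] X) Y M v) := by
    have h2 := map_assoc_nat (LinearMap.id (M := W)) (LinearMap.id (M := X))
      (inc Y.rcoact M.lcoact) (incLM W X (Y.cot M) y)
    rw [TensorProduct.map_id] at h2
    rw [← hy]
    refine Eq.trans ?_ h2
    refine Eq.trans ?_ (congrArg (TensorProduct.map LinearMap.id
      (TensorProduct.map LinearMap.id (inc Y.rcoact M.lcoact))) (incRM_assocM W X (Y.cot M) y))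
    exact (map_tri (fun _ => rfl) (fun _ => rfl) _).symm
  refine (hl w).trans ?_
  rw [hw, assoc_pentagon]
  exact hr.symm

/-- The isomorphism of comodules `M ≅ B □ M` given by the coaction. -/
def coactIso (M : LComod k B) : M ≅ (HopfTrimodule.reg k B).cot M := M.leftUnitIso

/-- Inside `X ⊗ (B ⊗ M)` the two sides are induced by the right coaction of `X` and the coaction of
`M`. They agree on `X □ M` by its definition. -/
lemma rightUnitT_assocM (X : HopfTrimodule k B) (M : LComod k B) :
    cotM X.rightUnitT.hom (𝟙 M) ≫ (assocM X (HopfTrimodule.reg k B) M).hom =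
      cotM (𝟙 X) (coactIso M).hom :=
  LComod.hom_ext fun (z : Cot X.rcoact M.lcoact) => incRM_inj X (HopfTrimodule.reg k B) M (by
    refine (incRM_assocM X (HopfTrimodule.reg k B) M _).trans ?_
    have h1 : incLM X (HopfTrimodule.reg k B) M ((cotM X.rightUnitT.hom (𝟙 M)).lin z) =
        X.rcoact.rTensor M (inc X.rcoact M.lcoact z) :=
      map_tri (fun _ => rfl) (fun _ => rfl) (inc X.rcoact M.lcoact z)
    have h2 : incRM X (HopfTrimodule.reg k B) M ((cotM (𝟙 X) (coactIso M).hom).lin z) =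
        M.lcoact.lTensor X (inc X.rcoact M.lcoact z) :=
      map_tri (fun _ => rfl) (fun _ => rfl) (inc X.rcoact M.lcoact z)
    rw [h1]
    exact (incl_mem z).trans h2.symm)

/-- Inside `B ⊗ (X ⊗ M)` this is the property that defines the coaction of `X □ M`. -/
lemma leftUnitT_assocM (X : HopfTrimodule k B) (M : LComod k B) :
    cotM X.leftUnitT.hom (𝟙 M) ≫ (assocM (HopfTrimodule.reg k B) X M).hom =
      (coactIso (X.cot M)).hom :=
  LComod.hom_ext fun (z : Cot X.rcoact M.lcoact) => incRM_inj (HopfTrimodule.reg k B) X M (by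
    refine (incRM_assocM (HopfTrimodule.reg k B) X M _).trans ?_
    have h1 : incLM (HopfTrimodule.reg k B) X M ((cotM X.leftUnitT.hom (𝟙 M)).lin z) =
        X.lcoact.rTensor M (inc X.rcoact M.lcoact z) :=
      map_tri (fun _ => rfl) (fun _ => rfl) (inc X.rcoact M.lcoact z)
    rw [h1]
    exact (X.cotL_spec M z).symm)

lemma coactIso_naturality {M N : LComod k B} (f : M ⟶ N) :
    f ≫ (coactIso N).hom = (coactIso M).hom ≫ cotM (𝟙 (HopfTrimodule.reg k B)) f :=
  LComod.hom_ext fun (m : M) => by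
    refine inc_inj (HopfTrimodule.reg k B).rcoact N.lcoact ?_
    exact LComod.lcomm_apply f m

/-- As `B` acts on itself by multiplication, interchanging `m` past the coaction of `n` gives `m₍₋₁₎
n₍₋₁₎ ⊗ (m₍₀₎ ⊗ n₍₀₎)`, the diagonal coaction. -/
lemma coactIso_chi (M N : LComod k B) :
    M ◁ (coactIso N).hom ≫ (HopfTrimodule.reg k B).chi M N = (coactIso (M ⊗ N)).hom :=
  LComod.hom_ext fun (t : M ⊗[k] N) =>
    inc_inj (Coalgebra.comul (R := k) (A := B)) (M ⊗ N).lcoact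
    (DFunLike.congr_fun (f := chiAmb (LinearMap.mul k B) M.lcoact ∘ₗ
      (inc (Coalgebra.comul (R := k) (A := B)) N.lcoact).lTensor M ∘ₗ
        N.leftUnit.toLinearMap.lTensor M) (g := diagL M.lcoact N.lcoact)
      (TensorProduct.ext' fun m n => (chiAmb_tmul _ _ m (N.lcoact n)).trans
        (diagL_tmul M.lcoact N.lcoact m n).symm) t)

/-- The isomorphism of lax module functors from `(X □ Y) □ -` to the composite of `X □ -` and
`Y □ -`. -/
def assocLaxIso (X Y : HopfTrimodule k B) : (cotensorFunctor k B).obj (X.cotT Y) ≅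
    ((cotensorFunctor k B).obj X).comp ((cotensorFunctor k B).obj Y) :=
  LaxModEnd.isoOfId (F := (cotensorFunctor k B).obj (X.cotT Y))
    (G := ((cotensorFunctor k B).obj X).comp ((cotensorFunctor k B).obj Y))
    (NatIso.ofComponents (F := (X.cotT Y).cotFunctor) (G := Y.cotFunctor ⋙ X.cotFunctor)
      (fun M => assocM X Y M) fun f => by
        refine Eq.trans ?_ (assocM_naturality (𝟙 X) (𝟙 Y) f)
        rw [cotMapT_id]
        rfl)
    fun M N => assocM_chi X Y M N

/-- The coactions as an isomorphism of lax module functors from the identity to `B □ -`. -/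
def unitLaxIso (k B : Type u) [Field k] [Ring B] [Bialgebra k B] :
    LaxModEnd.unit ≅ (cotensorFunctor k B).obj (HopfTrimodule.reg k B) :=
  LaxModEnd.isoOfId (F := LaxModEnd.unit)
    (G := (cotensorFunctor k B).obj (HopfTrimodule.reg k B))
    (NatIso.ofComponents (F := 𝟭 _) (G := (HopfTrimodule.reg k B).cotFunctor)
      (coactIso) fun f => coactIso_naturality f)
    -- The lax structure of the identity functor is the identity, hence the extra
    -- `Category.id_comp`.
    fun M N => (coactIso_chi M N).trans (Category.id_comp _).symm

variable (k B) in
/-- The monoidal structure on `X ↦ (X □ -, χ)`. -/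
def coreMonoidal : (cotensorLexLax k B).CoreMonoidal :=
  Functor.CoreMonoidal.mk'
    ((lexFinitary k B).isoMk (unitLaxIso k B))
    -- The isomorphism `assocLaxIso` starts at the functor of `X □ Y`, so the tensorator is its
    -- inverse. The coherence conditions that follow are in terms of the inverse structure maps,
    -- where `assocM` appears directly.
    (fun X Y => ((lexFinitary k B).isoMk (X := (cotensorLexLax k B).obj (X.cotT Y))
      (Y := (cotensorLexLax k B).obj X ⊗ (cotensorLexLax k B).obj Y) (assocLaxIso X Y)).symm)
    (fun {X Y} f Z => ObjectProperty.hom_ext _ (LaxModEnd.hom_ext fun M => by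
      have h := assocM_naturality f (𝟙 Z) (𝟙 M)
      rw [cotM_id] at h
      refine Eq.trans (congrArg ((assocM X Z M).hom ≫ ·) ?_) h.symm
      refine (cotM_comp f (𝟙 Y) (𝟙 (Z.cot M)) (𝟙 (Z.cot M))).trans ?_
      rw [Category.comp_id, Category.comp_id]))
    (fun {X Y} Z f => ObjectProperty.hom_ext _ (LaxModEnd.hom_ext fun M => by
      refine Eq.trans (congrArg ((assocM Z X M).hom ≫ ·) ?_)
        (assocM_naturality (𝟙 Z) f (𝟙 M)).symm
      exact Category.id_comp _))
    (fun X Y Z => ObjectProperty.hom_ext _ (LaxModEnd.hom_ext fun M => by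
      -- Composition of functors is associative with identity components, so after removal of
      -- identities the hexagon is `pentagonM`.
      change (assocM (X.cotT Y) Z M).hom ≫ ((assocM X Y (Z.cot M)).hom ≫
          cotM (𝟙 X) (cotM (𝟙 Y) (𝟙 (Z.cot M)))) ≫ 𝟙 (X.cot (Y.cot (Z.cot M))) =
        cotM (assocT X Y Z).hom (𝟙 M) ≫ (assocM X (Y.cotT Z) M).hom ≫
          𝟙 (X.cot ((Y.cotT Z).cot M)) ≫ cotM (𝟙 X) (assocM Y Z M).hom
      rw [cotM_id, cotM_id, Category.comp_id, Category.comp_id, Category.id_comp, pentagonM]))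
    (fun X => ObjectProperty.hom_ext _ (LaxModEnd.hom_ext fun M => by
      -- The unitors of `LexLax` have identity components. The inverse of the left unitor
      -- `leftUnitT` composed with `assocM` is a coaction by `leftUnitT_assocM`, and it cancels
      -- against the inverse coaction.
      change 𝟙 (X.cot M) = cotM X.leftUnitT.hom (𝟙 M) ≫ (assocM (HopfTrimodule.reg k B) X M).hom ≫
        (coactIso (X.cot M)).inv ≫ 𝟙 (X.cot M)
      rw [Category.comp_id, ← Category.assoc, leftUnitT_assocM]
      exact (coactIso (X.cot M)).hom_inv_id.symm))
    (fun X => ObjectProperty.hom_ext _ (LaxModEnd.hom_ext fun M => by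
      change 𝟙 (X.cot M) = cotM X.rightUnitT.hom (𝟙 M) ≫
        (assocM X (HopfTrimodule.reg k B) M).hom ≫ 𝟙 (X.cot ((HopfTrimodule.reg k B).cot M)) ≫
          cotM (𝟙 X) (coactIso M).inv
      rw [Category.id_comp, ← Category.assoc, rightUnitT_assocM, cotM_comp, Category.comp_id,
        Iso.hom_inv_id, cotM_id]))

end HopfTrimodule

end Monoidal

end HopfTri

end Main

/-- `X ↦ (X □ -, χ)`, `f ↦ f □ -` takes values in left exact finitary `k`-linear lax module
endofunctors of the category of left `B`-comodules, and is a monoidal equivalence from Hopf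
trimodules, with the cotensor product and unit `B`, to these, with composition. The
monoidal structure isomorphisms are the associativity isomorphisms
`X □ (Y □ M) ≅ (X □ Y) □ M` and the coactions `M ≅ B □ M`. -/
theorem theorem7p1 (k B : Type u) [Field k] [Ring B] [Bialgebra k B] :
    ∃ h : ∀ X : HopfTri.HopfTrimodule k B,
        HopfTri.lexFinitary k B ((HopfTri.cotensorFunctor k B).obj X),
      ((HopfTri.lexFinitary k B).lift (HopfTri.cotensorFunctor k B) h).IsEquivalence ∧
      ∃ _ : ((HopfTri.lexFinitary k B).lift (HopfTri.cotensorFunctor k B) h).Monoidal,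
        (∀ (X Y : HopfTri.HopfTrimodule k B) (M : HopfTri.LComod k B),
          (Functor.LaxMonoidal.μ
            ((HopfTri.lexFinitary k B).lift (HopfTri.cotensorFunctor k B) h) X Y).hom.nat.app M =
              (X.cotAssocIso Y.toBicomod M).inv) ∧
        (∀ M : HopfTri.LComod k B,
          (Functor.LaxMonoidal.ε
            ((HopfTri.lexFinitary k B).lift (HopfTri.cotensorFunctor k B) h)).hom.nat.app M =
              M.leftUnitIso.hom) :=
  ⟨HopfTri.lexFinitary_cotensorFunctor, inferInstanceAs (HopfTri.cotensorLexLax k B).IsEquivalence,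
    (HopfTri.HopfTrimodule.coreMonoidal k B).toMonoidal, fun _ _ _ => rfl, fun _ => rfl⟩
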